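/- **Setting.** Let $Q$ be a global function field with exact constant field $\mathbb{F}_q$ (of characteristic $p$), let $\infty$ be a place of $Q$, and let $A\subset Q$ be the ring of elements that are regular outside $\infty$; $\hat A=\varprojlim_I A/I$ denotes its profinite completion. Let $K$ be a global function field that is a $Q$-algebra. For a finite extension $L/K$, let $\mathcal{O}_L$ be the integral closure of $A$ in $L$, put $L_\infty=L\otimes_Q Q_\infty$, and for a finite place $v$ of $K$ (one whose valuation ring contains $A$) put $L_v=L\otimes_K K_v$ and $\mathfrak{f}\mathcal{O}_{L,v}=\mathrm{im}(\mathfrak{f}\otimes\mathcal{O}_{K,v}\to L_v)$ for an ideal $\mathfrak{f}$ of $\mathcal{O}_L$. Let $E$ be a Drinfeld $A$-module over $\mathcal{O}_K$, that is, an $\mathbb{F}_q$-algebra homomorphism $\phi:A\to\mathcal{O}_K\{\tau\}$ such that the constant coefficient of $\phi(a)$ is the image of $a$; for an $\mathcal{O}_K$-algebra $R$, $E(R)$ is $R$ with the $A$-action through $\phi$, where $\tau$ acts as $x\mapsto x^q$. Let $\exp_E(X)=\sum_{i\ge0}e_iX^{q^i}$ ($e_0=1$, $e_i\in K$) be its exponential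 series, so $\exp_E(aX)=\phi(a)(\exp_E(X))$. For a nonzero ideal $\mathfrak{f}$ of $\mathcal{O}_L$ (a modulus) let $$H_{\mathfrak f}(E/\mathcal{O}_L)=\mathrm{coker}\Big(E(L)\to \frac{E(L_\infty)}{\exp_E(L_\infty)}\oplus\bigoplus_{v}\frac{E(L_v)}{E(\mathfrak{f}\mathcal{O}_{L,v})}\Big),$$ where $v$ runs over the finite places of $K$ and the map is diagonal. For a finite set $S$ of finite places of $K$ let $$H_S(E/\mathcal{O}_L)=\varprojlim_{\mathfrak f}H_{\mathfrak f}(E/\mathcal{O}_L),$$ where $\mathfrak f$ runs over the moduli of $L$ all of whose prime divisors lie above $S$. Each $H_{\mathfrak f}(E/\mathcal{O}_L)$ is annihilated by an ideal of finite index of $A$, so $H_S(E/\mathcal{O}_L)$ is naturally an $\hat A$-module. For $K\subset L\subset L'$ with $L'/L$ finite, the trace $L'\to L$ induces maps $H_{\mathfrak f\mathcal{O}_{L'}}(E/\mathcal{O}_{L'})\to H_{\mathfrak f}(E/\mathcal{O}_L)$ and, in the limit, a map $H_S(E/\mathcal{O}_{L'})\to H_S(E/\mathcal{O}_L)$. If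 $L/K$ is Galois, $\mathrm{Gal}(L/K)$ acts $\hat A$-linearly on $H_S(E/\mathcal{O}_L)$. For a group $G$ acting on an $\hat A$-module $H$, $H_G$ is the quotient of $H$ by the $\hat A$-submodule generated by all $\sigma x-x$ ($\sigma\in G$, $x\in H$). **Proposition.** Let $S$ be a finite set of finite places of $K$. 1. Let $K'/K$ be a finite Galois extension with group $G$ that is tamely ramified at every finite place $v\notin S$ of $K$. Then the map induced by the trace gives an isomorphism of $\hat A$-modules $$H_S(E/\mathcal{O}_{K'})_G\;\simeq\;H_S(E/\mathcal{O}_K).$$ 2. Let $\mathcal K/K$ be a $\mathbb{Z}_p$-extension with group $\Gamma$, let $K_n$ be its $n$-th layer (the fixed field of $\Gamma^{p^n}$), and let $H_S(E/\mathcal{O}_{\mathcal K})=\varprojlim_n H_S(E/\mathcal{O}_{K_n})$, the limit being taken with respect to the maps induced by the traces. If $S$ contains every finite place of $K$ that is ramified in $\mathcal K/K$, then for every $n\ge0$ the projection gives an isomorphism of $\hat A$-modules $$H_S(E/\mathcal{O}_{\mathcal K})_{\Gamma^{p^n}}\;\simeq\;H_S(E/\mathcal{O}_{K_n}).$$ 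-/

import Mathlib

open scoped TensorProduct DirectSum

noncomputable section

namespace TaelmanClassGroup

/-! ### Global function fields, places, completions -/

/-- `F` is a global function field over the finite field `Fq`: a finite extension of a rational
function field `Fq(x)` in one variable. -/
def IsGlobalFunctionField (Fq F : Type*) [Field Fq] [Field F] [Algebra Fq F] : Prop :=
  ∃ x : F, Transcendental Fq x ∧ FiniteDimensional (IntermediateField.adjoin Fq {x}) F

/-- The completion `F_v` of the field `F` at the place `v`. A place of a global function field is
given by its valuation ring, a valuation subring `v ≠ ⊤` of `F`. -/
abbrev Cmpl {F : Type*} [Field F] (v : ValuationSubring F) : Type _ := v.valuation.Completion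

instance {F : Type*} [Field F] (v : ValuationSubring F) : Algebra F (Cmpl v) :=
  ((UniformSpace.Completion.coeRingHom (α := WithVal v.valuation)).comp
    ((WithVal.equiv v.valuation).symm : F →+* WithVal v.valuation)).toAlgebra

/-- The valuation ring `𝒪_{F,v}` of the completion `F_v`. -/
def cmplInt {F : Type*} [Field F] (v : ValuationSubring F) : Subring (Cmpl v) :=
  (Valued.v : Valuation (Cmpl v) v.ValueGroup).integer

theorem algebraMap_mem_valuationSubring {Fq Q : Type*} [Field Fq] [Fintype Fq] [Field Q]
    [Algebra Fq Q] (v : ValuationSubring Q) (c : Fq) : algebraMap Fq Q c ∈ v := by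
  rcases eq_or_ne c 0 with rfl | hc
  · simp
  · rcases v.mem_or_inv_mem (algebraMap Fq Q c) with h | h
    · exact h
    · have h1 : algebraMap Fq Q c = (algebraMap Fq Q c)⁻¹ ^ (Fintype.card Fq - 2) := by
        have hcard : 1 < Fintype.card Fq := Fintype.one_lt_card
        have h2 : c ^ (Fintype.card Fq - 1) = 1 := FiniteField.pow_card_sub_one_eq_one c hc
        have h3 : Fintype.card Fq - 1 = (Fintype.card Fq - 2) + 1 := by omega
        rw [h3, pow_succ] at h2
        have h4 : c = c⁻¹ ^ (Fintype.card Fq - 2) := by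
          rw [inv_pow]
          exact eq_inv_of_mul_eq_one_right h2
        conv_lhs => rw [h4]
        simp
      rw [h1]
      exact pow_mem h _

/-- The ring `A ⊆ Q` of the elements of `Q` that are regular outside the place `∞`. -/
def regularRing (Fq : Type*) {Q : Type*} [Field Fq] [Fintype Fq] [Field Q] [Algebra Fq Q]
    (inf : ValuationSubring Q) : Subalgebra Fq Q where
  carrier := {x | ∀ v : ValuationSubring Q, v ≠ ⊤ → v ≠ inf → x ∈ v}
  mul_mem' hx hy v h1 h2 := mul_mem (hx v h1 h2) (hy v h1 h2)
  add_mem' hx hy v h1 h2 := add_mem (hx v h1 h2) (hy v h1 h2)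
  algebraMap_mem' c v _ _ := algebraMap_mem_valuationSubring v c

instance {Fq Q : Type*} [Field Fq] [Fintype Fq] [Field Q] [Algebra Fq Q]
    [IsIntegrallyClosedIn Fq Q] (inf : ValuationSubring Q) :
    IsIntegrallyClosedIn Fq (regularRing Fq inf) where
  algebraMap_injective := (algebraMap Fq (regularRing Fq inf)).injective
  isIntegral_iff {x} := by
    have h : IsIntegral Fq x ↔ IsIntegral Fq (x : Q) :=
      (isIntegral_algHom_iff (regularRing Fq inf).val Subtype.val_injective).symm
    rw [h, IsIntegrallyClosedIn.isIntegral_iff]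
    constructor
    · rintro ⟨y, hy⟩
      exact ⟨y, Subtype.ext hy⟩
    · rintro ⟨y, hy⟩
      exact ⟨y, congrArg Subtype.val hy⟩

section Rings

variable (A K : Type*) [CommRing A] [Field K] [Algebra A K]

/-- The integer ring `𝒪_K`, the integral closure of `A` in `K`. -/
abbrev IntRing : Type _ := ↥(integralClosure A K)

/-- The finite places of `K`: the places whose valuation ring contains `A`. -/
abbrev FinPlace : Type _ := {v : ValuationSubring K // v ≠ ⊤ ∧ ∀ a : A, algebraMap A K a ∈ v}

end Rings

/-- The ramification index of the place `w` of `L` over the field `K`, that is, the index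
`[w(Lˣ) : w(Kˣ)]` of value groups (with the convention that it is `0` if this index is infinite). -/
def ramIdx (K : Type*) {L : Type*} [Field K] [Field L] [Algebra K L] (w : ValuationSubring L) : ℕ :=
  (Units.map ((w.valuation : L →* w.ValueGroup).comp
    (algebraMap K L : K →* L))).range.index

/-- `L/K` is tamely ramified at the place `v` of `K`: for every place `w` of `L` above `v` the
ramification index is prime to the residue characteristic `p`. (Residue fields are finite, so that
the residue extensions are automatically separable.) -/
def IsTameAt (p : ℕ) {K : Type*} (L : Type*) [Field K] [Field L] [Algebra K L]
    (v : ValuationSubring K) : Prop :=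
  ∀ w : ValuationSubring L, w.comap (algebraMap K L) = v → ¬ p ∣ ramIdx K w

/-- `L/K` is ramified at the place `v` of `K`: some place of `L` above `v` has a ramification index
different from `1`. Here `L/K` is algebraic, possibly infinite. (Residue fields are algebraic
over finite fields, so that the residue extensions are automatically separable.) -/
def IsRamifiedAt {K : Type*} (L : Type*) [Field K] [Field L] [Algebra K L]
    (v : ValuationSubring K) : Prop :=
  ∃ w : ValuationSubring L, w.comap (algebraMap K L) = v ∧ ramIdx K w ≠ 1

/-! ### Twisted polynomials and Drinfeld modules -/

section Twisted

variable (Fq : Type*) [Field Fq] [Fintype Fq]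

/-- The ring `R`, on which the generator `τ` of the monoid `ℕ` acts by the `q`-th Frobenius map. -/
def FrobRing (_Fq R : Type*) : Type _ := R

instance (R : Type*) [CommRing R] : CommRing (FrobRing Fq R) := inferInstanceAs (CommRing R)

instance (R : Type*) [CommRing R] [Algebra Fq R] : Algebra Fq (FrobRing Fq R) :=
  inferInstanceAs (Algebra Fq R)

/-- The identity map from `FrobRing Fq R` to `R`. -/
def FrobRing.val (R : Type*) [CommRing R] : FrobRing Fq R ≃+* R := RingEquiv.refl R

theorem add_pow_card_pow (R : Type*) [CommRing R] [Algebra Fq R] (n : ℕ) (x y : R) :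
    (x + y) ^ (Fintype.card Fq ^ n) = x ^ (Fintype.card Fq ^ n) + y ^ (Fintype.card Fq ^ n) := by
  induction n with
  | zero => simp
  | succ n ih =>
    rw [pow_succ, pow_mul, ih, pow_mul, pow_mul]
    exact map_add (FiniteField.frobeniusAlgHom Fq R) _ _

theorem zero_pow_card_pow (R : Type*) [CommRing R] (n : ℕ) :
    (0 : R) ^ (Fintype.card Fq ^ n) = 0 :=
  zero_pow (pow_ne_zero _ Fintype.card_ne_zero)

instance (R : Type*) [CommRing R] [Algebra Fq R] :
    MulSemiringAction (Multiplicative ℕ) (FrobRing Fq R) where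
  smul n x := (x ^ (Fintype.card Fq ^ n.toAdd) : R)
  one_smul x := by
    change (x ^ (Fintype.card Fq ^ 0) : R) = x
    rw [pow_zero, pow_one]
  mul_smul m n x := by
    change (x ^ (Fintype.card Fq ^ (m.toAdd + n.toAdd)) : R) =
      ((x ^ (Fintype.card Fq ^ n.toAdd)) ^ (Fintype.card Fq ^ m.toAdd) : R)
    rw [← pow_mul, ← pow_add, add_comm]
  smul_zero n := zero_pow_card_pow Fq R n.toAdd
  smul_add n x y := add_pow_card_pow Fq R n.toAdd x y
  smul_one n := one_pow (M := R) _
  smul_mul n x y := mul_pow (M := R) x y _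

theorem frobRing_smul_def (R : Type*) [CommRing R] [Algebra Fq R] (n : Multiplicative ℕ)
    (x : FrobRing Fq R) : n • x = x ^ (Fintype.card Fq ^ n.toAdd) := rfl

instance (R : Type*) [CommRing R] [Algebra Fq R] :
    SMulCommClass (Multiplicative ℕ) Fq (FrobRing Fq R) where
  smul_comm n c x := by
    rw [frobRing_smul_def, frobRing_smul_def, Algebra.smul_def, Algebra.smul_def, mul_pow,
      ← map_pow, FiniteField.pow_card_pow]

/-- The ring `R{τ}` of twisted polynomials, with `(a τ^i) (b τ^j) = a b^(q^i) τ^(i+j)`. -/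
abbrev TwistedPoly (R : Type*) [CommRing R] : Type _ := SkewPolynomial (FrobRing Fq R)

variable (A K : Type*) [CommRing A] [Algebra Fq A] [Field K] [Algebra Fq K] [Algebra A K]
  [IsScalarTower Fq A K]

/-- A Drinfeld `A`-module over `𝒪_K`: a homomorphism `φ : A → 𝒪_K{τ}` of `Fq`-algebras such that
the constant coefficient of `φ(a)` is the image of `a` in `𝒪_K`. (It is not required that
`φ(A)` is not contained in `𝒪_K`.) -/
structure DrinfeldModule where
  /-- The structure homomorphism. -/
  φ : A →ₐ[Fq] TwistedPoly Fq (IntRing A K)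
  coeff_zero : ∀ a : A, (φ a).coeff 0 = algebraMap A (IntRing A K) a

end Twisted

/-! ### The functor `E` -/

section Points

/-- The `q`-th Frobenius map of an `Fq`-algebra as an additive endomorphism. -/
def frobEnd (Fq R : Type*) [Field Fq] [Fintype Fq] [CommRing R] [Algebra Fq R] : AddMonoid.End R :=
  (FiniteField.frobeniusAlgHom Fq R : R →+ R)

theorem frobEnd_pow_apply (Fq R : Type*) [Field Fq] [Fintype Fq] [CommRing R] [Algebra Fq R]
    (n : ℕ) (x : R) : (frobEnd Fq R ^ n) x = x ^ (Fintype.card Fq ^ n) := by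
  induction n generalizing x with
  | zero => simp
  | succ n ih =>
    rw [pow_succ]
    change (frobEnd Fq R ^ n) (x ^ Fintype.card Fq) = _
    rw [ih]
    rw [← pow_mul, pow_succ']

/-- A commutative `O`-algebra `R` as a left `O{τ}`-module: `∑ cᵢ τ^i` acts on `R` as
`x ↦ ∑ cᵢ x^(q^i)`. -/
def evalHom (Fq O R : Type*) [Field Fq] [Fintype Fq] [CommRing O] [Algebra Fq O] [CommRing R]
    [Algebra O R] : TwistedPoly Fq O →+* AddMonoid.End R :=
  letI : Algebra Fq R := ((algebraMap O R).comp (algebraMap Fq O)).toAlgebra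
  SkewMonoidAlgebra.liftNCRingHom (k := FrobRing Fq O)
    (show O →+* AddMonoid.End R from Module.toAddMonoidEnd O R)
    (powersHom (AddMonoid.End R) (frobEnd Fq R)) (by
      intro x n
      ext r
      change (show O from n • x) • ((frobEnd Fq R ^ n.toAdd) r) =
        (frobEnd Fq R ^ n.toAdd) ((show O from x) • r)
      rw [frobEnd_pow_apply, frobEnd_pow_apply, smul_pow]
      rfl)

theorem evalHom_apply (Fq O R : Type*) [Field Fq] [Fintype Fq] [CommRing O] [Algebra Fq O]
    [CommRing R] [Algebra O R] (P : TwistedPoly Fq O) (x : R) :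
    evalHom Fq O R P x =
      P.sum fun n c => FrobRing.val Fq O c • x ^ (Fintype.card Fq ^ n) := by
  let _ : Algebra Fq R := ((algebraMap O R).comp (algebraMap Fq O)).toAlgebra
  rw [SkewPolynomial.sum_def']
  have h0 : ∀ n : Multiplicative ℕ, FrobRing.val Fq O 0 • x ^ (Fintype.card Fq ^ n.toAdd) = 0 := by
    intro n
    rw [map_zero, zero_smul]
  induction P using SkewMonoidAlgebra.induction_on' with
  | single n c =>
    rw [SkewMonoidAlgebra.sum_single_index (h0 n)]
    have h : evalHom Fq O R (SkewMonoidAlgebra.single n c) =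
        Module.toAddMonoidEnd O R (FrobRing.val Fq O c) * frobEnd Fq R ^ n.toAdd :=
      SkewMonoidAlgebra.liftNC_single _ _ _ _
    rw [h]
    change FrobRing.val Fq O c • ((frobEnd Fq R ^ n.toAdd) x) = _
    rw [frobEnd_pow_apply]
  | add P Q hP hQ =>
    rw [map_add, SkewMonoidAlgebra.sum_add_index' h0
      (fun _ b c => by rw [map_add, add_smul]), ← hP, ← hQ]
    rfl

variable {Fq A K : Type*} [Field Fq] [Fintype Fq] [CommRing A] [Algebra Fq A] [Field K]
  [Algebra Fq K] [Algebra A K] [IsScalarTower Fq A K]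

/-- `E(R)` for a commutative `𝒪_K`-algebra `R`: the additive group `R`, on which `a ∈ A` acts as
`x ↦ ∑ cᵢ x^(q^i)` where `φ(a) = ∑ cᵢ τ^i`. -/
def Points (_E : DrinfeldModule Fq A K) (R : Type*) : Type _ := R

variable (E : DrinfeldModule Fq A K)

instance (R : Type*) [CommRing R] : AddCommGroup (Points E R) := inferInstanceAs (AddCommGroup R)

/-- The identity map from `E(R)` to `R`. -/
def Points.val {R : Type*} [CommRing R] : Points E R ≃+ R := AddEquiv.refl R

instance (R : Type*) [CommRing R] [Algebra (IntRing A K) R] : Module A (Points E R) :=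
  Module.compHom R ((evalHom Fq (IntRing A K) R).comp (E.φ : A →+* TwistedPoly Fq (IntRing A K)))

theorem points_smul_def {R : Type*} [CommRing R] [Algebra (IntRing A K) R] (a : A)
    (x : Points E R) : Points.val E (a • x) = (E.φ a).sum fun n c =>
      FrobRing.val Fq (IntRing A K) c • Points.val E x ^ (Fintype.card Fq ^ n) :=
  evalHom_apply Fq (IntRing A K) R (E.φ a) x

end Points

/-! ### The exponential series -/

section Exp

variable {Fq A K : Type*} [Field Fq] [Fintype Fq] [CommRing A] [Algebra Fq A] [Field K]
  [Algebra Fq K] [Algebra A K] [IsScalarTower Fq A K] (E : DrinfeldModule Fq A K)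

/-- The coefficient in `K` of `τ^n` in `φ(a)`. -/
def DrinfeldModule.coeff (a : A) (n : ℕ) : K :=
  algebraMap (IntRing A K) K (FrobRing.val Fq (IntRing A K) ((E.φ a).coeff n))

/-- The coefficients of the product of two twisted power series `∑ fᵢ τ^i` and `∑ gᵢ τ^i`, that is,
of the composition of the additive power series `∑ fᵢ X^(q^i)` and `∑ gᵢ X^(q^i)`. -/
def twistMul (Fq : Type*) {K : Type*} [Fintype Fq] [Field K] (f g : ℕ → K) (n : ℕ) : K :=
  ∑ p ∈ Finset.HasAntidiagonal.antidiagonal n, f p.1 * g p.2 ^ (Fintype.card Fq ^ p.1)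

/-- `∑ eᵢ X^(q^i)` is an exponential series of `E`: `e₀ = 1` and, for all `a ∈ A`,
`φ(a)(∑ eᵢ X^(q^i)) = ∑ eᵢ (a X)^(q^i)`. -/
def DrinfeldModule.IsExp (e : ℕ → K) : Prop :=
  e 0 = 1 ∧ ∀ (a : A) (n : ℕ),
    twistMul Fq (E.coeff a) e n = e n * algebraMap A K a ^ (Fintype.card Fq ^ n)

theorem sum_pow_card_pow (Fq R : Type*) [Field Fq] [Fintype Fq] [CommRing R] [Algebra Fq R]
    {ι : Type*} (s : Finset ι) (f : ι → R) (n : ℕ) :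
    (∑ i ∈ s, f i) ^ (Fintype.card Fq ^ n) = ∑ i ∈ s, f i ^ (Fintype.card Fq ^ n) := by
  classical
  induction s using Finset.induction_on with
  | empty => simp
  | insert i s hi ih => rw [Finset.sum_insert hi, Finset.sum_insert hi, add_pow_card_pow, ih]

theorem twistMul_assoc (f g h : ℕ → K) (n : ℕ) :
    twistMul Fq (twistMul Fq f g) h n = twistMul Fq f (twistMul Fq g h) n := by
  simp only [twistMul, sum_pow_card_pow Fq K, Finset.sum_mul, Finset.mul_sum, Finset.sum_sigma']
  apply Finset.sum_nbij' (fun x => ⟨(x.2.1, x.2.2 + x.1.2), (x.2.2, x.1.2)⟩)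
    (fun x => ⟨(x.1.1 + x.2.1, x.2.2), (x.1.1, x.2.1)⟩)
  · rintro ⟨⟨i, j⟩, ⟨k, l⟩⟩ h
    simp only [Finset.mem_sigma, Finset.HasAntidiagonal.mem_antidiagonal] at h ⊢
    obtain ⟨h1, h2⟩ := h
    rw [← h1, ← h2, add_assoc]
    simp
  · rintro ⟨⟨i, j⟩, ⟨k, l⟩⟩ h
    simp only [Finset.mem_sigma, Finset.HasAntidiagonal.mem_antidiagonal] at h ⊢
    obtain ⟨h1, h2⟩ := h
    rw [← h1, ← h2, add_assoc]
    simp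
  · rintro ⟨⟨i, j⟩, ⟨k, l⟩⟩ h
    simp only [Finset.mem_sigma, Finset.HasAntidiagonal.mem_antidiagonal] at h ⊢
    obtain ⟨h1, rfl⟩ := h
    rfl
  · rintro ⟨⟨i, j⟩, ⟨k, l⟩⟩ h
    simp only [Finset.mem_sigma, Finset.HasAntidiagonal.mem_antidiagonal] at h ⊢
    obtain ⟨h1, rfl⟩ := h
    rfl
  · rintro ⟨⟨i, j⟩, ⟨k, l⟩⟩ h
    simp only [Finset.mem_sigma, Finset.HasAntidiagonal.mem_antidiagonal] at h ⊢
    obtain ⟨h1, rfl⟩ := h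
    rw [mul_pow, ← pow_mul, ← pow_add, mul_assoc, add_comm l k]

theorem DrinfeldModule.coeff_mul (a b : A) (n : ℕ) :
    E.coeff (a * b) n = twistMul Fq (E.coeff a) (E.coeff b) n := by
  have h : (E.φ a * E.φ b).coeff n = ∑ p ∈ Finset.HasAntidiagonal.antidiagonal n,
      (E.φ a).coeff p.1 * (E.φ b).coeff p.2 ^ (Fintype.card Fq ^ p.1) := by
    let s : Finset (ℕ × ℕ) := Finset.HasAntidiagonal.antidiagonal n
    have hs : ∀ {p : ℕ × ℕ}, p ∈ s ↔ p.1 + p.2 = n := Finset.HasAntidiagonal.mem_antidiagonal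
    exact SkewMonoidAlgebra.coeff_mul_antidiagonal_of_finset (E.φ a) (E.φ b)
      (Multiplicative.ofAdd n) s hs
  rw [DrinfeldModule.coeff, map_mul, h]
  simp only [map_sum, map_mul, map_pow]
  rfl

theorem DrinfeldModule.coeff_zero' (a : A) : E.coeff a 0 = algebraMap A K a := by
  rw [DrinfeldModule.coeff, E.coeff_zero]
  rfl

theorem DrinfeldModule.coeff_algebraMap (c : Fq) (n : ℕ) :
    E.coeff (algebraMap Fq A c) n = if n = 0 then algebraMap Fq K c else 0 := by
  rw [DrinfeldModule.coeff, AlgHom.commutes]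
  change algebraMap (IntRing A K) K (FrobRing.val Fq (IntRing A K)
    (SkewMonoidAlgebra.coeff (algebraMap Fq (TwistedPoly Fq (IntRing A K)) c)
      (Multiplicative.ofAdd n))) = _
  rw [SkewMonoidAlgebra.coe_algebraMap]
  rcases Nat.eq_zero_or_pos n with rfl | hn
  · rw [Function.comp_apply, SkewMonoidAlgebra.coeff_single_apply, if_pos ofAdd_zero.symm,
      if_pos rfl]
    exact (IsScalarTower.algebraMap_apply Fq (IntRing A K) K c).symm
  · rw [Function.comp_apply, SkewMonoidAlgebra.coeff_single_apply, if_neg hn.ne',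
      if_neg (fun h => hn.ne (Multiplicative.ofAdd.injective (ofAdd_zero.trans h))),
      map_zero, map_zero]

theorem twistMul_eq {Fq K : Type*} [Fintype Fq] [Field K] (f g : ℕ → K) (n : ℕ) : twistMul Fq f g n =
    f 0 * g n + ∑ p ∈ (Finset.HasAntidiagonal.antidiagonal n).erase (0, n),
      f p.1 * g p.2 ^ (Fintype.card Fq ^ p.1) := by
  rw [twistMul, ← Finset.add_sum_erase _ _ (a := ((0, n) : ℕ × ℕ)) (by simp)]
  simp

theorem lt_of_mem_erase_antidiagonal {n : ℕ} {p : ℕ × ℕ}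
    (hp : p ∈ (Finset.HasAntidiagonal.antidiagonal n).erase (0, n)) : p.2 < n := by
  rw [Finset.mem_erase, Finset.HasAntidiagonal.mem_antidiagonal] at hp
  obtain ⟨h1, h2⟩ := hp
  by_contra h
  exact h1 (Prod.ext (by simp; omega) (by simp; omega))

/-- The recursive solution of the functional equation for one element `t` of `A`. -/
def DrinfeldModule.expRec (t : A) : ℕ → K
  | 0 => 1
  | n + 1 =>
    (∑ p ∈ ((Finset.HasAntidiagonal.antidiagonal (n + 1)).erase (0, n + 1)).attach,
      E.coeff t p.1.1 * DrinfeldModule.expRec t p.1.2 ^ (Fintype.card Fq ^ p.1.1)) /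
      (algebraMap A K t ^ (Fintype.card Fq ^ (n + 1)) - algebraMap A K t)
  decreasing_by exact lt_of_mem_erase_antidiagonal p.2

/-- Every Drinfeld module has an exponential series. -/
theorem DrinfeldModule.exists_isExp [IsIntegrallyClosedIn Fq A] [FaithfulSMul A K] :
    ∃ e : ℕ → K, E.IsExp e := by
  have hinj : Function.Injective (algebraMap A K) := FaithfulSMul.algebraMap_injective A K
  by_cases hA : ∃ t : A, ¬ IsIntegral Fq t
  · obtain ⟨t, ht⟩ := hA
    have hne : ∀ n : ℕ, 0 < n →
        algebraMap A K t ^ (Fintype.card Fq ^ n) - algebraMap A K t ≠ 0 := by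
      intro n hn h
      apply ht
      rw [sub_eq_zero, ← map_pow] at h
      have h1 : t ^ (Fintype.card Fq ^ n) = t := hinj h
      have h2 : 1 < Fintype.card Fq ^ n := Nat.one_lt_pow hn.ne' Fintype.one_lt_card
      refine ⟨Polynomial.X ^ (Fintype.card Fq ^ n) - Polynomial.X,
        Polynomial.monic_X_pow_sub (by rw [Polynomial.degree_X]; exact_mod_cast h2), ?_⟩
      simp [h1]
    have hrec : ∀ n, twistMul Fq (E.coeff t) (E.expRec t) n =
        E.expRec t n * algebraMap A K t ^ (Fintype.card Fq ^ n) := by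
      intro n
      rw [twistMul_eq, E.coeff_zero']
      cases n with
      | zero => simp [DrinfeldModule.expRec]
      | succ n =>
        have h := hne (n + 1) (Nat.succ_pos n)
        have h1 : E.expRec t (n + 1) * (algebraMap A K t ^ (Fintype.card Fq ^ (n + 1)) -
            algebraMap A K t) =
            ∑ p ∈ (Finset.HasAntidiagonal.antidiagonal (n + 1)).erase (0, n + 1),
              E.coeff t p.1 * E.expRec t p.2 ^ (Fintype.card Fq ^ p.1) := by
          rw [DrinfeldModule.expRec, div_mul_cancel₀ _ h]
          exact Finset.sum_attach
            ((Finset.HasAntidiagonal.antidiagonal (n + 1)).erase (0, n + 1))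
            (fun p => E.coeff t p.1 * E.expRec t p.2 ^ (Fintype.card Fq ^ p.1))
        rw [← h1]
        ring
    refine ⟨E.expRec t, by simp [DrinfeldModule.expRec], fun a n => ?_⟩
    have key : ∀ n, twistMul Fq (E.coeff a) (E.expRec t) n -
        E.expRec t n * algebraMap A K a ^ (Fintype.card Fq ^ n) = 0 := by
      set e := E.expRec t with he
      set d : ℕ → K := fun n => twistMul Fq (E.coeff a) e n -
        e n * algebraMap A K a ^ (Fintype.card Fq ^ n) with hd
      have hcomm : ∀ n, twistMul Fq (E.coeff t) d n =
          d n * algebraMap A K t ^ (Fintype.card Fq ^ n) := by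
        intro n
        have h1 : twistMul Fq (E.coeff t) d n =
            twistMul Fq (E.coeff t) (twistMul Fq (E.coeff a) e) n -
            twistMul Fq (E.coeff t) e n * algebraMap A K a ^ (Fintype.card Fq ^ n) := by
          simp only [twistMul, Finset.sum_mul]
          rw [← Finset.sum_sub_distrib]
          refine Finset.sum_congr rfl fun p hp => ?_
          rw [Finset.HasAntidiagonal.mem_antidiagonal] at hp
          have hsub : ∀ (x y : K) (m : ℕ), (x - y) ^ (Fintype.card Fq ^ m) =
              x ^ (Fintype.card Fq ^ m) - y ^ (Fintype.card Fq ^ m) := by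
            intro x y m
            rw [eq_sub_iff_add_eq, ← add_pow_card_pow Fq K, sub_add_cancel]
          simp only [hd]
          rw [hsub, mul_pow, ← pow_mul, ← pow_add, ← hp, add_comm p.1 p.2]
          simp only [twistMul]
          ring
        have h2 : twistMul Fq (E.coeff t) (twistMul Fq (E.coeff a) e) n =
            twistMul Fq (E.coeff a) e n * algebraMap A K t ^ (Fintype.card Fq ^ n) := by
          rw [← twistMul_assoc]
          have h3 : twistMul Fq (E.coeff t) (E.coeff a) = twistMul Fq (E.coeff a) (E.coeff t) := by
            funext m
            rw [← E.coeff_mul, ← E.coeff_mul, mul_comm]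
          rw [h3, twistMul_assoc]
          have h4 : twistMul Fq (E.coeff t) e =
              fun m => e m * algebraMap A K t ^ (Fintype.card Fq ^ m) := funext hrec
          rw [h4]
          simp only [twistMul, Finset.sum_mul]
          refine Finset.sum_congr rfl fun p hp => ?_
          rw [Finset.HasAntidiagonal.mem_antidiagonal] at hp
          rw [mul_pow, ← pow_mul, ← pow_add, ← hp, add_comm p.1 p.2]
          ring
        rw [h1, h2, hrec n]
        simp only [hd]
        ring
      intro n
      change d n = 0
      induction n using Nat.strong_induction_on with
      | _ n ih =>
        rcases Nat.eq_zero_or_pos n with rfl | hn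
        · simp [hd, twistMul_eq, E.coeff_zero', he, DrinfeldModule.expRec]
        · have h := hcomm n
          rw [twistMul_eq, Finset.sum_eq_zero, add_zero, E.coeff_zero'] at h
          · have h5 : d n * (algebraMap A K t ^ (Fintype.card Fq ^ n) - algebraMap A K t) = 0 := by
              rw [mul_sub, ← h]
              ring
            exact (mul_eq_zero.mp h5).resolve_right (hne n hn)
          · intro p hp
            rw [ih p.2 (lt_of_mem_erase_antidiagonal hp), zero_pow_card_pow, mul_zero]
    exact sub_eq_zero.mp (key n)
  · push Not at hA
    refine ⟨fun n => if n = 0 then 1 else 0, by simp, fun a n => ?_⟩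
    obtain ⟨c, rfl⟩ := IsIntegrallyClosedIn.isIntegral_iff.mp (hA a)
    rw [twistMul_eq, Finset.sum_eq_zero, add_zero, E.coeff_zero']
    · rcases Nat.eq_zero_or_pos n with rfl | hn
      · simp
      · simp [hn.ne']
    · intro p hp
      rw [E.coeff_algebraMap]
      have h1 := lt_of_mem_erase_antidiagonal hp
      have h2 := Finset.mem_of_mem_erase hp
      rw [Finset.HasAntidiagonal.mem_antidiagonal] at h2
      rw [if_neg (by omega), zero_mul]

/-- The coefficients `eᵢ` of the exponential series `exp_E(X) = ∑ eᵢ X^(q^i)`. -/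
def DrinfeldModule.expCoeff [IsIntegrallyClosedIn Fq A] [FaithfulSMul A K] : ℕ → K :=
  E.exists_isExp.choose

theorem DrinfeldModule.isExp_expCoeff [IsIntegrallyClosedIn Fq A] [FaithfulSMul A K] :
    E.IsExp E.expCoeff :=
  E.exists_isExp.choose_spec

end Exp

/-! ### Semilocal algebras -/

section Local

/-- `L_∞ = L ⊗_Q Q_∞`, where `Q_∞` is the completion of `Q` at the place `∞`. It is the product of
the completions of `L` at the infinite places. -/
abbrev InfAlg {Q : Type*} [Field Q] (inf : ValuationSubring Q) (L : Type*) [Field L]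
    [Algebra Q L] : Type _ := L ⊗[Q] Cmpl inf

/-- `L_∞` carries its topology as a `Q_∞`-module (the product topology, for any basis). -/
@[reducible]
def infTopology {Q : Type*} [Field Q] (inf : ValuationSubring Q) (L : Type*) [Field L]
    [Algebra Q L] : TopologicalSpace (InfAlg inf L) :=
  letI : Algebra (Cmpl inf) (L ⊗[Q] Cmpl inf) := Algebra.TensorProduct.rightAlgebra
  moduleTopology (Cmpl inf) (L ⊗[Q] Cmpl inf)

/-- `L_v = L ⊗_K K_v` for a place `v` of `K`. It is the product of the completions of `L` at the
places above `v`; for `L = K` it is the completion `K_v` itself. -/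
abbrev LocAlg {K : Type*} [Field K] (v : ValuationSubring K) (L : Type*) [Field L]
    [Algebra K L] : Type _ := L ⊗[K] Cmpl v

end Local

section Maps

/-- A `K`-linear map `T : L' → L` that commutes with the `q`-th Frobenius maps. -/
structure TauMap (Fq K L' L : Type*) [Fintype Fq] [Field K] [Field L'] [Field L] [Algebra K L']
    [Algebra K L] extends L' →ₗ[K] L where
  map_frob : ∀ x : L', toLinearMap (x ^ Fintype.card Fq) = toLinearMap x ^ Fintype.card Fq

variable {Fq K L L' : Type*} [Field Fq] [Fintype Fq] [Field K] [Field L] [Field L'] [Algebra Fq K]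
  [Algebra K L] [Algebra K L']

theorem pow_card_pow_of_frob {Fq R R' : Type*} [Fintype Fq] [CommRing R] [CommRing R'] (f : R → R')
    (hf : ∀ x, f (x ^ Fintype.card Fq) = f x ^ Fintype.card Fq) (n : ℕ) (x : R) :
    f (x ^ (Fintype.card Fq ^ n)) = f x ^ (Fintype.card Fq ^ n) := by
  induction n generalizing x with
  | zero => simp
  | succ n ih => rw [pow_succ', pow_mul, ih, hf, ← pow_mul]

/-- The base change `T ⊗ id : L' ⊗_F B → L ⊗_F B`. -/
def TauMap.base (T : TauMap Fq K L' L) (F B : Type*) [Field F] [Algebra F K] [Algebra F L]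
    [Algebra F L'] [IsScalarTower F K L] [IsScalarTower F K L'] [CommRing B] [Algebra F B] :
    L' ⊗[F] B →ₗ[K] L ⊗[F] B :=
  TensorProduct.AlgebraTensorModule.map T.toLinearMap LinearMap.id

theorem TauMap.base_tmul (T : TauMap Fq K L' L) (F B : Type*) [Field F] [Algebra F K]
    [Algebra F L] [Algebra F L'] [IsScalarTower F K L] [IsScalarTower F K L'] [CommRing B]
    [Algebra F B] (x : L') (b : B) : T.base F B (x ⊗ₜ b) = T.toLinearMap x ⊗ₜ b := rfl

theorem TauMap.base_frob (T : TauMap Fq K L' L) (F B : Type*) [Field F] [Algebra F K]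
    [Algebra F L] [Algebra F L'] [IsScalarTower F K L] [IsScalarTower F K L'] [CommRing B]
    [Algebra F B] (z : L' ⊗[F] B) :
    T.base F B (z ^ Fintype.card Fq) = T.base F B z ^ Fintype.card Fq := by
  let _ : Algebra Fq (L' ⊗[F] B) :=
    ((algebraMap K (L' ⊗[F] B)).comp (algebraMap Fq K)).toAlgebra
  let _ : Algebra Fq (L ⊗[F] B) :=
    ((algebraMap K (L ⊗[F] B)).comp (algebraMap Fq K)).toAlgebra
  induction z using TensorProduct.induction_on with
  | zero => rw [zero_pow Fintype.card_ne_zero, map_zero, zero_pow Fintype.card_ne_zero]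
  | tmul x b =>
    rw [Algebra.TensorProduct.tmul_pow, T.base_tmul, T.base_tmul, Algebra.TensorProduct.tmul_pow,
      T.map_frob]
  | add x y hx hy =>
    have h1 := add_pow_card_pow Fq (L' ⊗[F] B) 1 x y
    have h2 := add_pow_card_pow Fq (L ⊗[F] B) 1 (T.base F B x) (T.base F B y)
    rw [pow_one] at h1 h2
    rw [h1, map_add, hx, hy, map_add, h2]

/-- The identity map. -/
def TauMap.id (Fq K L : Type*) [Fintype Fq] [Field K] [Field L] [Algebra K L] :
    TauMap Fq K L L where
  toLinearMap := LinearMap.id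
  map_frob _ := rfl

end Maps

/-! ### Class groups with moduli -/

section ClassGroup

variable {Fq A Q K : Type*} [Field Fq] [Fintype Fq] [CommRing A] [Algebra Fq A] [Field Q]
  [Field K] [Algebra Fq K] [Algebra A K] [IsScalarTower Fq A K] [Algebra Q K]
  (E : DrinfeldModule Fq A K) (inf : ValuationSubring Q)

/-- Functoriality of `E(R)`. -/
def Points.map {R R' : Type*} [CommRing R] [CommRing R'] [Algebra (IntRing A K) R]
    [Algebra (IntRing A K) R'] (f : R →ₗ[IntRing A K] R')
    (hf : ∀ x, f (x ^ Fintype.card Fq) = f x ^ Fintype.card Fq) : Points E R →ₗ[A] Points E R' where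
  toFun x := (Points.val E).symm (f (Points.val E x))
  map_add' x y := by rw [map_add, map_add, map_add]
  map_smul' a x := by
    rw [RingHom.id_apply]
    apply (Points.val E).injective
    rw [points_smul_def, points_smul_def, AddEquiv.apply_symm_apply, AddEquiv.apply_symm_apply,
      SkewPolynomial.sum_def, SkewPolynomial.sum_def, map_sum]
    refine Finset.sum_congr rfl fun n _ => ?_
    rw [f.map_smul, pow_card_pow_of_frob f hf]

theorem Points.map_apply {R R' : Type*} [CommRing R] [CommRing R'] [Algebra (IntRing A K) R]
    [Algebra (IntRing A K) R'] (f : R →ₗ[IntRing A K] R')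
    (hf : ∀ x, f (x ^ Fintype.card Fq) = f x ^ Fintype.card Fq) (x : Points E R) :
    Points.val E (Points.map E f hf x) = f (Points.val E x) := rfl

variable (L : Type*) [Field L] [Algebra K L] [Algebra A L] [IsScalarTower A K L] [Algebra Q L]
  [IsScalarTower Q K L]

/-- `exp_E(L_∞)`, the `A`-submodule of `E(L_∞)` formed by the values `exp_E(x) = ∑ eᵢ x^(q^i)` for
`x ∈ L_∞`. -/
def expImage [IsIntegrallyClosedIn Fq A] [FaithfulSMul A K] :
    Submodule A (Points E (InfAlg inf L)) :=
  letI := infTopology inf L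
  Submodule.span A {y | ∃ x : InfAlg inf L,
    HasSum (fun i => algebraMap K (InfAlg inf L) (E.expCoeff i) * x ^ (Fintype.card Fq ^ i))
      (Points.val E y)}

variable {L}

/-- `𝔣𝒪_{L,v}`, the image of `𝔣 ⊗ 𝒪_{K,v}` in `L_v = L ⊗_K K_v`, for an ideal `𝔣` of `𝒪_L` and a
place `v` of `K`. -/
def locIdeal (f : Ideal (IntRing A L)) (v : ValuationSubring K) : AddSubgroup (LocAlg v L) :=
  AddSubgroup.closure {z | ∃ x ∈ f, ∃ c ∈ cmplInt v, z = (x : L) ⊗ₜ[K] c}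

theorem locIdeal_pow (Fq : Type*) [Field Fq] [Fintype Fq] [Algebra Fq K] (f : Ideal (IntRing A L))
    (v : ValuationSubring K) (n : ℕ) {z : LocAlg v L} (hz : z ∈ locIdeal f v) :
    z ^ (Fintype.card Fq ^ n) ∈ locIdeal f v := by
  let _ : Algebra Fq (LocAlg v L) :=
    ((algebraMap K (LocAlg v L)).comp (algebraMap Fq K)).toAlgebra
  rw [← frobEnd_pow_apply Fq]
  induction hz using AddSubgroup.closure_induction with
  | mem z hz =>
    obtain ⟨x, hx, c, hc, rfl⟩ := hz
    rw [frobEnd_pow_apply, Algebra.TensorProduct.tmul_pow]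
    exact AddSubgroup.subset_closure ⟨x ^ (Fintype.card Fq ^ n),
      Ideal.pow_mem_of_mem f hx _ (pow_pos Fintype.card_pos n), _, pow_mem hc _, rfl⟩
  | zero => rw [map_zero]; exact zero_mem _
  | add x y _ _ hx hy => rw [map_add]; exact add_mem hx hy
  | neg x _ hx => rw [map_neg]; exact neg_mem hx

theorem locIdeal_smul (f : Ideal (IntRing A L)) (v : ValuationSubring K) (c : IntRing A K)
    {z : LocAlg v L} (hz : z ∈ locIdeal f v) : c • z ∈ locIdeal f v := by
  induction hz using AddSubgroup.closure_induction with
  | mem z hz =>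
    obtain ⟨x, hx, d, hd, rfl⟩ := hz
    refine AddSubgroup.subset_closure
      ⟨(IsScalarTower.toAlgHom A K L).mapIntegralClosure c * x, f.mul_mem_left _ hx, d, hd, ?_⟩
    change ((c : K) • (x : L)) ⊗ₜ[K] d = _
    rw [Algebra.smul_def]
    rfl
  | zero => rw [smul_zero]; exact zero_mem _
  | add x y _ _ hx hy => rw [smul_add]; exact add_mem hx hy
  | neg x _ hx => rw [smul_neg]; exact neg_mem hx

/-- `E(𝔣𝒪_{L,v})` inside `E(L_v)`. -/
def locSub (f : Ideal (IntRing A L)) (v : ValuationSubring K) :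
    Submodule A (Points E (LocAlg v L)) where
  carrier := {x | Points.val E x ∈ locIdeal f v}
  add_mem' hx hy := (locIdeal f v).add_mem hx hy
  zero_mem' := zero_mem (locIdeal f v)
  smul_mem' a x hx := by
    rw [Set.mem_ofPred_eq, points_smul_def, SkewPolynomial.sum_def]
    exact sum_mem fun n _ => locIdeal_smul f v _ (locIdeal_pow Fq f v n hx)

variable (L) in
/-- `L → L_v`, `x ↦ x ⊗ 1`, as an `A`-homomorphism `E(L) → E(L_v)`. -/
def diagLoc (v : ValuationSubring K) : Points E L →ₗ[A] Points E (LocAlg v L) :=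
  Points.map E ((Algebra.TensorProduct.includeLeft : L →ₐ[K] LocAlg v L).toLinearMap.restrictScalars
    (IntRing A K)) (fun x => map_pow (Algebra.TensorProduct.includeLeft : L →ₐ[K] LocAlg v L) x _)

variable (L) in
/-- `L → L_∞`, `x ↦ x ⊗ 1`, as an `A`-homomorphism `E(L) → E(L_∞)`. -/
def diagInf : Points E L →ₗ[A] Points E (InfAlg inf L) :=
  Points.map E
    ((Algebra.TensorProduct.includeLeft : L →ₐ[K] InfAlg inf L).toLinearMap.restrictScalars
      (IntRing A K))
    (fun x => map_pow (Algebra.TensorProduct.includeLeft : L →ₐ[K] InfAlg inf L) x _)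

variable [IsIntegrallyClosedIn Fq A] [FaithfulSMul A K]

/-- The `A`-module `E(L_∞)/exp_E(L_∞) ⊕ ⨁_v E(L_v)/E(𝔣𝒪_{L,v})`, where `v` runs over the finite
places of `K`. -/
abbrev IdeleQuot (f : Ideal (IntRing A L)) : Type _ :=
  (Points E (InfAlg inf L) ⧸ expImage E inf L) ×
    ⨁ v : FinPlace A K, (Points E (LocAlg v.1 L) ⧸ locSub E f v.1)

/-- The same module, with the direct product over `v` in the place of the direct sum. -/
abbrev IdeleProd (f : Ideal (IntRing A L)) : Type _ :=
  (Points E (InfAlg inf L) ⧸ expImage E inf L) ×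
    ∀ v : FinPlace A K, (Points E (LocAlg v.1 L) ⧸ locSub E f v.1)

/-- The diagonal map on `E(L)`. (It takes values in the direct sum.) -/
def diagMap (f : Ideal (IntRing A L)) : Points E L →ₗ[A] IdeleProd E inf f :=
  LinearMap.prod ((expImage E inf L).mkQ ∘ₗ diagInf E inf L)
    (LinearMap.pi fun v => (locSub E f v.1).mkQ ∘ₗ diagLoc E L v.1)

/-- The inclusion of the direct sum into the direct product. -/
def sumToProd (f : Ideal (IntRing A L)) : IdeleQuot E inf f →ₗ[A] IdeleProd E inf f :=
  LinearMap.prodMap LinearMap.id (DirectSum.coeFnLinearMap A)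

/-- The image of the diagonal map `E(L) → E(L_∞)/exp_E(L_∞) ⊕ ⨁_v E(L_v)/E(𝔣𝒪_{L,v})`. -/
def diagImage (f : Ideal (IntRing A L)) : Submodule A (IdeleQuot E inf f) :=
  (LinearMap.range (diagMap E inf f)).comap (sumToProd E inf f)

/-- The class group `H_𝔣(E/𝒪_L)` with modulus `𝔣`. -/
def ClassGroup (f : Ideal (IntRing A L)) : Type _ := IdeleQuot E inf f ⧸ diagImage E inf f

instance (f : Ideal (IntRing A L)) : AddCommGroup (ClassGroup E inf f) :=
  Submodule.Quotient.addCommGroup (diagImage E inf f)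

instance (f : Ideal (IntRing A L)) : Module A (ClassGroup E inf f) :=
  Submodule.Quotient.module (diagImage E inf f)

end ClassGroup

/-! ### Functoriality -/

section Functoriality

variable {Fq A Q K : Type*} [Field Fq] [Fintype Fq] [CommRing A] [Algebra Fq A] [Field Q]
  [Field K] [Algebra Fq K] [Algebra A K] [IsScalarTower Fq A K] [Algebra Q K]
  (E : DrinfeldModule Fq A K) (inf : ValuationSubring Q)
  {L L' L'' : Type*}
  [Field L] [Algebra K L] [Algebra A L] [IsScalarTower A K L] [Algebra Q L] [IsScalarTower Q K L]
  [Field L'] [Algebra K L'] [Algebra A L'] [IsScalarTower A K L'] [Algebra Q L']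
  [IsScalarTower Q K L']
  [Field L''] [Algebra K L''] [Algebra A L''] [IsScalarTower A K L''] [Algebra Q L'']
  [IsScalarTower Q K L'']

/-- `T(𝔣') ⊆ 𝔣`, for ideals `𝔣'` of `𝒪_{L'}` and `𝔣` of `𝒪_L`. -/
def TauMap.MapsInto (T : TauMap Fq K L' L) (f' : Ideal (IntRing A L')) (f : Ideal (IntRing A L)) :
    Prop := ∀ x ∈ f', ∃ y ∈ f, (y : L) = T.toLinearMap x

/-- The map `E(L'_∞) → E(L_∞)` induced by `T`. -/
def infMap (T : TauMap Fq K L' L) : Points E (InfAlg inf L') →ₗ[A] Points E (InfAlg inf L) :=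
  Points.map E ((T.base Q (Cmpl inf)).restrictScalars (IntRing A K)) (T.base_frob Q (Cmpl inf))

/-- The map `E(L'_v) → E(L_v)` induced by `T`. -/
def locMap (T : TauMap Fq K L' L) (v : ValuationSubring K) :
    Points E (LocAlg v L') →ₗ[A] Points E (LocAlg v L) :=
  Points.map E ((T.base K (Cmpl v)).restrictScalars (IntRing A K)) (T.base_frob K (Cmpl v))

theorem infMap_continuous (T : TauMap Fq K L' L) :
    @Continuous _ _ (infTopology inf L') (infTopology inf L) (T.base Q (Cmpl inf)) := by
  letI : Algebra (Cmpl inf) (L ⊗[Q] Cmpl inf) := Algebra.TensorProduct.rightAlgebra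
  letI : Algebra (Cmpl inf) (L' ⊗[Q] Cmpl inf) := Algebra.TensorProduct.rightAlgebra
  letI := infTopology inf L
  letI := infTopology inf L'
  haveI : IsModuleTopology (Cmpl inf) (L ⊗[Q] Cmpl inf) := ⟨rfl⟩
  haveI : IsModuleTopology (Cmpl inf) (L' ⊗[Q] Cmpl inf) := ⟨rfl⟩
  haveI : ContinuousAdd (L ⊗[Q] Cmpl inf) := IsModuleTopology.toContinuousAdd (Cmpl inf) _
  let g : L' ⊗[Q] Cmpl inf →ₗ[Cmpl inf] L ⊗[Q] Cmpl inf :=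
    { toFun := T.base Q (Cmpl inf)
      map_add' := map_add _
      map_smul' := by
        intro c z
        rw [RingHom.id_apply, Algebra.smul_def, Algebra.smul_def]
        induction z using TensorProduct.induction_on with
        | zero => simp
        | tmul x b =>
          change T.base Q (Cmpl inf) ((1 ⊗ₜ c) * (x ⊗ₜ b)) =
            (1 ⊗ₜ c) * T.base Q (Cmpl inf) (x ⊗ₜ b)
          rw [Algebra.TensorProduct.tmul_mul_tmul, T.base_tmul, T.base_tmul,
            Algebra.TensorProduct.tmul_mul_tmul, one_mul, one_mul]
        | add x y hx hy => rw [mul_add, map_add, hx, hy, map_add, mul_add] }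
  exact IsModuleTopology.continuous_of_linearMap g

theorem expImage_le_comap [IsIntegrallyClosedIn Fq A] [FaithfulSMul A K] (T : TauMap Fq K L' L) :
    expImage E inf L' ≤ (expImage E inf L).comap (infMap E inf T) := by
  letI := infTopology inf L
  letI := infTopology inf L'
  refine Submodule.span_le.mpr ?_
  rintro y ⟨x, hx⟩
  refine Submodule.subset_span ⟨T.base Q (Cmpl inf) x, ?_⟩
  have h := hx.map (T.base Q (Cmpl inf)) (infMap_continuous inf T)
  have h2 : (T.base Q (Cmpl inf)) ∘ (fun i => algebraMap K (InfAlg inf L') (E.expCoeff i) *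
      x ^ (Fintype.card Fq ^ i)) = fun i => algebraMap K (InfAlg inf L) (E.expCoeff i) *
      (T.base Q (Cmpl inf) x) ^ (Fintype.card Fq ^ i) := by
    funext i
    rw [Function.comp_apply, ← Algebra.smul_def, ← Algebra.smul_def, map_smul,
      pow_card_pow_of_frob _ (T.base_frob Q (Cmpl inf))]
  rw [h2] at h
  exact h

theorem locSub_le_comap {T : TauMap Fq K L' L} {f' : Ideal (IntRing A L')}
    {f : Ideal (IntRing A L)} (h : T.MapsInto f' f) (v : ValuationSubring K) :
    locSub E f' v ≤ (locSub E f v).comap (locMap E T v) := by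
  intro z hz
  change T.base K (Cmpl v) (Points.val E z) ∈ locIdeal f v
  replace hz : Points.val E z ∈ locIdeal f' v := hz
  generalize Points.val E z = w at hz
  induction hz using AddSubgroup.closure_induction with
  | mem z hz =>
    obtain ⟨x, hx, c, hc, rfl⟩ := hz
    obtain ⟨y, hy, hxy⟩ := h x hx
    rw [T.base_tmul, ← hxy]
    exact AddSubgroup.subset_closure ⟨y, hy, c, hc, rfl⟩
  | zero => rw [map_zero]; exact zero_mem _
  | add x y _ _ hx hy => rw [map_add]; exact add_mem hx hy
  | neg x _ hx => rw [map_neg]; exact neg_mem hx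

variable [IsIntegrallyClosedIn Fq A] [FaithfulSMul A K]

/-- The map `E(L'_∞)/exp_E(L'_∞) ⊕ ⨁_v E(L'_v)/E(𝔣'𝒪_{L',v}) →
E(L_∞)/exp_E(L_∞) ⊕ ⨁_v E(L_v)/E(𝔣𝒪_{L,v})` induced by `T` if `T(𝔣') ⊆ 𝔣`. -/
def ideleMap (T : TauMap Fq K L' L) {f' : Ideal (IntRing A L')} {f : Ideal (IntRing A L)}
    (h : T.MapsInto f' f) : IdeleQuot E inf f' →ₗ[A] IdeleQuot E inf f :=
  LinearMap.prodMap (Submodule.mapQ _ _ (infMap E inf T) (expImage_le_comap E inf T))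
    (DirectSum.lmap fun v : FinPlace A K =>
      Submodule.mapQ _ _ (locMap E T v.1) (locSub_le_comap E h v.1))

theorem diagImage_le_comap (T : TauMap Fq K L' L) {f' : Ideal (IntRing A L')}
    {f : Ideal (IntRing A L)} (h : T.MapsInto f' f) :
    diagImage E inf f' ≤ (diagImage E inf f).comap (ideleMap E inf T h) := by
  rintro m ⟨x, hx⟩
  refine ⟨(Points.val E).symm (T.toLinearMap (Points.val E x)), ?_⟩
  obtain ⟨h1, h2⟩ := Prod.ext_iff.mp hx
  refine Prod.ext ?_ (funext fun v => ?_)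
  · change _ = Submodule.mapQ _ _ (infMap E inf T) (expImage_le_comap E inf T) m.1
    change Submodule.Quotient.mk (diagInf E inf L' x) = m.1 at h1
    rw [← h1]
    rfl
  · change _ = DirectSum.lmap (fun v : FinPlace A K =>
      Submodule.mapQ _ _ (locMap E T v.1) (locSub_le_comap E h v.1)) m.2 v
    have h3 : Submodule.Quotient.mk (diagLoc E L' v.1 x) = m.2 v := congrFun h2 v
    rw [DirectSum.lmap_apply, ← h3]
    rfl

/-- The map `H_𝔣'(E/𝒪_{L'}) → H_𝔣(E/𝒪_L)` induced by `T` if `T(𝔣') ⊆ 𝔣`. -/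
def classMap (T : TauMap Fq K L' L) {f' : Ideal (IntRing A L')} {f : Ideal (IntRing A L)}
    (h : T.MapsInto f' f) : ClassGroup E inf f' →ₗ[A] ClassGroup E inf f :=
  Submodule.mapQ _ _ (ideleMap E inf T h) (diagImage_le_comap E inf T h)

theorem TauMap.base_comp (T₁ : TauMap Fq K L' L) (T₂ : TauMap Fq K L'' L')
    (T₃ : TauMap Fq K L'' L) (hT : ∀ x, T₃.toLinearMap x = T₁.toLinearMap (T₂.toLinearMap x))
    (F B : Type*) [Field F] [Algebra F K] [Algebra F L] [Algebra F L'] [Algebra F L'']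
    [IsScalarTower F K L] [IsScalarTower F K L'] [IsScalarTower F K L''] [CommRing B] [Algebra F B]
    (z : L'' ⊗[F] B) : T₁.base F B (T₂.base F B z) = T₃.base F B z := by
  induction z using TensorProduct.induction_on with
  | zero => simp
  | tmul x b => rw [T₂.base_tmul, T₁.base_tmul, T₃.base_tmul, hT]
  | add x y hx hy => rw [map_add, map_add, hx, hy, map_add]

theorem classMap_comp (T₁ : TauMap Fq K L' L) (T₂ : TauMap Fq K L'' L')
    (T₃ : TauMap Fq K L'' L) (hT : ∀ x, T₃.toLinearMap x = T₁.toLinearMap (T₂.toLinearMap x))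
    {f'' : Ideal (IntRing A L'')} {f' : Ideal (IntRing A L')} {f : Ideal (IntRing A L)}
    (h₁ : T₁.MapsInto f' f) (h₂ : T₂.MapsInto f'' f') (h₃ : T₃.MapsInto f'' f)
    (z : ClassGroup E inf f'') :
    classMap E inf T₁ h₁ (classMap E inf T₂ h₂ z) = classMap E inf T₃ h₃ z := by
  obtain ⟨⟨a, b⟩, rfl⟩ := Submodule.Quotient.mk_surjective (diagImage E inf f'') z
  refine congrArg Submodule.Quotient.mk (Prod.ext ?_ ?_)
  · obtain ⟨a, rfl⟩ := Submodule.Quotient.mk_surjective _ a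
    exact congrArg Submodule.Quotient.mk (TauMap.base_comp T₁ T₂ T₃ hT Q (Cmpl inf) _)
  · refine DFinsupp.ext fun v => ?_
    change Submodule.mapQ _ _ (locMap E T₁ v.1) (locSub_le_comap E h₁ v.1)
      (Submodule.mapQ _ _ (locMap E T₂ v.1) (locSub_le_comap E h₂ v.1) (b v)) =
      Submodule.mapQ _ _ (locMap E T₃ v.1) (locSub_le_comap E h₃ v.1) (b v)
    obtain ⟨c, hc⟩ := Submodule.Quotient.mk_surjective _ (b v)
    rw [← hc]
    exact congrArg Submodule.Quotient.mk (TauMap.base_comp T₁ T₂ T₃ hT K (Cmpl v.1) _)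

end Functoriality

/-! ### `S`-modified class groups -/

section Limit

variable {Fq A Q K : Type*} [Field Fq] [Fintype Fq] [CommRing A] [Algebra Fq A] [Field Q]
  [Field K] [Algebra Fq K] [Algebra A K] [IsScalarTower Fq A K] [Algebra Q K]
  {L L' L'' : Type*}
  [Field L] [Algebra K L] [Algebra A L] [IsScalarTower A K L] [Algebra Q L] [IsScalarTower Q K L]
  [Field L'] [Algebra K L'] [Algebra A L'] [IsScalarTower A K L'] [Algebra Q L']
  [IsScalarTower Q K L']

/-- The support of the ideal `𝔣` of `𝒪_L` consists of places above places in `S`: every finite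
place `w` of `L` that divides `𝔣` lies above a place in `S`. -/
def Supported (S : Set (FinPlace A K)) (f : Ideal (IntRing A L)) : Prop :=
  ∀ w : FinPlace A L, (∀ x ∈ f, w.1.valuation (x : L) < 1) →
    ∃ v ∈ S, v.1 = w.1.comap (algebraMap K L)

/-- The moduli of `L` (nonzero ideals of `𝒪_L`) whose supports are contained in `S_L`, the set of
places of `L` above `S`. -/
abbrev Moduli (S : Set (FinPlace A K)) (L : Type*) [Field L] [Algebra K L] [Algebra A L] : Type _ :=
  {f : Ideal (IntRing A L) // f ≠ ⊥ ∧ Supported S f}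

theorem mapsInto_id {f g : Ideal (IntRing A L)} (h : f ≤ g) :
    (TauMap.id Fq K L).MapsInto f g := fun x hx => ⟨x, h hx, rfl⟩

theorem valuation_lt_one_iff {F : Type*} [Field F] (v : ValuationSubring F) (x : F) :
    v.valuation x < 1 ↔ x = 0 ∨ x⁻¹ ∉ v := by
  rcases eq_or_ne x 0 with rfl | hx
  · simp
  · rw [← ValuationSubring.valuation_le_one_iff, map_inv₀, or_iff_right hx, not_le,
      one_lt_inv₀ (zero_lt_iff.mpr ((Valuation.ne_zero_iff _).mpr hx))]

theorem Supported.exists_of_lt_one {S : Set (FinPlace A K)} {f : Ideal (IntRing A L)}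
    (hf : Supported S f) (hf0 : f ≠ ⊥) (g : L →ₐ[K] L') (w : FinPlace A L')
    (hw : ∀ x ∈ f, w.1.valuation (g (x : L)) < 1) :
    ∃ v ∈ S, v.1 = w.1.comap (algebraMap K L') := by
  have hlt : ∀ x : L, (w.1.comap (g : L →+* L')).valuation x < 1 ↔ w.1.valuation (g x) < 1 := by
    intro x
    rw [valuation_lt_one_iff, valuation_lt_one_iff, ValuationSubring.mem_comap]
    simp
  have hne : w.1.comap (g : L →+* L') ≠ ⊤ := by
    intro htop
    obtain ⟨x, hx, hx0⟩ := Submodule.exists_mem_ne_zero_of_ne_bot hf0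
    have h := (hlt x).mpr (hw x hx)
    rw [valuation_lt_one_iff, htop] at h
    rcases h with h | h
    · exact hx0 (Subtype.ext h)
    · exact h (ValuationSubring.mem_top _)
  have hA : ∀ a : A, algebraMap A L a ∈ w.1.comap (g : L →+* L') := by
    intro a
    have h := w.2.2 a
    rw [IsScalarTower.algebraMap_apply A K L'] at h
    rw [ValuationSubring.mem_comap, IsScalarTower.algebraMap_apply A K L]
    change g _ ∈ _
    rwa [AlgHom.commutes]
  obtain ⟨v, hv, h⟩ := hf ⟨w.1.comap (g : L →+* L'), hne, hA⟩ (fun x hx => (hlt x).mpr (hw x hx))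
  refine ⟨v, hv, h.trans ?_⟩
  ext x
  simp only [ValuationSubring.mem_comap]
  change g (algebraMap K L x) ∈ _ ↔ _
  rw [AlgHom.commutes]

variable (E : DrinfeldModule Fq A K) (inf : ValuationSubring Q) [IsIntegrallyClosedIn Fq A]
  [FaithfulSMul A K]

/-- The projective limit of the class groups `H_𝔣(E/𝒪_L)`, where `𝔣` runs over the moduli of `L`
whose supports are contained in `S_L`, inside their product. -/
def sClassSubmodule (S : Set (FinPlace A K)) (L : Type*) [Field L] [Algebra K L] [Algebra A L]
    [IsScalarTower A K L] [Algebra Q L] [IsScalarTower Q K L] :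
    Submodule A (∀ f : Moduli S L, ClassGroup E inf f.1) where
  carrier := {x | ∀ (f g : Moduli S L) (h : f.1 ≤ g.1),
    classMap E inf (TauMap.id Fq K L) (mapsInto_id h) (x f) = x g}
  add_mem' hx hy f g h := by
    rw [Pi.add_apply, map_add, hx f g h, hy f g h, Pi.add_apply]
  zero_mem' f g h := by rw [Pi.zero_apply, map_zero, Pi.zero_apply]
  smul_mem' a x hx f g h := by rw [Pi.smul_apply, map_smul, hx f g h, Pi.smul_apply]

section

variable (S : Set (FinPlace A K)) (L : Type*) [Field L] [Algebra K L] [Algebra A L]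
  [IsScalarTower A K L] [Algebra Q L] [IsScalarTower Q K L]

/-- The `A`-module `H_S(E/𝒪_L)`, the projective limit of the class groups `H_𝔣(E/𝒪_L)`, where `𝔣`
runs over the moduli of `L` whose supports are contained in `S_L`. -/
def SClassGroup : Type _ := ↥(sClassSubmodule E inf S L)

instance : AddCommGroup (SClassGroup E inf S L) :=
  (sClassSubmodule E inf S L).addCommGroup

instance : Module A (SClassGroup E inf S L) :=
  (sClassSubmodule E inf S L).module

end

/-- The projective limit of the maps `H_{𝔣'}(E/𝒪_{L'}) → H_𝔣(E/𝒪_L)` induced by `T`, where a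
modulus `𝔣' = pull 𝔣` with `T(𝔣') ⊆ 𝔣` is used to compute the component at `𝔣`. -/
def limMap {S : Set (FinPlace A K)} (T : TauMap Fq K L' L) (pull : Moduli S L → Moduli S L')
    (hT : ∀ f, T.MapsInto (pull f).1 f.1) (hmono : ∀ f g, f.1 ≤ g.1 → (pull f).1 ≤ (pull g).1) :
    SClassGroup E inf S L' →ₗ[A] SClassGroup E inf S L where
  toFun x := ⟨fun f => classMap E inf T (hT f) (x.1 (pull f)), fun f g h => by
    have h3 : T.MapsInto (pull f).1 g.1 := fun x hx => by
      obtain ⟨y, hy, h'⟩ := hT f x hx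
      exact ⟨y, h hy, h'⟩
    beta_reduce
    rw [← x.2 (pull f) (pull g) (hmono f g h),
      classMap_comp E inf (TauMap.id Fq K L) T T (fun _ => rfl) _ _ h3,
      classMap_comp E inf T (TauMap.id Fq K L') T (fun _ => rfl) _ _ h3]⟩
  map_add' x y := Subtype.ext (funext fun f => map_add (classMap E inf T (hT f)) _ _)
  map_smul' a x := Subtype.ext (funext fun f => map_smul (classMap E inf T (hT f)) _ _)

end Limit

section Trace

variable {Fq A Q K : Type*} [Field Fq] [Fintype Fq] [CommRing A] [Algebra Fq A] [Field Q]
  [Field K] [Algebra Fq K] [Algebra A K] [IsScalarTower Fq A K] [Algebra Q K]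
  (L L' : Type*)
  [Field L] [Algebra K L] [Algebra A L] [IsScalarTower A K L] [Algebra Q L] [IsScalarTower Q K L]
  [Field L'] [Algebra K L'] [Algebra A L'] [IsScalarTower A K L'] [Algebra Q L']
  [IsScalarTower Q K L'] [Algebra L L'] [IsScalarTower K L L']

variable (Fq K) in
/-- The trace map `L' → L`. -/
def traceTau : TauMap Fq K L' L where
  toLinearMap := (Algebra.trace L L').restrictScalars K
  map_frob x := by
    change Algebra.trace L L' _ = Algebra.trace L L' _ ^ _
    by_cases hfin : FiniteDimensional L L'
    · by_cases hsep : Algebra.IsSeparable L L'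
      · let _ : Algebra Fq (AlgebraicClosure L) :=
          ((algebraMap K (AlgebraicClosure L)).comp (algebraMap Fq K)).toAlgebra
        apply (algebraMap L (AlgebraicClosure L)).injective
        have h := sum_pow_card_pow Fq (AlgebraicClosure L) Finset.univ
          (fun σ : L' →ₐ[L] AlgebraicClosure L => σ x) 1
        rw [pow_one] at h
        have key : ∀ y : L', algebraMap L (AlgebraicClosure L) (Algebra.trace L L' y) =
            ∑ σ : L' →ₐ[L] AlgebraicClosure L, σ y :=
          fun y => trace_eq_sum_embeddings (AlgebraicClosure L)
        rw [map_pow (algebraMap L (AlgebraicClosure L)), key, key, h]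
        simp only [map_pow]
      · rw [Algebra.trace_eq_zero_of_not_isSeparable hsep]
        simp
    · rw [Algebra.trace_eq_zero_of_not_exists_basis]
      · simp
      · rintro ⟨s, ⟨b⟩⟩
        exact hfin (Module.Finite.of_basis b)

variable {L}

/-- The ideal `𝔣𝒪_{L'}`. -/
def extIdeal (f : Ideal (IntRing A L)) : Ideal (IntRing A L') :=
  f.map ((IsScalarTower.toAlgHom K L L').restrictScalars A).mapIntegralClosure

theorem traceTau_mapsInto (f : Ideal (IntRing A L)) :
    (traceTau Fq K L L').MapsInto (extIdeal (K := K) L' f) f := by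
  have hint : ∀ b : IntRing A L', ∃ c : IntRing A L, (c : L) = Algebra.trace L L' (b : L') := by
    intro b
    haveI : IsScalarTower A L L' := IsScalarTower.of_algebraMap_eq fun a => by
      rw [IsScalarTower.algebraMap_apply A K L', IsScalarTower.algebraMap_apply A K L,
        IsScalarTower.algebraMap_apply K L L']
    by_cases hfin : FiniteDimensional L L'
    · exact ⟨⟨_, Algebra.isIntegral_trace b.2⟩, rfl⟩
    · refine ⟨0, ?_⟩
      rw [Algebra.trace_eq_zero_of_not_exists_basis]
      · simp
      · rintro ⟨s, ⟨b⟩⟩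
        exact hfin (Module.Finite.of_basis b)
  intro x hx
  change ∃ y ∈ f, (y : L) = Algebra.trace L L' (x : L')
  suffices h : ∀ b : IntRing A L', ∃ y ∈ f, (y : L) = Algebra.trace L L' ((b * x : IntRing A L') : L') by
    simpa using h 1
  induction hx using Submodule.span_induction with
  | mem z hz =>
    obtain ⟨y, hy, rfl⟩ := hz
    intro b
    obtain ⟨c, hc⟩ := hint b
    refine ⟨c * y, f.mul_mem_left c hy, ?_⟩
    change (c : L) * (y : L) = Algebra.trace L L' ((b : L') * algebraMap L L' (y : L))
    rw [hc, mul_comm (b : L'), ← Algebra.smul_def, map_smul, smul_eq_mul, mul_comm]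
  | zero => exact fun b => ⟨0, f.zero_mem, by simp⟩
  | add x y _ _ hx hy =>
    intro b
    obtain ⟨u, hu, hu'⟩ := hx b
    obtain ⟨v, hv, hv'⟩ := hy b
    refine ⟨u + v, f.add_mem hu hv, ?_⟩
    rw [mul_add]
    push_cast
    rw [map_add, hu', hv']
    push_cast
    rfl
  | smul c x _ hx =>
    intro b
    obtain ⟨y, hy, h⟩ := hx (b * c)
    refine ⟨y, hy, ?_⟩
    rw [h, smul_eq_mul, mul_assoc]

/-- `𝔣𝒪_{L'}` as a modulus of `L'`. -/
def extModulus {S : Set (FinPlace A K)} (f : Moduli S L) : Moduli S L' :=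
  ⟨extIdeal (K := K) L' f.1, by
    obtain ⟨x, hx, hx0⟩ := Submodule.exists_mem_ne_zero_of_ne_bot f.2.1
    intro h
    have h1 := Ideal.mem_map_of_mem
      ((IsScalarTower.toAlgHom K L L').restrictScalars A).mapIntegralClosure hx
    have h2 : ((IsScalarTower.toAlgHom K L L').restrictScalars A).mapIntegralClosure x = 0 := by
      rw [← Ideal.mem_bot, ← h]
      exact h1
    have h3 : algebraMap L L' (x : L) = 0 := congrArg Subtype.val h2
    exact hx0 (Subtype.ext ((map_eq_zero _).mp h3)), fun w hw =>
    f.2.2.exists_of_lt_one f.2.1 (IsScalarTower.toAlgHom K L L') w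
      (fun x hx => hw _ (Ideal.mem_map_of_mem _ hx))⟩

variable (E : DrinfeldModule Fq A K) (inf : ValuationSubring Q) [IsIntegrallyClosedIn Fq A]
  [FaithfulSMul A K]

variable (L)

/-- The map `H_S(E/𝒪_{L'}) → H_S(E/𝒪_L)` induced by the trace. Its component at `𝔣` is computed
with the modulus `𝔣𝒪_{L'}`, whose trace is contained in `𝔣`. -/
def traceMap (S : Set (FinPlace A K)) : SClassGroup E inf S L' →ₗ[A] SClassGroup E inf S L :=
  limMap E inf (traceTau Fq K L L') (extModulus L') (fun f => traceTau_mapsInto L' f.1)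
    (fun _ _ h => Ideal.map_mono h)

end Trace

section Galois

variable {Fq A Q K : Type*} [Field Fq] [Fintype Fq] [CommRing A] [Algebra Fq A] [Field Q]
  [Field K] [Algebra Fq K] [Algebra A K] [IsScalarTower Fq A K] [Algebra Q K]
  {L : Type*}
  [Field L] [Algebra K L] [Algebra A L] [IsScalarTower A K L] [Algebra Q L] [IsScalarTower Q K L]

variable (Fq) in
/-- An automorphism `σ` of `L/K`, as a map `L → L`. -/
def galTau (σ : L ≃ₐ[K] L) : TauMap Fq K L L where
  toLinearMap := σ.toLinearMap
  map_frob x := map_pow σ x _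

/-- The modulus `σ⁻¹(𝔣)`. -/
def galModulus {S : Set (FinPlace A K)} (σ : L ≃ₐ[K] L) (f : Moduli S L) : Moduli S L :=
  ⟨f.1.comap (σ.restrictScalars A).mapIntegralClosure, by
    obtain ⟨x, hx, hx0⟩ := Submodule.exists_mem_ne_zero_of_ne_bot f.2.1
    intro h
    have h1 : (σ.restrictScalars A).mapIntegralClosure.symm x ∈
        f.1.comap (σ.restrictScalars A).mapIntegralClosure := by
      rw [Ideal.mem_comap, AlgEquiv.apply_symm_apply]
      exact hx
    rw [h, Ideal.mem_bot] at h1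
    exact hx0 ((map_eq_zero_iff _ (AlgEquiv.injective _)).mp h1), fun w hw =>
    f.2.2.exists_of_lt_one f.2.1 (σ.symm : L →ₐ[K] L) w (fun x hx => by
      refine hw ((σ.restrictScalars A).mapIntegralClosure.symm x) ?_
      rw [Ideal.mem_comap, AlgEquiv.apply_symm_apply]
      exact hx)⟩

variable (E : DrinfeldModule Fq A K) (inf : ValuationSubring Q) [IsIntegrallyClosedIn Fq A]
  [FaithfulSMul A K]

/-- The action of `σ ∈ Gal(L/K)` on `H_S(E/𝒪_L)`. The component of `σ x` at `𝔣` is the image under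
`σ` of the component of `x` at `σ⁻¹(𝔣)`. -/
def galMap (S : Set (FinPlace A K)) (σ : L ≃ₐ[K] L) :
    SClassGroup E inf S L →ₗ[A] SClassGroup E inf S L :=
  limMap E inf (galTau Fq σ) (galModulus σ)
    (fun _ x hx => ⟨(σ.restrictScalars A).mapIntegralClosure x, hx, rfl⟩)
    (fun _ _ h => Ideal.comap_mono h)

end Galois

section Equivariance

variable {Fq A Q K : Type*} [Field Fq] [Fintype Fq] [CommRing A] [Algebra Fq A] [Field Q]
  [Field K] [Algebra Fq K] [Algebra A K] [IsScalarTower Fq A K] [Algebra Q K]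
  {L L' : Type*}
  [Field L] [Algebra K L] [Algebra A L] [IsScalarTower A K L] [Algebra Q L] [IsScalarTower Q K L]
  [Field L'] [Algebra K L'] [Algebra A L'] [IsScalarTower A K L'] [Algebra Q L']
  [IsScalarTower Q K L'] [Algebra L L'] [IsScalarTower K L L']
  (E : DrinfeldModule Fq A K) (inf : ValuationSubring Q) [IsIntegrallyClosedIn Fq A]
  [FaithfulSMul A K]

variable (Fq) in
theorem extModulus_galModulus_le {S : Set (FinPlace A K)} (σ' : L' ≃ₐ[K] L') (σ : L ≃ₐ[K] L)
    (hσ : ∀ x, σ' (algebraMap L L' x) = algebraMap L L' (σ x)) (f : Moduli S L) :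
    (extModulus L' (galModulus σ f)).1 ≤ (galModulus σ' (extModulus L' f)).1 := by
  refine Ideal.map_le_iff_le_comap.mpr fun x hx => ?_
  have h := Ideal.mem_map_of_mem
    ((IsScalarTower.toAlgHom K L L').restrictScalars A).mapIntegralClosure
    (show (σ.restrictScalars A).mapIntegralClosure x ∈ f.1 from hx)
  have h2 : ((IsScalarTower.toAlgHom K L L').restrictScalars A).mapIntegralClosure
      ((σ.restrictScalars A).mapIntegralClosure x) =
      (σ'.restrictScalars A).mapIntegralClosure
        (((IsScalarTower.toAlgHom K L L').restrictScalars A).mapIntegralClosure x) :=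
    Subtype.ext (hσ x).symm
  rw [h2] at h
  exact h

/-- The composition of two maps. -/
def TauMap.comp {L'' : Type*} [Field L''] [Algebra K L''] (T₁ : TauMap Fq K L' L)
    (T₂ : TauMap Fq K L'' L') : TauMap Fq K L'' L where
  toLinearMap := T₁.toLinearMap ∘ₗ T₂.toLinearMap
  map_frob x := by
    rw [LinearMap.comp_apply, T₂.map_frob, T₁.map_frob, LinearMap.comp_apply]

/-- The map induced by the trace commutes with the Galois actions. -/
theorem traceMap_galMap (S : Set (FinPlace A K)) (σ' : L' ≃ₐ[K] L') (σ : L ≃ₐ[K] L)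
    (hσ : ∀ x, σ' (algebraMap L L' x) = algebraMap L L' (σ x)) (x : SClassGroup E inf S L') :
    traceMap L L' E inf S (galMap E inf S σ' x) = galMap E inf S σ (traceMap L L' E inf S x) := by
  refine Subtype.ext (funext fun f => ?_)
  have hle := extModulus_galModulus_le σ' σ hσ f
  have h1 : (galTau Fq σ').MapsInto (galModulus σ' (extModulus L' f)).1 (extModulus L' f).1 :=
    fun x hx => ⟨(σ'.restrictScalars A).mapIntegralClosure x, hx, rfl⟩
  have h2 : (galTau Fq σ).MapsInto (galModulus σ f).1 f.1 :=
    fun x hx => ⟨(σ.restrictScalars A).mapIntegralClosure x, hx, rfl⟩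
  change classMap E inf (traceTau Fq K L L') (traceTau_mapsInto L' f.1)
      (classMap E inf (galTau Fq σ') h1 (x.1 (galModulus σ' (extModulus L' f)))) =
    classMap E inf (galTau Fq σ) h2 (classMap E inf (traceTau Fq K L L')
      (traceTau_mapsInto L' (galModulus σ f).1) (x.1 (extModulus L' (galModulus σ f))))
  have h3 : ((galTau Fq σ).comp (traceTau Fq K L L')).MapsInto
      (extModulus L' (galModulus σ f)).1 f.1 := by
    intro y hy
    obtain ⟨z, hz, h⟩ := traceTau_mapsInto (Fq := Fq) L' (galModulus σ f).1 y hy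
    obtain ⟨u, hu, h'⟩ := h2 z hz
    refine ⟨u, hu, ?_⟩
    rw [h', h]
    rfl
  have h4 : (galTau Fq σ').MapsInto (extModulus L' (galModulus σ f)).1 (extModulus L' f).1 :=
    fun y hy => h1 y (hle hy)
  have hcomm : ∀ y, ((galTau Fq σ).comp (traceTau Fq K L L')).toLinearMap y =
      (traceTau Fq K L L').toLinearMap ((galTau Fq σ').toLinearMap y) := by
    intro y
    change σ (Algebra.trace L L' y) = Algebra.trace L L' (σ' y)
    have h := Algebra.trace_eq_of_equiv_equiv σ.toRingEquiv σ'.toRingEquiv (by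
      ext z
      exact (hσ z).symm) y
    rw [h]
    exact σ.apply_symm_apply _
  have e1 := classMap_comp E inf (galTau Fq σ) (traceTau Fq K L L')
    ((galTau Fq σ).comp (traceTau Fq K L L')) (fun _ => rfl) h2
    (traceTau_mapsInto L' (galModulus σ f).1) h3 (x.1 (extModulus L' (galModulus σ f)))
  have e2 := classMap_comp E inf (galTau Fq σ') (TauMap.id Fq K L') (galTau Fq σ')
    (fun _ => rfl) h1 (mapsInto_id hle) h4 (x.1 (extModulus L' (galModulus σ f)))
  have e3 := classMap_comp E inf (traceTau Fq K L L') (galTau Fq σ')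
    ((galTau Fq σ).comp (traceTau Fq K L L')) hcomm (traceTau_mapsInto L' f.1) h4 h3
    (x.1 (extModulus L' (galModulus σ f)))
  have e4 := x.2 (extModulus L' (galModulus σ f)) (galModulus σ' (extModulus L' f)) hle
  exact (congrArg _ ((congrArg _ e4).symm.trans e2)).trans (e3.trans e1.symm)

end Equivariance

/-! ### Iwasawa modules -/

section Tower

variable {K : Type*} [Field K] (p : ℕ) (M : Type*) [Field M] [Algebra K M]

variable (K) in
/-- The subgroup `Γ^(p^n)` of `Γ = Gal(M/K)` generated by the `p^n`-th powers. -/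
def gammaPow (n : ℕ) : Subgroup (M ≃ₐ[K] M) :=
  Subgroup.closure (Set.range fun g : M ≃ₐ[K] M => g ^ (p ^ n))

variable (K) in
/-- The `n`-th layer `K_n` of a `ℤ_p`-extension `M/K`, the fixed field of `Γ^(p^n)`. -/
def layer (n : ℕ) : IntermediateField K M := IntermediateField.fixedField (gammaPow K p M n)

theorem mem_layer_iff (n : ℕ) (x : M) :
    x ∈ layer K p M n ↔ ∀ g : M ≃ₐ[K] M, (g ^ (p ^ n)) x = x := by
  rw [layer, IntermediateField.mem_fixedField_iff]
  constructor
  · exact fun h g => h _ (Subgroup.subset_closure ⟨g, rfl⟩)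
  · intro h f hf
    induction hf using Subgroup.closure_induction with
    | mem f hf => obtain ⟨g, rfl⟩ := hf; exact h g
    | one => rfl
    | mul f g _ _ hf hg => rw [AlgEquiv.mul_apply, hg, hf]
    | inv f _ hf =>
      have h1 : f⁻¹ (f x) = x := by rw [← AlgEquiv.mul_apply, inv_mul_cancel]; rfl
      rwa [hf] at h1

theorem layer_mono {n m : ℕ} (h : n ≤ m) : layer K p M n ≤ layer K p M m := by
  intro x hx
  rw [mem_layer_iff] at hx ⊢
  intro g
  have h1 : g ^ (p ^ m) = (g ^ (p ^ (m - n))) ^ (p ^ n) := by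
    rw [← pow_mul, ← pow_add, Nat.sub_add_cancel h]
  rw [h1]
  exact hx _

variable {M}

theorem apply_mem_layer (σ : M ≃ₐ[K] M) (n : ℕ) {x : M} (hx : x ∈ layer K p M n) :
    σ x ∈ layer K p M n := by
  rw [mem_layer_iff] at hx ⊢
  intro g
  have h := hx (σ⁻¹ * g * σ⁻¹⁻¹)
  rw [conj_pow, inv_inv] at h
  have h1 : σ ((σ⁻¹ * g ^ p ^ n * σ) x) = σ x := congrArg σ h
  rw [← AlgEquiv.mul_apply, ← mul_assoc, ← mul_assoc, mul_inv_cancel, one_mul,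
    AlgEquiv.mul_apply] at h1
  exact h1

/-- The restriction of `σ ∈ Gal(M/K)` to the layer `K_n`. -/
def layerAut (σ : M ≃ₐ[K] M) (n : ℕ) : layer K p M n ≃ₐ[K] layer K p M n :=
  AlgEquiv.ofAlgHom
    ((σ.toAlgHom.comp (layer K p M n).val).codRestrict (layer K p M n).toSubalgebra
      (fun x => apply_mem_layer p σ n x.2))
    ((σ⁻¹.toAlgHom.comp (layer K p M n).val).codRestrict (layer K p M n).toSubalgebra
      (fun x => apply_mem_layer p σ⁻¹ n x.2))
    (by
      ext x
      exact σ.apply_symm_apply x)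
    (by
      ext x
      exact σ.symm_apply_apply x)

end Tower

section Iwasawa

variable {Fq A Q K : Type*} [Field Fq] [Fintype Fq] [CommRing A] [Algebra Fq A] [Field Q]
  [Field K] [Algebra Fq K] [Algebra A K] [IsScalarTower Fq A K] [Algebra Q K]
  (E : DrinfeldModule Fq A K) (inf : ValuationSubring Q) [IsIntegrallyClosedIn Fq A]
  [FaithfulSMul A K] (S : Set (FinPlace A K)) (p : ℕ)
  (M : Type*) [Field M] [Algebra K M] [Algebra A M] [IsScalarTower A K M] [Algebra Q M]
  [IsScalarTower Q K M]

/-- The map `H_S(E/𝒪_{K_m}) → H_S(E/𝒪_{K_n})` induced by the trace, for `n ≤ m`. -/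
def layerTrace {n m : ℕ} (h : n ≤ m) :
    SClassGroup E inf S (layer K p M m) →ₗ[A] SClassGroup E inf S (layer K p M n) :=
  letI : Algebra (layer K p M n) (layer K p M m) :=
    (IntermediateField.inclusion (layer_mono p M h)).toAlgebra
  haveI : IsScalarTower K (layer K p M n) (layer K p M m) :=
    IsScalarTower.of_algebraMap_eq fun _ => rfl
  traceMap (layer K p M n) (layer K p M m) E inf S

/-- The projective limit of the modules `H_S(E/𝒪_{K_n})` over the layers `K_n` of `M/K`, with
respect to the trace maps, inside their product. -/
def iwasawaSubmodule : Submodule A (∀ n : ℕ, SClassGroup E inf S (layer K p M n)) where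
  carrier := {x | ∀ (n m : ℕ) (h : n ≤ m), layerTrace E inf S p M h (x m) = x n}
  add_mem' hx hy n m h := by rw [Pi.add_apply, map_add, hx n m h, hy n m h, Pi.add_apply]
  zero_mem' n m h := by rw [Pi.zero_apply, map_zero, Pi.zero_apply]
  smul_mem' a x hx n m h := by rw [Pi.smul_apply, map_smul, hx n m h, Pi.smul_apply]

/-- The Iwasawa module `H_S(E/𝒪_M)`, the projective limit of the modules `H_S(E/𝒪_{K_n})` over the
layers `K_n` of `M/K`. -/
def IwasawaModule : Type _ := ↥(iwasawaSubmodule E inf S p M)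

instance : AddCommGroup (IwasawaModule E inf S p M) :=
  (iwasawaSubmodule E inf S p M).addCommGroup

instance : Module A (IwasawaModule E inf S p M) :=
  (iwasawaSubmodule E inf S p M).module

variable {M}

theorem layerTrace_galMap (σ : M ≃ₐ[K] M) {n m : ℕ} (h : n ≤ m)
    (x : SClassGroup E inf S (layer K p M m)) :
    layerTrace E inf S p M h (galMap E inf S (layerAut p σ m) x) =
      galMap E inf S (layerAut p σ n) (layerTrace E inf S p M h x) := by
  letI : Algebra (layer K p M n) (layer K p M m) :=
    (IntermediateField.inclusion (layer_mono p M h)).toAlgebra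
  haveI : IsScalarTower K (layer K p M n) (layer K p M m) :=
    IsScalarTower.of_algebraMap_eq fun _ => rfl
  exact traceMap_galMap E inf S (layerAut p σ m) (layerAut p σ n) (fun _ => rfl) x

/-- The action of `σ ∈ Gal(M/K)` on `H_S(E/𝒪_M)`, componentwise. -/
def iwasawaGal (σ : M ≃ₐ[K] M) : IwasawaModule E inf S p M →ₗ[A] IwasawaModule E inf S p M :=
  LinearMap.restrict (p := iwasawaSubmodule E inf S p M) (q := iwasawaSubmodule E inf S p M)
    (LinearMap.pi fun n => galMap E inf S (layerAut p σ n) ∘ₗ LinearMap.proj n)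
    (fun x hx n m h => (layerTrace_galMap E inf S p σ h (x m)).trans
      (congrArg (galMap E inf S (layerAut p σ n)) (hx n m h)))

theorem iwasawaGal_apply (σ : M ≃ₐ[K] M) (x : IwasawaModule E inf S p M) (n : ℕ) :
    (iwasawaGal E inf S p σ x).1 n = galMap E inf S (layerAut p σ n) (x.1 n) := rfl

end Iwasawa

/-! ### The profinite completion of `A` -/

section ProfiniteCompletion

/-- The projective limit of the finite quotients `A/I` of `A`, inside their product. -/
def profiniteSubring (A : Type*) [CommRing A] :
    Subring (∀ I : {I : Ideal A // Finite (A ⧸ I)}, A ⧸ I.1) where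
  carrier := {x | ∀ (I J : {I : Ideal A // Finite (A ⧸ I)}) (h : I.1 ≤ J.1),
    Ideal.Quotient.factor h (x I) = x J}
  mul_mem' hx hy I J h := by rw [Pi.mul_apply, map_mul, hx I J h, hy I J h, Pi.mul_apply]
  one_mem' I J h := by rw [Pi.one_apply, map_one, Pi.one_apply]
  add_mem' hx hy I J h := by rw [Pi.add_apply, map_add, hx I J h, hy I J h, Pi.add_apply]
  zero_mem' I J h := by rw [Pi.zero_apply, map_zero, Pi.zero_apply]
  neg_mem' hx I J h := by rw [Pi.neg_apply, map_neg, hx I J h, Pi.neg_apply]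

/-- The profinite completion of the commutative ring `A`: the projective limit of the finite
quotients `A/I`. -/
def ProfiniteCompletion (A : Type*) [CommRing A] : Type _ := ↥(profiniteSubring A)

instance (A : Type*) [CommRing A] : CommRing (ProfiniteCompletion A) :=
  (profiniteSubring A).toCommRing

variable {Fq A Q K : Type*} [Field Fq] [Fintype Fq] [CommRing A] [Algebra Fq A] [Field Q]
  [Field K] [Algebra Fq K] [Algebra A K] [IsScalarTower Fq A K] [Algebra Q K]
  (E : DrinfeldModule Fq A K) (inf : ValuationSubring Q) [IsIntegrallyClosedIn Fq A]
  [FaithfulSMul A K] (S : Set (FinPlace A K))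
  (L : Type*) [Field L] [Algebra K L] [Algebra A L] [IsScalarTower A K L] [Algebra Q L]
  [IsScalarTower Q K L]

/-- The given module structure over the profinite completion of `A` on `H_S(E/𝒪_L)` is the natural
one: every `H_𝔣(E/𝒪_L)` is annihilated by an ideal `I` of finite index of `A`, and an element of the
profinite completion acts on the component at `𝔣` as any `a ∈ A` that is congruent to it
modulo `I`. (There is at most one such structure.) -/
def IsNaturalModule [Module (ProfiniteCompletion A) (SClassGroup E inf S L)] : Prop :=
  ∀ f : Moduli S L, ∃ I : {I : Ideal A // Finite (A ⧸ I)},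
    (∀ a ∈ I.1, ∀ z : ClassGroup E inf f.1, a • z = 0) ∧
    ∀ (c : ProfiniteCompletion A) (a : A), c.1 I = Ideal.Quotient.mk I.1 a →
      ∀ x : SClassGroup E inf S L, (c • x).1 f = a • x.1 f

end ProfiniteCompletion

end TaelmanClassGroup

end

/-! Strong approximation removes the finite places: every class of $H_{\mathfrak f}(E/\mathcal O_L)$
has a representative supported at infinity (`infClass_surjective`), and such a representative is
trivial exactly when it lies in $\exp_E(L_\infty)+\mathfrak f$ (`infClass_eq_zero_iff`). Thus
$H_{\mathfrak f}(E/\mathcal O_L)=E(L_\infty)/(\exp_E(L_\infty)+\mathfrak f)$, and the modulus enters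
only as a lattice in $L_\infty$.

For a finite Galois extension $L'/L$ the trace $L'_\infty\to L_\infty$ is surjective, its kernel is
generated by the differences $\sigma y-y$ (additive Hilbert 90, `exists_sum_galTau_sub`), and it
maps exponential values onto exponential values (`expImage_le_map`). Suppose now that the trace of
$z$ is $x$ plus an exponential value, with $x\in\mathrm{Tr}(\mathfrak f')$. Both terms lift to
$L'_\infty$, and after subtracting the lifts $z$ has trace exactly zero. Hence the kernel of
$H_{\mathfrak f'}(E/\mathcal O_{L'})\to H_{\mathrm{Tr}\,\mathfrak f'}(E/\mathcal O_L)$ consists of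
sums of differences $\sigma y-y$ (`exists_sum_of_classMap_traceTau_eq_zero`).

The target here has modulus $\mathrm{Tr}(\mathfrak f\mathcal O_{L'})$, which may be smaller than
$\mathfrak f$. At a tame place some integral element has a trace that is a local unit
(`exists_trace_notMem`), so tameness outside $S$ makes $\mathrm{Tr}(\mathfrak f\mathcal O_{L'})$
again a modulus supported in $S$ (`supported_traceIdeal`). In the projective limit the discrepancy
disappears.

Passing to the limit requires compactness. Each $H_{\mathfrak f}$ is finite (`finite_classGroup`),
because the exponential values contain an open subgroup of $L_\infty$ and $\mathfrak f$ is
cocompact. So $H_S$ is compact Hausdorff, and an equation solvable at every level is solvable in the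
limit (`exists_eq_of_forall_exists`). For a $\mathbb Z_p$-extension with generator $\gamma$, the
group of $K_m/K_n$ is generated by $\gamma^{p^n}$. The kernel of $H_S(E/\mathcal O_{K_m})\to
H_S(E/\mathcal O_{K_n})$ is therefore the image of $\gamma^{p^n}-1$, and compactness is applied once
more. Finally, $\hat A$ acts on a finite $A$-module through a finite quotient of $A$, so $A$-linear
maps between such modules are automatically $\hat A$-linear. -/

noncomputable section

namespace TaelmanClassGroup

/-! ### Integral closures in function fields -/

section FunctionField

open Polynomial

variable (k : Type*) [Field k]

open Classical in
/-- The valuation ring of the place `X = ∞` of `k(X)`. -/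
def inftyRing : ValuationSubring (RatFunc k) := (RatFunc.inftyValuation k).valuationSubring

open Classical in
theorem mem_inftyRing {r : RatFunc k} : r ∈ inftyRing k ↔ RatFunc.inftyValuation k r ≤ 1 :=
  Iff.rfl

theorem exists_inv_X_pow_div_mem_inftyRing {r : RatFunc k} (hr : r ≠ 0) :
    ∃ N : ℕ, ∀ n, N ≤ n → (RatFunc.X : RatFunc k)⁻¹ ^ n / r ∈ inftyRing k := by
  classical
  -- The degree of $X^{-n}/r$ is $-n-\deg r$.
  refine ⟨(-r.intDegree).toNat, fun n hn => ?_⟩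
  rw [mem_inftyRing, map_div₀, map_pow, map_inv₀, RatFunc.inftyValuation.X,
    RatFunc.inftyValuation_apply, RatFunc.inftyValuation_of_nonzero k hr, ← WithZero.exp_neg,
    ← WithZero.exp_nsmul, ← WithZero.exp_sub, ← WithZero.exp_zero, WithZero.exp_le_exp]
  simp only [nsmul_eq_mul]
  omega

/-- Division with remainder: the error is the remainder over the denominator, which has no pole at
infinity. -/
theorem exists_sub_mem_inftyRing (r : RatFunc k) :
    ∃ p : k[X], r - algebraMap k[X] (RatFunc k) p ∈ inftyRing k := by
  classical
  refine ⟨r.num / r.denom, ?_⟩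
  have hd : algebraMap k[X] (RatFunc k) r.denom ≠ 0 := by simpa using r.denom_ne_zero
  have h : r - algebraMap k[X] (RatFunc k) (r.num / r.denom) =
      algebraMap k[X] (RatFunc k) (r.num % r.denom) / algebraMap k[X] (RatFunc k) r.denom := by
    rw [eq_div_iff hd, sub_mul]
    nth_rw 1 [← r.num_div_denom]
    rw [div_mul_cancel₀ _ hd, ← map_mul, ← map_sub]
    congr 1
    rw [EuclideanDomain.mod_eq_sub_mul_div]
    ring
  rw [h]
  by_cases h0 : r.num % r.denom = 0
  · rw [h0, map_zero, zero_div]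
    exact zero_mem _
  · rw [mem_inftyRing, map_div₀, RatFunc.inftyValuation_apply, RatFunc.inftyValuation_apply,
      RatFunc.inftyValuation.polynomial k h0, RatFunc.inftyValuation.polynomial k r.denom_ne_zero,
      ← WithZero.exp_sub, ← WithZero.exp_zero, WithZero.exp_le_exp]
    have := natDegree_le_natDegree (degree_mod_lt r.num r.denom_ne_zero).le
    omega

variable (F : Type*) [Field F] [Algebra (RatFunc k) F] [FiniteDimensional (RatFunc k) F]

variable {F} in
-- Some nonzero `c` in the valuation ring makes `c • y` integral, and high powers of $X^{-1}$ are
-- multiples of `c`.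
theorem exists_isIntegral_inv_X_pow_smul (y : F) :
    ∃ N : ℕ, ∀ n, N ≤ n → IsIntegral (inftyRing k) ((RatFunc.X : RatFunc k)⁻¹ ^ n • y) := by
  obtain ⟨c, hc, h⟩ := exists_integral_multiples (inftyRing k) (RatFunc k) {y}
  have hc0 : (c : RatFunc k) ≠ 0 := by simpa using hc
  obtain ⟨N, hN⟩ := exists_inv_X_pow_div_mem_inftyRing k hc0
  refine ⟨N, fun n hn => ?_⟩
  have h1 : (RatFunc.X : RatFunc k)⁻¹ ^ n • y =
      (⟨_, hN n hn⟩ : inftyRing k) • (c • y) := by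
    change _ = ((RatFunc.X : RatFunc k)⁻¹ ^ n / c) • ((c : RatFunc k) • y)
    rw [smul_smul, div_mul_cancel₀ _ hc0]
  rw [h1]
  exact (h y (Finset.mem_singleton_self y)).smul _

variable {F} in
theorem exists_isIntegral_inv_X_pow_smul_family {ι : Type*} [Finite ι] (y : ι → F) :
    ∃ N : ℕ, ∀ n, N ≤ n → ∀ i, IsIntegral (inftyRing k) ((RatFunc.X : RatFunc k)⁻¹ ^ n • y i) := by
  choose N hN using fun i => exists_isIntegral_inv_X_pow_smul k (y i)
  cases nonempty_fintype ι
  exact ⟨Finset.univ.sup N, fun n hn i => hN i n ((Finset.le_sup (Finset.mem_univ i)).trans hn)⟩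

variable [Algebra k[X] F] [IsScalarTower k[X] (RatFunc k) F]

theorem finite_natDegree_le [Finite k] (n : ℕ) : {p : k[X] | p.natDegree ≤ n}.Finite := by
  have : Finite (degreeLT k (n + 1)) := Finite.of_equiv _ (degreeLTEquiv k (n + 1)).symm.toEquiv
  refine Set.Finite.subset (Set.toFinite (degreeLT k (n + 1) : Set k[X])) fun p hp => ?_
  rw [SetLike.mem_coe, mem_degreeLT]
  exact (degree_le_of_natDegree_le hp).trans_lt (by exact_mod_cast Nat.lt_succ_self n)

theorem isTorsionFree_polynomial : Module.IsTorsionFree k[X] F := by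
  have : FaithfulSMul k[X] F := FaithfulSMul.trans k[X] (RatFunc k) F
  infer_instance

/-- A Riemann–Roch space over a finite field is finite. The minimal polynomial of `x` has
coefficients in $k[X]$. Scaling its roots by $X^{-N}$ gives a polynomial integral at infinity, so
the coefficients have degree at most `N * d`. Finitely many polynomials remain, each with finitely
many roots. -/
theorem finite_integral_bounded [Finite k] (N : ℕ) :
    {x : F | IsIntegral k[X] x ∧
      IsIntegral (inftyRing k) ((RatFunc.X : RatFunc k)⁻¹ ^ N • x)}.Finite := by
  classical
  have := isTorsionFree_polynomial k F
  set d := Module.finrank (RatFunc k) F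
  refine (bUnion_roots_finite (algebraMap k[X] F) d (finite_natDegree_le k (N * d))).subset ?_
  rintro x ⟨hx, hx'⟩
  have hX : (RatFunc.X : RatFunc k)⁻¹ ^ N ≠ 0 := pow_ne_zero _ (inv_ne_zero RatFunc.X_ne_zero)
  have e1 := minpoly.isIntegrallyClosed_eq_field_fractions' (RatFunc k) hx
  have e2 := minpoly.isIntegrallyClosed_eq_field_fractions' (RatFunc k) hx'
  rw [IsIntegrallyClosed.minpoly_smul hX (Algebra.IsIntegral.isIntegral x), e1] at e2
  have hdeg : (minpoly k[X] x).natDegree ≤ d := by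
    rw [← (minpoly.monic hx).natDegree_map (algebraMap k[X] (RatFunc k)), ← e1]
    exact minpoly.natDegree_le x
  simp_rw [Set.mem_iUnion]
  refine ⟨minpoly k[X] x, ⟨hdeg, fun i => ?_⟩, mem_rootSet.2
    ⟨minpoly.ne_zero hx, minpoly.aeval _ x⟩⟩
  change natDegree _ ≤ _
  by_cases h0 : (minpoly k[X] x).coeff i = 0
  · rw [h0, natDegree_zero]
    exact Nat.zero_le _
  have h := congrArg (fun p => coeff p i) e2
  simp only [coeff_scaleRoots, coeff_map] at h
  have h2 : algebraMap k[X] (RatFunc k) ((minpoly k[X] x).coeff i) *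
      ((RatFunc.X : RatFunc k)⁻¹ ^ N) ^ ((minpoly k[X] x).natDegree - i) ∈ inftyRing k := by
    rw [(minpoly.monic hx).natDegree_map] at h
    rw [h]
    exact Subtype.property _
  rw [mem_inftyRing, map_mul, ← pow_mul, map_pow, map_inv₀, RatFunc.inftyValuation.X,
    RatFunc.inftyValuation_apply, RatFunc.inftyValuation.polynomial k h0, ← WithZero.exp_neg,
    ← WithZero.exp_nsmul, ← WithZero.exp_add, ← WithZero.exp_zero, WithZero.exp_le_exp,
    nsmul_eq_mul] at h2
  have h3 : N * ((minpoly k[X] x).natDegree - i) ≤ N * d :=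
    Nat.mul_le_mul_left _ ((Nat.sub_le _ _).trans hdeg)
  zify at h3 ⊢
  push_cast at h2
  linarith

theorem exists_basis_isIntegral : ∃ (s : Finset F) (b : Module.Basis s (RatFunc k) F),
    ∀ i, IsIntegral k[X] (b i) :=
  FiniteDimensional.exists_is_basis_integral k[X] (RatFunc k) F

/-- The integral closure of `k[X]` in a finite extension of `k(X)` is a finite `k[X]`-module, for
a finite field `k`. (The extension need not be separable.) -/
theorem finite_integralClosure [Finite k] : Module.Finite k[X] (integralClosure k[X] F) := by
  obtain ⟨s, b, hb⟩ := exists_basis_isIntegral k F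
  obtain ⟨N, hN⟩ := exists_isIntegral_inv_X_pow_smul_family k b
  have hfin := finite_integral_bounded k F N
  set T := {x : F | IsIntegral k[X] x ∧
      IsIntegral (inftyRing k) ((RatFunc.X : RatFunc k)⁻¹ ^ N • x)}
  -- The trace form can be degenerate in the inseparable case, so coordinates are rounded instead:
  -- after subtracting the polynomial parts of the coordinates of an integral element, the remainder
  -- lies in the finite set `T`.
  suffices h : (Subalgebra.toSubmodule (integralClosure k[X] F)) =
      Submodule.span k[X] (Set.range b ∪ T) from
    Module.Finite.iff_fg.mpr (h ▸ Submodule.fg_span ((Set.finite_range b).union hfin))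
  refine le_antisymm (fun x hx => ?_) (Submodule.span_le.mpr ?_)
  · choose p hp using fun i => exists_sub_mem_inftyRing k (b.repr x i)
    have hP : ∑ i, p i • b i ∈ Submodule.span k[X] (Set.range b) :=
      sum_mem fun i _ => Submodule.smul_mem _ _ (Submodule.subset_span ⟨i, rfl⟩)
    have hd : x - ∑ i, p i • b i =
        ∑ i, (b.repr x i - algebraMap k[X] (RatFunc k) (p i)) • b i := by
      nth_rw 1 [← b.sum_repr x]
      rw [← Finset.sum_sub_distrib]
      simp only [sub_smul, algebraMap_smul]
    have hT : x - ∑ i, p i • b i ∈ T := by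
      constructor
      · exact IsIntegral.sub hx (IsIntegral.sum _ fun i _ => (hb i).smul _)
      · rw [hd, Finset.smul_sum]
        refine IsIntegral.sum _ fun i _ => ?_
        rw [smul_comm]
        exact (hN N le_rfl i).smul (⟨_, hp i⟩ : inftyRing k)
    rw [← sub_add_cancel x (∑ i, p i • b i)]
    exact add_mem (Submodule.subset_span (Or.inr hT))
      (Submodule.span_mono Set.subset_union_left hP)
  · rintro x (⟨i, rfl⟩ | hx)
    · exact hb i
    · exact hx.1

theorem isDedekindDomain_integralClosure [Finite k] :
    IsDedekindDomain (integralClosure k[X] F) := by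
  have hfin := finite_integralClosure k F
  have : IsNoetherianRing (integralClosure k[X] F) := IsNoetherianRing.of_finite k[X] _
  have : IsFractionRing (integralClosure k[X] F) F :=
    integralClosure.isFractionRing_of_finite_extension (RatFunc k) F
  have : Ring.DimensionLEOne (integralClosure k[X] F) := Ring.DimensionLEOne.of_isIntegral k[X] _
  have : IsIntegrallyClosed (integralClosure k[X] F) :=
    integralClosure.isIntegrallyClosedOfFiniteExtension (RatFunc k)
  exact { }

/-- `F = B₀ + X^(-N) B_∞ + (finite set)`, where `B₀` and `B_∞` are the integral closures of `k[X]`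
and of the valuation ring at infinity. -/
theorem exists_finite_sub_mem [Finite k] (N : ℕ) : ∃ V : Set F, V.Finite ∧ ∀ x : F, ∃ v ∈ V,
    ∃ y z : F, IsIntegral k[X] y ∧ IsIntegral (inftyRing k) z ∧
      x - v = y + (RatFunc.X : RatFunc k)⁻¹ ^ N • z := by
  obtain ⟨s, b, hb⟩ := exists_basis_isIntegral k F
  obtain ⟨N₀, hN⟩ := exists_isIntegral_inv_X_pow_smul_family k b
  -- `N₀` makes the basis integral at infinity and `N` supplies the factor $X^{-N}$. The polynomial
  -- part of $X^M$ times a coordinate is divided by $X^M$: the quotient goes to `B₀`, and only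
  -- finitely many remainders are possible.
  set M := N + N₀ with hM
  have : Finite (degreeLT k M) := Finite.of_equiv _ (degreeLTEquiv k M).symm.toEquiv
  let g : (s → degreeLT k M) → F := fun p => ∑ i, ((RatFunc.X : RatFunc k)⁻¹ ^ M *
    algebraMap k[X] (RatFunc k) (p i : k[X])) • b i
  refine ⟨Set.range g, Set.finite_range g, fun x => ?_⟩
  have hX : (RatFunc.X : RatFunc k) ≠ 0 := RatFunc.X_ne_zero
  choose p hp using fun i => exists_sub_mem_inftyRing k (RatFunc.X ^ M * b.repr x i)
  have hmod : ∀ i, p i %ₘ X ^ M ∈ degreeLT k M := fun i => by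
    rw [mem_degreeLT]
    exact (degree_modByMonic_lt _ (monic_X_pow M)).trans_eq (degree_X_pow M)
  refine ⟨_, ⟨fun i => ⟨p i %ₘ X ^ M, hmod i⟩, rfl⟩, ∑ i, (p i /ₘ X ^ M) • b i,
    ∑ i, (RatFunc.X ^ M * b.repr x i - algebraMap k[X] (RatFunc k) (p i)) •
      (RatFunc.X : RatFunc k)⁻¹ ^ N₀ • b i, IsIntegral.sum _ fun i _ => (hb i).smul _,
    IsIntegral.sum _ fun i _ => (hN N₀ le_rfl i).smul (⟨_, hp i⟩ : inftyRing k), ?_⟩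
  nth_rw 1 [← b.sum_repr x]
  rw [Finset.smul_sum, ← Finset.sum_sub_distrib, ← Finset.sum_add_distrib]
  refine Finset.sum_congr rfl fun i _ => ?_
  rw [← algebraMap_smul (RatFunc k) (p i /ₘ X ^ M) (b i), smul_smul, smul_smul, ← sub_smul,
    ← add_smul]
  congr 1
  have h1 := congrArg (algebraMap k[X] (RatFunc k)) (modByMonic_add_div (p i) (X ^ M))
  rw [map_add, map_mul, map_pow, RatFunc.algebraMap_X] at h1
  rw [← h1]
  have h2 : (RatFunc.X : RatFunc k)⁻¹ ^ M * RatFunc.X ^ M = 1 := by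
    rw [← mul_pow, inv_mul_cancel₀ hX, one_pow]
  have h3 : (RatFunc.X : RatFunc k)⁻¹ ^ N * (RatFunc.X : RatFunc k)⁻¹ ^ N₀ =
    (RatFunc.X : RatFunc k)⁻¹ ^ M := by rw [← pow_add]
  linear_combination (-(b.repr x i) + algebraMap k[X] (RatFunc k) (p i /ₘ X ^ M)) * h2 +
    (algebraMap k[X] (RatFunc k) (p i %ₘ X ^ M) +
      RatFunc.X ^ M * algebraMap k[X] (RatFunc k) (p i /ₘ X ^ M) -
      RatFunc.X ^ M * b.repr x i) * h3

end FunctionField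

/-! ### Valuation subrings -/

section Valuations

theorem mem_of_isIntegral {R F : Type*} [CommRing R] [Field F] [Algebra R F]
    (v : ValuationSubring F) (h : ∀ r : R, algebraMap R F r ∈ v) {x : F} (hx : IsIntegral R x) :
    x ∈ v := by
  let f : R →+* v := (algebraMap R F).codRestrict v h
  have hx' : IsIntegral v x := by
    obtain ⟨p, hp, h0⟩ := hx
    refine ⟨p.map f, hp.map f, ?_⟩
    rw [Polynomial.eval₂_map]
    exact h0
  obtain ⟨y, rfl⟩ := IsIntegrallyClosed.isIntegral_iff.mp hx'
  exact y.2

theorem valuation_lt_one_or_eq_one {F : Type*} [Field F] (v : ValuationSubring F) {x : F}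
    (hx : x ∈ v) : v.valuation x < 1 ∨ v.valuation x = 1 :=
  ((v.valuation_le_one_iff x).mpr hx).lt_or_eq

theorem inv_mem_of_valuation_eq_one {F : Type*} [Field F] (v : ValuationSubring F) {x : F}
    (hx : v.valuation x = 1) : x⁻¹ ∈ v := by
  rw [← v.valuation_le_one_iff, map_inv₀, hx, inv_one]

open IsDedekindDomain HeightOneSpectrum in
/-- The valuation subrings of the field of fractions of a Dedekind domain `R` that contain `R` are
the localizations of `R` at its nonzero primes. -/
theorem exists_heightOneSpectrum {R F : Type*} [CommRing R] [IsDedekindDomain R] [Field F]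
    [Algebra R F] [IsFractionRing R F] (v : ValuationSubring F) (hv : v ≠ ⊤)
    (h : ∀ r : R, algebraMap R F r ∈ v) : ∃ P : HeightOneSpectrum R,
      v = (P.valuation F).valuationSubring ∧
      ∀ r : R, r ∈ P.asIdeal ↔ v.valuation (algebraMap R F r) < 1 := by
  let f : R →+* v := (algebraMap R F).codRestrict v h
  have hmem : ∀ r, r ∈ (IsLocalRing.maximalIdeal v).comap f ↔
      v.valuation (algebraMap R F r) < 1 := fun r => (v.valuation_lt_one_iff (f r))
  -- If the centre of `v` on `R` were zero, all nonzero elements of `R` would be units of `v`, and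
  -- `v` would be the whole field.
  have hne : (IsLocalRing.maximalIdeal v).comap f ≠ ⊥ := by
    intro hbot
    apply hv
    rw [eq_top_iff]
    intro x _
    obtain ⟨a, b, hb, rfl⟩ := IsFractionRing.div_surjective (A := R) x
    have hb0 : b ≠ 0 := nonZeroDivisors.ne_zero hb
    have hb1 : b ∉ (IsLocalRing.maximalIdeal v).comap f := by rwa [hbot, Ideal.mem_bot]
    rw [hmem] at hb1
    rw [div_eq_mul_inv]
    exact mul_mem (h a) (inv_mem_of_valuation_eq_one v
      ((valuation_lt_one_or_eq_one v (h b)).resolve_left hb1))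
  let P : HeightOneSpectrum R := ⟨(IsLocalRing.maximalIdeal v).comap f, inferInstance, hne⟩
  refine ⟨P, ?_, hmem⟩
  -- The localization at `P` is contained in `v`, and a discrete valuation ring has no overring
  -- strictly between itself and the field.
  rw [← valuationSubringAtPrime_eq_valuationSubring]
  refine (ValuationSubring.eq_of_le_of_ne_top _ ?_ hv).symm
  rintro x ⟨a, s, hs, rfl⟩
  have hs1 : ¬ v.valuation (algebraMap R F s) < 1 := fun h' => hs ((hmem s).mpr h')
  exact mul_mem (h a) (inv_mem_of_valuation_eq_one v
    ((valuation_lt_one_or_eq_one v (h s)).resolve_left hs1))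

end Valuations

/-! ### Function fields as finite extensions of rational function fields. -/

section Global

open Polynomial

variable {k F : Type*} [Field k] [Field F] [Algebra k F]

open IntermediateField in
/-- A transcendental element `t` of a function field `F` makes `F` a finite extension of the field
of rational functions. -/
theorem IsGlobalFunctionField.exists_algebra (hF : IsGlobalFunctionField k F) {t : F}
    (ht : Transcendental k t) : ∃ (_ : Algebra k[X] F) (_ : Algebra (RatFunc k) F)
      (_ : IsScalarTower k[X] (RatFunc k) F) (_ : FiniteDimensional (RatFunc k) F),
      ∀ p : k[X], algebraMap k[X] F p = aeval t p := by
  have key : ∀ {s : F} (hs : Transcendental k s),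
      letI : Algebra (RatFunc k) F := ((algebraMap k⟮s⟯ F).comp
        (RatFunc.algEquivOfTranscendental s hs : RatFunc k →+* k⟮s⟯)).toAlgebra
      FiniteDimensional (RatFunc k) F ↔ FiniteDimensional k⟮s⟯ F := by
    intro s hs
    letI : Algebra (RatFunc k) F := ((algebraMap k⟮s⟯ F).comp
        (RatFunc.algEquivOfTranscendental s hs : RatFunc k →+* k⟮s⟯)).toAlgebra
    constructor
    · intro h
      exact Module.Finite.of_equiv_equiv (RatFunc.algEquivOfTranscendental s hs).toRingEquiv
        (RingEquiv.refl F) (by ext; rfl)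
    · intro h
      refine Module.Finite.of_equiv_equiv
        (RatFunc.algEquivOfTranscendental s hs).symm.toRingEquiv
        (RingEquiv.refl F) ?_
      ext x
      change algebraMap k⟮s⟯ F (RatFunc.algEquivOfTranscendental s hs
        ((RatFunc.algEquivOfTranscendental s hs).symm x)) = _
      rw [AlgEquiv.apply_symm_apply]
      rfl
  have hfin : FiniteDimensional k⟮t⟯ F := by
    obtain ⟨x, hx, hfin⟩ := hF
    letI : Algebra (RatFunc k) F := ((algebraMap k⟮x⟯ F).comp
        (RatFunc.algEquivOfTranscendental x hx : RatFunc k →+* k⟮x⟯)).toAlgebra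
    have := (key hx).mpr hfin
    have : IsScalarTower k (RatFunc k) F := IsScalarTower.of_algebraMap_eq fun c => by
      change _ = algebraMap k⟮x⟯ F (RatFunc.algEquivOfTranscendental x hx (algebraMap k _ c))
      rw [AlgEquiv.commutes]
      rfl
    exact FunctionField.finiteDimensional_of_adjoin_transcendental ht
  letI i1 : Algebra k[X] F := (aeval t).toAlgebra
  letI i2 : Algebra (RatFunc k) F := ((algebraMap k⟮t⟯ F).comp
        (RatFunc.algEquivOfTranscendental t ht : RatFunc k →+* k⟮t⟯)).toAlgebra
  refine ⟨i1, i2, IsScalarTower.of_algebraMap_eq fun p => ?_, (key ht).mpr hfin, fun p => rfl⟩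
  change aeval t p = algebraMap k⟮t⟯ F (RatFunc.algEquivOfTranscendental t ht
    (algebraMap k[X] (RatFunc k) p))
  rw [RatFunc.algEquivOfTranscendental_algebraMap]
  rw [← aeval_algebraMap_apply]
  rfl

variable [Fintype k]

theorem aeval_mem_valuationSubring (v : ValuationSubring F) {t : F} (ht : t ∈ v) (p : k[X]) :
    aeval t p ∈ v := by
  rw [aeval_eq_sum_range]
  refine sum_mem fun i _ => ?_
  rw [Algebra.smul_def]
  exact mul_mem (algebraMap_mem_valuationSubring v _) (pow_mem ht _)

/-- An element algebraic over a finite field lies in every valuation ring. -/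
theorem transcendental_of_notMem (v : ValuationSubring F) {t : F} (ht : t ∉ v) :
    Transcendental k t := fun h =>
  ht (mem_of_isIntegral v (algebraMap_mem_valuationSubring (Fq := k) v) h.isIntegral)

/-- The restriction of `v` to $k(X)$ is trivial on `k` and has a pole at $X$; the only such
valuation, up to equivalence, is the one at infinity. -/
theorem inftyRing_le [Algebra (RatFunc k) F] [IsScalarTower k (RatFunc k) F]
    (v : ValuationSubring F) (h : algebraMap (RatFunc k) F RatFunc.X ∉ v) (r : inftyRing k) :
    algebraMap (inftyRing k) F r ∈ v := by
  classical
  let w : Valuation (RatFunc k) v.ValueGroup := v.valuation.comap (algebraMap (RatFunc k) F)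
  have : w.IsTrivialOn k := ⟨fun c hc => by
    have h1 : ∀ c : k, w (algebraMap k (RatFunc k) c) ≤ 1 := fun c => by
      change v.valuation (algebraMap (RatFunc k) F (algebraMap k (RatFunc k) c)) ≤ 1
      rw [← IsScalarTower.algebraMap_apply, v.valuation_le_one_iff]
      exact algebraMap_mem_valuationSubring v c
    refine le_antisymm (h1 c) ?_
    have h2 := h1 c⁻¹
    rw [map_inv₀, map_inv₀] at h2
    rwa [inv_le_one₀ (zero_lt_iff.mpr ((Valuation.ne_zero_iff _).mpr (by simpa using hc)))] at h2⟩
  have h1 : 1 < w RatFunc.X := by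
    rw [← not_le]
    exact fun h' => h ((v.valuation_le_one_iff _).mp h')
  have h2 := RatFunc.valuation_isEquiv_inftyValuation_of_one_lt_valuation_X h1
  rw [← v.valuation_le_one_iff]
  exact (Valuation.isEquiv_iff_val_le_one.mp h2).mpr r.2

end Global

/-! ### Elements with a single pole and the ring of regular elements. -/

section RegularRing

open Polynomial

variable {k F : Type*} [Field k] [Field F] [Algebra k F] [Fintype k]

theorem isScalarTower_of_algebraMap_eq_aeval [Algebra k[X] F] [Algebra (RatFunc k) F]
    [IsScalarTower k[X] (RatFunc k) F] {t : F} (h : ∀ p : k[X], algebraMap k[X] F p = aeval t p) :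
    IsScalarTower k (RatFunc k) F := IsScalarTower.of_algebraMap_eq fun c => by
  rw [IsScalarTower.algebraMap_apply k k[X] (RatFunc k), ← IsScalarTower.algebraMap_apply k[X], h,
    Polynomial.algebraMap_eq, aeval_C]

theorem algebraMap_X_eq [Algebra k[X] F] [Algebra (RatFunc k) F]
    [IsScalarTower k[X] (RatFunc k) F] {t : F} (h : ∀ p : k[X], algebraMap k[X] F p = aeval t p) :
    algebraMap (RatFunc k) F RatFunc.X = t := by
  rw [← RatFunc.algebraMap_X, ← IsScalarTower.algebraMap_apply, h, aeval_X]

open IsDedekindDomain HeightOneSpectrum in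
/-- For a place `v₀` of `F` there is an element of `F` with a pole at `v₀` but at no other
place at which `s` is regular. -/
theorem exists_pole (hF : IsGlobalFunctionField k F) {s : F} (hs : Transcendental k s)
    (v₀ : ValuationSubring F) (hv₀ : v₀ ≠ ⊤) (hsv₀ : s ∈ v₀) :
    ∃ x, x ∉ v₀ ∧ ∀ v : ValuationSubring F, v ≠ ⊤ → v ≠ v₀ → s ∈ v → x ∈ v := by
  obtain ⟨_, _, _, _, hX⟩ := hF.exists_algebra hs
  have := isDedekindDomain_integralClosure k F
  have : IsFractionRing (integralClosure k[X] F) F :=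
    integralClosure.isFractionRing_of_finite_extension (RatFunc k) F
  have hR : ∀ v : ValuationSubring F, s ∈ v → ∀ r : integralClosure k[X] F,
      algebraMap _ F r ∈ v := fun v hv r =>
    mem_of_isIntegral v (fun p => by rw [hX]; exact aeval_mem_valuationSubring v hv p) r.2
  obtain ⟨P, hP, hPmem⟩ := exists_heightOneSpectrum v₀ hv₀ (hR v₀ hsv₀)
  -- An element of $P^{-1}$ outside the ring is regular at every other prime `P'`, as multiplication
  -- by some element of $P\setminus P'$ makes it integral. It must then have a pole at `P`, since an
  -- element regular at all primes lies in the ring.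
  obtain ⟨x, hx, hx1⟩ := FractionalIdeal.exists_notMem_one_of_ne_bot (K := F) P.ne_bot
    P.isPrime.ne_top
  have hmem : ∀ v : ValuationSubring F, v ≠ ⊤ → v ≠ v₀ → s ∈ v → x ∈ v := by
    intro v hv hvv hsv
    obtain ⟨P', hP', hPmem'⟩ := exists_heightOneSpectrum v hv (hR v hsv)
    have hne : ¬ P.asIdeal ≤ P'.asIdeal := by
      intro hle
      have h : P = P' := HeightOneSpectrum.ext (P.isMaximal.eq_of_le P'.isPrime.ne_top hle)
      exact hvv (by rw [hP, hP', h])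
    obtain ⟨r, hr, hr'⟩ := SetLike.not_le_iff_exists.mp hne
    rw [hPmem'] at hr'
    have h1 := inv_mem_of_valuation_eq_one v
      ((valuation_lt_one_or_eq_one v (hR v hsv r)).resolve_left hr')
    have h2 := (FractionalIdeal.mem_inv_iff (by simpa using P.ne_bot)).mp hx
      (algebraMap _ F r) (FractionalIdeal.mem_coeIdeal_of_mem _ hr)
    obtain ⟨b, hb⟩ := (FractionalIdeal.mem_one_iff _).mp h2
    have hr0 : algebraMap (integralClosure k[X] F) F r ≠ 0 := by
      intro h0
      rw [h0, map_zero] at hr'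
      exact hr' zero_lt_one
    rw [← mul_inv_cancel_right₀ hr0 x, ← hb]
    exact mul_mem (hR v hsv b) h1
  refine ⟨x, fun hxv₀ => hx1 ?_, hmem⟩
  rw [FractionalIdeal.mem_one_iff]
  have h := mem_integers_of_valuation_le_one (R := integralClosure k[X] F) F x (fun P' => by
    change x ∈ (P'.valuation F).valuationSubring
    by_cases h : (P'.valuation F).valuationSubring = v₀
    · rwa [h]
    · refine hmem _ ?_ h ?_
      · rw [ne_eq, Valuation.valuationSubring_eq_top_iff, not_not]
        infer_instance
      · have hsR : IsIntegral k[X] s := by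
          have : algebraMap k[X] F X = s := by rw [hX, aeval_X]
          rw [← this]
          exact isIntegral_algebraMap
        exact P'.valuation_le_one (⟨s, hsR⟩ : integralClosure k[X] F))
  exact h

/-- There is an element of `F` whose only pole is the place `inf`. -/
theorem exists_mem_regularRing_notMem (hF : IsGlobalFunctionField k F) (inf : ValuationSubring F)
    (hinf : inf ≠ ⊤) : ∃ t ∈ regularRing k inf, t ∉ inf := by
  obtain ⟨t, ht⟩ : ∃ t, t ∉ inf := by
    by_contra! h
    exact hinf (eq_top_iff.mpr fun x _ => h x)
  have htr : Transcendental k t := transcendental_of_notMem inf ht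
  have htinv : ∀ v : ValuationSubring F, t ∉ v → t⁻¹ ∈ v := fun v hv =>
    (v.mem_or_inv_mem t).resolve_left hv
  -- A pigeonhole argument in the place of Riemann–Roch. Two powers of `w` agree modulo `B₀ + B_∞`,
  -- and the `B₀`-part of their difference is the desired element: it is integral over $k[t]$, and
  -- at the poles of `t` other than `inf` it is a difference of elements regular there.
  obtain ⟨w, hw, hw'⟩ := exists_pole hF (s := t⁻¹)
    (fun h => htr (by simpa using h.inv)) inf hinf (htinv inf ht)
  obtain ⟨_, _, _, _, hX⟩ := hF.exists_algebra htr
  have := isScalarTower_of_algebraMap_eq_aeval hX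
  obtain ⟨V, hV, h⟩ := exists_finite_sub_mem k F 0
  choose g hg y z hy hz hyz using h
  have : Finite V := hV
  obtain ⟨i, j, hij, heq⟩ := Finite.exists_ne_map_eq_of_infinite
    (fun n : ℕ => (⟨g (w ^ n), hg _⟩ : V))
  wlog hlt : i < j generalizing i j
  · exact this j i hij.symm heq.symm (lt_of_le_of_ne (not_lt.mp hlt) hij.symm)
  have heq' : g (w ^ i) = g (w ^ j) := congrArg Subtype.val heq
  have e1 := hyz (w ^ i)
  have e2 := hyz (w ^ j)
  rw [heq'] at e1
  rw [pow_zero, one_smul] at e1 e2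
  have e3 : y (w ^ j) - y (w ^ i) = w ^ j - w ^ i - (z (w ^ j) - z (w ^ i)) := by
    linear_combination e1 - e2
  have hzv : ∀ v : ValuationSubring F, t ∉ v → z (w ^ j) - z (w ^ i) ∈ v := fun v hv =>
    mem_of_isIntegral v (inftyRing_le v (by rwa [algebraMap_X_eq hX])) ((hz _).sub (hz _))
  refine ⟨y (w ^ j) - y (w ^ i), fun v hv hvi => ?_, fun hmem => ?_⟩
  · by_cases htv : t ∈ v
    · exact mem_of_isIntegral v (fun p => by rw [hX]; exact aeval_mem_valuationSubring v htv p)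
        ((hy _).sub (hy _))
    · rw [e3]
      have := hw' v hv hvi (htinv v htv)
      exact sub_mem (sub_mem (pow_mem this _) (pow_mem this _)) (hzv v htv)
  -- At `inf` the higher power `w ^ j` dominates, so the pole persists.
  · have h1 : w ^ j - w ^ i ∈ inf := by
      have := add_mem hmem (hzv inf ht)
      rwa [e3, sub_add_cancel] at this
    have h2 : 1 < inf.valuation w := by
      rw [← not_le, inf.valuation_le_one_iff]
      exact hw
    rw [← inf.valuation_le_one_iff, Valuation.map_sub_eq_of_lt_left, map_pow] at h1
    · exact absurd h1 (not_le.mpr (one_lt_pow₀ h2 (by omega)))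
    · rw [map_pow, map_pow]
      exact pow_lt_pow_right₀ h2 hlt

/-- The integral closure of $k[t]$ is the intersection of the valuation rings containing it, and
`inf` is the only proper valuation ring that does not contain `t`. -/
theorem isIntegral_iff_mem_regularRing (inf : ValuationSubring F) {t : F}
    (ht : t ∈ regularRing k inf) (ht' : t ∉ inf) [Algebra k[X] F]
    (hX : ∀ p : k[X], algebraMap k[X] F p = aeval t p) {x : F} :
    IsIntegral k[X] x ↔ x ∈ regularRing k inf := by
  constructor
  · intro hx v hv hvi
    exact mem_of_isIntegral v (fun p => by
      rw [hX]; exact aeval_mem_valuationSubring v (ht v hv hvi) p) hx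
  · intro hx
    by_contra hxR
    have : IsIntegrallyClosedIn (integralClosure k[X] F).toSubring F :=
      inferInstanceAs (IsIntegrallyClosedIn (integralClosure k[X] F) F)
    obtain ⟨V, hV, hxV⟩ := Subring.exists_le_valuationSubring_of_isIntegrallyClosedIn
      (R := (integralClosure k[X] F).toSubring) hxR
    refine hxV (hx V ?_ ?_)
    · rintro rfl
      exact hxV (ValuationSubring.mem_top x)
    · rintro rfl
      refine ht' (hV ?_)
      change IsIntegral k[X] t
      have : algebraMap k[X] F X = t := by rw [hX, aeval_X]
      rw [← this]
      exact isIntegral_algebraMap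

/-- The place `inf` is of rank one: the powers of an element of its maximal ideal tend to `0`. -/
theorem exists_inv_pow_mul_mem (hF : IsGlobalFunctionField k F) (inf : ValuationSubring F) {t : F}
    (ht' : t ∉ inf) (x : F) : ∃ N : ℕ, ∀ n, N ≤ n → t⁻¹ ^ n * x ∈ inf := by
  obtain ⟨_, _, _, _, hX⟩ := hF.exists_algebra (transcendental_of_notMem inf ht')
  have := isScalarTower_of_algebraMap_eq_aeval hX
  obtain ⟨N, hN⟩ := exists_isIntegral_inv_X_pow_smul k x
  refine ⟨N, fun n hn => ?_⟩
  have h := mem_of_isIntegral inf (inftyRing_le inf (by rwa [algebraMap_X_eq hX])) (hN n hn)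
  rwa [Algebra.smul_def, map_pow, map_inv₀, algebraMap_X_eq hX] at h

/-- `F/(A + t^(-N) 𝒪_inf)` is finite. -/
theorem exists_finite_sub_mem_regularRing (hF : IsGlobalFunctionField k F)
    (inf : ValuationSubring F) {t : F} (ht : t ∈ regularRing k inf) (ht' : t ∉ inf) (N : ℕ) :
    ∃ V : Set F, V.Finite ∧ ∀ x : F, ∃ v ∈ V, ∃ y ∈ regularRing k inf, ∃ z ∈ inf,
      x - v = y + t⁻¹ ^ N * z := by
  obtain ⟨_, _, _, _, hX⟩ := hF.exists_algebra (transcendental_of_notMem inf ht')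
  have := isScalarTower_of_algebraMap_eq_aeval hX
  obtain ⟨V, hV, h⟩ := exists_finite_sub_mem k F N
  refine ⟨V, hV, fun x => ?_⟩
  obtain ⟨v, hv, y, z, hy, hz, hxv⟩ := h x
  refine ⟨v, hv, y, (isIntegral_iff_mem_regularRing inf ht ht' hX).mp hy, z,
    mem_of_isIntegral inf (inftyRing_le inf (by rwa [algebraMap_X_eq hX])) hz, ?_⟩
  rw [hxv, Algebra.smul_def, map_pow, map_inv₀, algebraMap_X_eq hX]

end RegularRing

/-! ### Integer rings -/

section IntegerRings

open Polynomial

theorem isDedekindDomain_of_isIntegralClosure (k F C : Type*) [Field k] [Finite k] [Field F]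
    [Algebra k[X] F] [Algebra (RatFunc k) F] [IsScalarTower k[X] (RatFunc k) F]
    [FiniteDimensional (RatFunc k) F] [CommRing C] [IsDomain C] [Algebra k[X] C] [Algebra C F]
    [IsScalarTower k[X] C F] [IsIntegralClosure C k[X] F] :
    Module.Finite k[X] C ∧ IsDedekindDomain C ∧ IsFractionRing C F ∧ ¬ IsField C := by
  have h1 := finite_integralClosure k F
  have hfin : Module.Finite k[X] C :=
    Module.Finite.equiv (IsIntegralClosure.equiv k[X] (integralClosure k[X] F) F C).toLinearEquiv
  have : IsNoetherianRing C := IsNoetherianRing.of_finite k[X] _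
  have hfrac : IsFractionRing C F :=
    IsIntegralClosure.isFractionRing_of_finite_extension k[X] (RatFunc k) F C
  have hint : Algebra.IsIntegral k[X] C := IsIntegralClosure.isIntegral_algebra k[X] F
  have : Ring.DimensionLEOne C := Ring.DimensionLEOne.of_isIntegral k[X] _
  have : IsIntegrallyClosed C := (isIntegrallyClosed_iff F).mpr fun {x} hx =>
    ⟨IsIntegralClosure.mk' C x (isIntegral_trans (R := k[X]) _ hx),
      IsIntegralClosure.algebraMap_mk' _ _ _⟩
  refine ⟨hfin, { }, hfrac, fun hC => ?_⟩
  have hinj : Function.Injective (algebraMap k[X] C) := by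
    have h2 : Function.Injective (algebraMap k[X] F) := by
      rw [IsScalarTower.algebraMap_eq k[X] (RatFunc k) F]
      exact (algebraMap (RatFunc k) F).injective.comp (RatFunc.algebraMap_injective k)
    rw [IsScalarTower.algebraMap_eq k[X] C F] at h2
    exact Function.Injective.of_comp h2
  exact Polynomial.not_isField k (isField_of_isIntegral_of_isField hinj hC)

variable {Fq Q : Type*} [Field Fq] [Fintype Fq] [Field Q] [Algebra Fq Q]

/-- A transcendental `t` in `Q` stays transcendental in `K`, and both fields are finite over the
rational functions in `t`. -/
theorem finiteDimensional_of_isGlobalFunctionField (hQ : IsGlobalFunctionField Fq Q)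
    (inf : ValuationSubring Q) (hinf : inf ≠ ⊤) (K : Type*) [Field K] [Algebra Fq K] [Algebra Q K]
    [IsScalarTower Fq Q K] (hK : IsGlobalFunctionField Fq K) : FiniteDimensional Q K := by
  obtain ⟨t, ht, ht'⟩ := exists_mem_regularRing_notMem hQ inf hinf
  have htr : Transcendental Fq t := transcendental_of_notMem inf ht'
  have htr' : Transcendental Fq (algebraMap Q K t) :=
    (transcendental_algebraMap_iff (algebraMap Q K).injective).mpr htr
  obtain ⟨_, _, _, _, hX⟩ := hQ.exists_algebra htr
  obtain ⟨_, _, _, _, hX'⟩ := hK.exists_algebra htr'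
  have : IsScalarTower (RatFunc Fq) Q K := IsScalarTower.of_algebraMap_eq' (by
    refine IsLocalization.ringHom_ext (nonZeroDivisors Fq[X]) ?_
    refine RingHom.ext fun p => ?_
    simp only [RingHom.comp_apply]
    rw [← IsScalarTower.algebraMap_apply Fq[X] (RatFunc Fq) K,
      ← IsScalarTower.algebraMap_apply Fq[X] (RatFunc Fq) Q, hX', hX,
      aeval_algebraMap_apply])
  exact Module.Finite.of_restrictScalars_finite (RatFunc Fq) Q K

/-- The structure of the integer ring `𝒪_L` of a finite extension `L` of `Q`. -/
theorem intRing_structure (hQ : IsGlobalFunctionField Fq Q) (inf : ValuationSubring Q)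
    (hinf : inf ≠ ⊤) (A : Type*) [CommRing A] [Algebra A Q] [FaithfulSMul A Q] [Algebra Fq A]
    [IsScalarTower Fq A Q] (hA : Set.range (algebraMap A Q) = regularRing Fq inf)
    (L : Type*) [Field L] [Algebra Q L] [Algebra A L]
    [IsScalarTower A Q L] [FiniteDimensional Q L] :
    Module.Finite A (IntRing A L) ∧ IsDedekindDomain (IntRing A L) ∧
      IsFractionRing (IntRing A L) L ∧ ¬ IsField (IntRing A L) ∧
      ∀ P : Ideal (IntRing A L), P.IsMaximal → Finite (IntRing A L ⧸ P) := by
  obtain ⟨t', ht, ht'⟩ := exists_mem_regularRing_notMem hQ inf hinf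
  rw [← SetLike.mem_coe, ← hA] at ht
  obtain ⟨t, rfl⟩ := ht
  have ht : algebraMap A Q t ∈ regularRing Fq inf := by
    rw [← SetLike.mem_coe, ← hA]
    exact ⟨t, rfl⟩
  obtain ⟨_, _, _, _, hX⟩ := hQ.exists_algebra (transcendental_of_notMem inf ht')
  letI : Algebra Fq[X] A := (aeval t).toAlgebra
  have : IsScalarTower Fq[X] A Q := IsScalarTower.of_algebraMap_eq fun p => by
    rw [hX]
    exact aeval_algebraMap_apply Q t p
  letI : Algebra Fq[X] L := ((algebraMap Q L).comp (algebraMap Fq[X] Q)).toAlgebra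
  letI : Algebra (RatFunc Fq) L := ((algebraMap Q L).comp (algebraMap (RatFunc Fq) Q)).toAlgebra
  have : IsScalarTower (RatFunc Fq) Q L := IsScalarTower.of_algebraMap_eq fun _ => rfl
  have : IsScalarTower Fq[X] Q L := IsScalarTower.of_algebraMap_eq fun _ => rfl
  have : IsScalarTower Fq[X] (RatFunc Fq) L := IsScalarTower.of_algebraMap_eq fun p => by
    change algebraMap Q L (algebraMap Fq[X] Q p) = algebraMap Q L _
    rw [← IsScalarTower.algebraMap_apply Fq[X] (RatFunc Fq) Q]
  have : FiniteDimensional (RatFunc Fq) L := FiniteDimensional.trans (RatFunc Fq) Q L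
  have : IsScalarTower Fq[X] A L := IsScalarTower.of_algebraMap_eq fun p => by
    change algebraMap Q L (algebraMap Fq[X] Q p) = _
    rw [IsScalarTower.algebraMap_apply A Q L, ← IsScalarTower.algebraMap_apply Fq[X] A Q]
  -- Since `A` is integral over the polynomials in `t`, the integral closures of `A` and of this
  -- polynomial ring in `L` coincide.
  have : Algebra.IsIntegral Fq[X] A := ⟨fun x => by
    have h := (isIntegral_iff_mem_regularRing inf ht ht' hX (x := algebraMap A Q x)).mpr (by
      rw [← SetLike.mem_coe, ← hA]
      exact ⟨x, rfl⟩)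
    exact (isIntegral_algebraMap_iff (FaithfulSMul.algebraMap_injective A Q)).mp h⟩
  have : IsIntegralClosure (IntRing A L) Fq[X] L := {
    algebraMap_injective := Subtype.val_injective
    isIntegral_iff := fun {x} => by
      constructor
      · intro hx
        exact ⟨⟨x, hx.tower_top⟩, rfl⟩
      · rintro ⟨y, rfl⟩
        exact isIntegral_trans (A := A) _ y.2 }
  obtain ⟨h1, h2, h3, h4⟩ := isDedekindDomain_of_isIntegralClosure Fq L (IntRing A L)
  refine ⟨Module.Finite.of_restrictScalars_finite Fq[X] _ _, h2, h3, h4, fun P hP => ?_⟩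
  -- The residue field is a finitely generated algebra over `Fq`, hence finite over it by the
  -- Nullstellensatz.
  letI := Ideal.Quotient.field P
  have : Module.Finite Fq[X] (IntRing A L ⧸ P) :=
    Module.Finite.of_surjective (Ideal.Quotient.mkₐ Fq[X] P).toLinearMap
      Ideal.Quotient.mk_surjective
  letI : Algebra Fq (IntRing A L ⧸ P) :=
    ((algebraMap Fq[X] (IntRing A L ⧸ P)).comp (algebraMap Fq Fq[X])).toAlgebra
  have : IsScalarTower Fq Fq[X] (IntRing A L ⧸ P) := IsScalarTower.of_algebraMap_eq fun _ => rfl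
  have : Algebra.FiniteType Fq (IntRing A L ⧸ P) :=
    Algebra.FiniteType.trans (S := Fq[X]) inferInstance inferInstance
  have := finite_of_finite_type_of_isJacobsonRing Fq (IntRing A L ⧸ P)
  exact Module.finite_of_finite Fq

end IntegerRings

/-! ### Completions -/

section Completion

variable {F : Type*} [Field F] (v : ValuationSubring F)

theorem mem_cmplInt {c : Cmpl v} : c ∈ cmplInt v ↔ Valued.v c ≤ (1 : v.ValueGroup) := Iff.rfl

theorem valued_algebraMap (x : F) :
    (Valued.v (algebraMap F (Cmpl v) x) : v.ValueGroup) = v.valuation x := by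
  change Valued.v ((((WithVal.equiv v.valuation).symm x : WithVal v.valuation)) : Cmpl v) = _
  rw [Valued.valuedCompletion_apply]
  rfl

theorem algebraMap_mem_cmplInt {x : F} : algebraMap F (Cmpl v) x ∈ cmplInt v ↔ x ∈ v := by
  rw [mem_cmplInt, valued_algebraMap, v.valuation_le_one_iff]

theorem isOpen_cmplInt : IsOpen (cmplInt v : Set (Cmpl v)) := Valued.isOpen_integer _

theorem denseRange_algebraMap : DenseRange (algebraMap F (Cmpl v)) := by
  have h := UniformSpace.Completion.denseRange_coe (α := WithVal v.valuation)
  exact h.comp (WithVal.equiv v.valuation).symm.surjective.denseRange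
    (UniformSpace.Completion.continuous_coe _)

theorem exists_sub_mem_of_isOpen (U : AddSubgroup (Cmpl v)) (hU : IsOpen (U : Set (Cmpl v)))
    (c : Cmpl v) : ∃ x : F, c - algebraMap F (Cmpl v) x ∈ U := by
  have ho : IsOpen ((fun y => c - y) ⁻¹' (U : Set (Cmpl v))) :=
    hU.preimage (by fun_prop)
  obtain ⟨x, hx⟩ := (denseRange_algebraMap v).exists_mem_open ho ⟨c, by simp⟩
  exact ⟨x, hx⟩

theorem exists_eq_algebraMap_add_mul (c : Cmpl v) {d : F} (hd : d ≠ 0) :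
    ∃ x : F, ∃ c' ∈ cmplInt v, c = algebraMap F (Cmpl v) x + algebraMap F (Cmpl v) d * c' := by
  have hd' : algebraMap F (Cmpl v) d ≠ 0 := by simpa using hd
  obtain ⟨x, hx⟩ := exists_sub_mem_of_isOpen v (cmplInt v).toAddSubgroup (isOpen_cmplInt v)
    ((algebraMap F (Cmpl v) d)⁻¹ * c)
  refine ⟨d * x, _, hx, ?_⟩
  rw [mul_sub, mul_inv_cancel_left₀ hd', map_mul]
  ring

/-- The `i`-th coordinate `L ⊗ F_v → F_v` with respect to a basis of `L` over `F`. -/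
def coordMap {L ι : Type*} [Field L] [Algebra F L] (b : Module.Basis ι F L) (i : ι)
    (B : Type*) [CommRing B] [Algebra F B] :
    L ⊗[F] B →ₗ[F] B :=
  (TensorProduct.lid F B).toLinearMap ∘ₗ LinearMap.rTensor B (b.coord i)

theorem coordMap_tmul {L ι : Type*} [Field L] [Algebra F L] (b : Module.Basis ι F L) (i : ι)
    (B : Type*) [CommRing B] [Algebra F B] (x : L) (c : B) :
    coordMap b i B (x ⊗ₜ c) = algebraMap F B (b.repr x i) * c := by
  rw [← Algebra.smul_def]
  rfl

theorem tmul_eq_sum_basis {L ι : Type*} [Field L] [Algebra F L] [Fintype ι]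
    (b : Module.Basis ι F L) {B : Type*} [CommRing B] [Algebra F B] (x : L) (c : B) :
    x ⊗ₜ[F] c = ∑ i, b i ⊗ₜ[F] (algebraMap F B (b.repr x i) * c) := by
  nth_rw 1 [← b.sum_repr x]
  rw [TensorProduct.sum_tmul]
  exact Finset.sum_congr rfl fun i _ => by
    rw [TensorProduct.smul_tmul, Algebra.smul_def]

end Completion

/-! ### Local structure of ideals -/

section LocalIdeals

variable {A K L : Type*} [CommRing A] [Field K] [Algebra A K] [Field L] [Algebra K L]
  [Algebra A L] [IsScalarTower A K L] [FiniteDimensional K L]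

/-- An arbitrary basis is multiplied by a common denominator and by a nonzero element of `f`. With
coordinates in such a basis, integrality of the coordinates implies membership in the local ideal.
-/
theorem exists_basis_mem [IsFractionRing (IntRing A K) K]
    {f : Ideal (IntRing A L)} (hf : f ≠ ⊥) :
    ∃ (n : ℕ) (b : Module.Basis (Fin n) K L), ∀ i, ∃ x ∈ f, (x : L) = b i := by
  classical
  obtain ⟨g, hg, hg0⟩ := Submodule.exists_mem_ne_zero_of_ne_bot hf
  have hg0' : (g : L) ≠ 0 := fun h => hg0 (Subtype.ext h)
  let b := Module.finBasis K L
  obtain ⟨s, hs, hsb⟩ := exists_integral_multiples (IntRing A K) K (Finset.univ.image b)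
  have hs0 : algebraMap (IntRing A K) L s ≠ 0 := by
    rw [IsScalarTower.algebraMap_apply (IntRing A K) K L]
    simpa using hs
  have hu : IsUnit ((g : L) * algebraMap (IntRing A K) L s) := (mul_ne_zero hg0' hs0).isUnit
  let m : L ≃ₗ[K] L := LinearEquiv.ofBijective
    (LinearMap.mulLeft K ((g : L) * algebraMap (IntRing A K) L s))
    ⟨fun x y h => hu.mul_left_cancel h, fun y => ⟨hu.unit⁻¹ * y, by
      change ((g : L) * algebraMap (IntRing A K) L s) * _ = _
      rw [← mul_assoc, IsUnit.mul_val_inv, one_mul]⟩⟩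
  refine ⟨_, b.map m, fun i => ?_⟩
  have h := hsb (b i) (Finset.mem_image_of_mem _ (Finset.mem_univ i))
  have h' : IsIntegral A (s • b i) := isIntegral_trans (A := IntRing A K) _ h
  refine ⟨g * ⟨_, h'⟩, f.mul_mem_right _ hg, ?_⟩
  change (g : L) * (s • b i) = (g : L) * algebraMap (IntRing A K) L s * b i
  rw [Algebra.smul_def, mul_assoc]

/-- The `v`-span of the ideal `f` in `L`. -/
def locSpan (f : Ideal (IntRing A L)) (v : ValuationSubring K) : AddSubgroup L :=
  AddSubgroup.closure {z | ∃ x ∈ f, ∃ c ∈ v, z = c • (x : L)}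

variable {f : Ideal (IntRing A L)} (v : ValuationSubring K)

omit [FiniteDimensional K L] in
theorem mul_tmul_mem_locIdeal {x : L} (hx : x ∈ locSpan f v) {c : Cmpl v} (hc : c ∈ cmplInt v) :
    x ⊗ₜ[K] c ∈ locIdeal f v := by
  induction hx using AddSubgroup.closure_induction with
  | mem z hz =>
    obtain ⟨x, hx, d, hd, rfl⟩ := hz
    refine AddSubgroup.subset_closure ⟨x, hx, algebraMap K (Cmpl v) d * c,
      mul_mem ((algebraMap_mem_cmplInt v).mpr hd) hc, ?_⟩
    rw [TensorProduct.smul_tmul, Algebra.smul_def]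
  | zero => rw [TensorProduct.zero_tmul]; exact zero_mem _
  | add x y _ _ hx hy => rw [TensorProduct.add_tmul]; exact add_mem hx hy
  | neg x _ hx => rw [TensorProduct.neg_tmul]; exact neg_mem hx

variable [IsFractionRing (IntRing A K) K]

/-- Density of $K$ in $K_v$, applied to the coordinates in a basis taken from `f`: the integral
errors are absorbed by the local ideal. -/
theorem exists_tmul_sub_mem_locIdeal (hf : f ≠ ⊥) (z : LocAlg v L) :
    ∃ x : L, z - x ⊗ₜ[K] 1 ∈ locIdeal f v := by
  obtain ⟨n, b, hb⟩ := exists_basis_mem (K := K) hf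
  induction z using TensorProduct.induction_on with
  | zero => exact ⟨0, by simp⟩
  | add z w hz hw =>
    obtain ⟨x, hx⟩ := hz
    obtain ⟨y, hy⟩ := hw
    refine ⟨x + y, ?_⟩
    rw [TensorProduct.add_tmul, add_sub_add_comm]
    exact add_mem hx hy
  | tmul x c =>
    rw [tmul_eq_sum_basis b]
    have h : ∀ i, ∃ y : L, b i ⊗ₜ[K] (algebraMap K (Cmpl v) (b.repr x i) * c) - y ⊗ₜ[K] 1 ∈
        locIdeal f v := by
      intro i
      obtain ⟨d, c', hc', h⟩ := exists_eq_algebraMap_add_mul v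
        (algebraMap K (Cmpl v) (b.repr x i) * c) one_ne_zero
      obtain ⟨y, hy, hyb⟩ := hb i
      refine ⟨d • b i, ?_⟩
      rw [h, map_one, one_mul, TensorProduct.tmul_add, TensorProduct.smul_tmul,
        Algebra.algebraMap_eq_smul_one, add_sub_cancel_left, ← hyb]
      exact AddSubgroup.subset_closure ⟨y, hy, c', hc', rfl⟩
    choose y hy using h
    refine ⟨∑ i, y i, ?_⟩
    rw [TensorProduct.sum_tmul, ← Finset.sum_sub_distrib]
    exact sum_mem fun i _ => hy i

/-- Coefficients from the completed valuation ring are replaced by coefficients from `v`. When the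
basis lies in `f`, the remaining error is again in the span of `f`, which is how local membership
descends to `L`. -/
theorem exists_sub_tmul_mem {n : ℕ} (b : Module.Basis (Fin n) K L)
    {z : LocAlg v L} (hz : z ∈ locIdeal f v) : ∃ x ∈ locSpan f v,
      ∀ i, coordMap b i (Cmpl v) (z - x ⊗ₜ[K] 1) ∈ cmplInt v := by
  induction hz using AddSubgroup.closure_induction with
  | zero => exact ⟨0, zero_mem _, fun i => by simp⟩
  | add z w _ _ hz hw =>
    obtain ⟨x, hx, hx'⟩ := hz
    obtain ⟨y, hy, hy'⟩ := hw
    refine ⟨x + y, add_mem hx hy, fun i => ?_⟩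
    rw [TensorProduct.add_tmul, add_sub_add_comm, map_add]
    exact add_mem (hx' i) (hy' i)
  | neg z _ hz =>
    obtain ⟨x, hx, hx'⟩ := hz
    refine ⟨-x, neg_mem hx, fun i => ?_⟩
    rw [TensorProduct.neg_tmul, ← neg_sub', map_neg]
    exact neg_mem (hx' i)
  | mem z hz =>
    obtain ⟨x, hx, c, hc, rfl⟩ := hz
    classical
    -- `d` is a common denominator of the coordinates of `x`; approximating `c` modulo `d` makes the
    -- coordinates of the error integral.
    obtain ⟨d, hd⟩ := IsLocalization.exist_integer_multiples_of_finset (nonZeroDivisors v)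
      (Finset.univ.image fun i => b.repr (x : L) i)
    have hd0 : (d.1 : K) ≠ 0 := fun h => nonZeroDivisors.ne_zero d.2 (Subtype.ext h)
    obtain ⟨y, c', hc', h⟩ := exists_eq_algebraMap_add_mul v c hd0
    have hy : y ∈ v := by
      rw [← algebraMap_mem_cmplInt]
      have h1 : algebraMap K (Cmpl v) y = c - algebraMap K (Cmpl v) d.1 * c' := by rw [h]; ring
      rw [h1]
      exact sub_mem hc (mul_mem ((algebraMap_mem_cmplInt v).mpr d.1.2) hc')
    refine ⟨y • (x : L), AddSubgroup.subset_closure ⟨x, hx, y, hy, rfl⟩, fun i => ?_⟩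
    rw [h, TensorProduct.tmul_add, TensorProduct.smul_tmul, Algebra.algebraMap_eq_smul_one,
      add_sub_cancel_left, coordMap_tmul, ← mul_assoc, ← map_mul]
    refine mul_mem ((algebraMap_mem_cmplInt v).mpr ?_) hc'
    obtain ⟨u, hu⟩ := hd (b.repr (x : L) i) (Finset.mem_image_of_mem _ (Finset.mem_univ i))
    rw [mul_comm]
    change (d.1 : K) * _ ∈ v
    change (u : K) = (d.1 : K) * _ at hu
    rw [← hu]
    exact u.2

/-- `f𝒪_{L,v} ∩ L` is the localization of `f`. -/
theorem mem_locSpan_of_tmul_mem (hf : f ≠ ⊥) {x : L} (hx : x ⊗ₜ[K] 1 ∈ locIdeal f v) :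
    x ∈ locSpan f v := by
  obtain ⟨n, b, hb⟩ := exists_basis_mem (K := K) hf
  obtain ⟨y, hy, h⟩ := exists_sub_tmul_mem v b hx
  rw [← sub_add_cancel x y]
  refine add_mem ?_ hy
  rw [← b.sum_repr (x - y)]
  refine sum_mem fun i _ => ?_
  obtain ⟨u, hu, hub⟩ := hb i
  rw [← hub]
  refine AddSubgroup.subset_closure ⟨u, hu, _, ?_, rfl⟩
  have h1 := h i
  rwa [← TensorProduct.sub_tmul, coordMap_tmul, mul_one, algebraMap_mem_cmplInt] at h1

end LocalIdeals

/-! ### Strong approximation -/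

section Approximation

variable {A K L : Type*} [CommRing A] [Field K] [Algebra A K] [Field L] [Algebra K L]
  [Algebra A L] [IsScalarTower A K L]

theorem FinPlace.intRing_mem (v : FinPlace A K) (x : IntRing A K) :
    algebraMap (IntRing A K) K x ∈ v.1 := mem_of_isIntegral v.1 v.2.2 x.2

variable [IsDedekindDomain (IntRing A K)] [IsFractionRing (IntRing A K) K]

open IsDedekindDomain HeightOneSpectrum

/-- The prime ideal of `𝒪_K` defined by a finite place of `K`. -/
def FinPlace.prime (v : FinPlace A K) : HeightOneSpectrum (IntRing A K) :=
  (exists_heightOneSpectrum v.1 v.2.1 v.intRing_mem).choose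

theorem FinPlace.eq_valuationSubring (v : FinPlace A K) :
    v.1 = (v.prime.valuation K).valuationSubring :=
  (exists_heightOneSpectrum v.1 v.2.1 v.intRing_mem).choose_spec.1

theorem FinPlace.mem_prime (v : FinPlace A K) (x : IntRing A K) :
    x ∈ v.prime.asIdeal ↔ v.1.valuation (x : K) < 1 :=
  (exists_heightOneSpectrum v.1 v.2.1 v.intRing_mem).choose_spec.2 x

theorem FinPlace.prime_injective : Function.Injective (FinPlace.prime (A := A) (K := K)) := by
  intro v w h
  apply Subtype.ext
  rw [v.eq_valuationSubring, w.eq_valuationSubring, h]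

theorem FinPlace.exists_prime_eq (P : HeightOneSpectrum (IntRing A K)) :
    ∃ v : FinPlace A K, v.prime = P := by
  obtain ⟨v, hv⟩ : ∃ v : FinPlace A K, v.1 = (P.valuation K).valuationSubring := by
    refine ⟨⟨(P.valuation K).valuationSubring, ?_, fun a => ?_⟩, rfl⟩
    · rw [ne_eq, Valuation.valuationSubring_eq_top_iff, not_not]
      infer_instance
    · exact P.valuation_le_one (algebraMap A (IntRing A K) a)
  refine ⟨v, HeightOneSpectrum.ext ((v.prime.isMaximal).eq_of_le P.isPrime.ne_top fun x hx => ?_)⟩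
  rw [v.mem_prime, valuation_lt_one_iff, hv] at hx
  rw [← valuation_lt_one_iff_mem (K := K) P]
  rcases hx with hx | hx
  · change P.valuation K (x : K) < 1
    rw [hx, map_zero]
    exact zero_lt_one
  · change ¬ P.valuation K (x : K)⁻¹ ≤ 1 at hx
    rw [map_inv₀, not_le] at hx
    change P.valuation K (x : K) < 1
    by_contra hlt
    exact absurd hx (not_lt.mpr (inv_le_one_of_one_le₀ (not_lt.mp hlt)))

theorem FinPlace.inv_mem (v : FinPlace A K) {s : IntRing A K} (hs : s ∉ v.prime.asIdeal) :
    (s : K)⁻¹ ∈ v.1 := by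
  rw [v.mem_prime] at hs
  exact inv_mem_of_valuation_eq_one _
    ((valuation_lt_one_or_eq_one v.1 (v.intRing_mem s)).resolve_left hs)

theorem FinPlace.exists_eq_mul_inv (v : FinPlace A K) {x : K} (hx : x ∈ v.1) :
    ∃ a s : IntRing A K, s ∉ v.prime.asIdeal ∧ x = a * (s : K)⁻¹ := by
  rw [v.eq_valuationSubring] at hx
  obtain ⟨a, s, h⟩ := exists_primeCompl_mul_eq_of_integer v.prime x hx
  refine ⟨a, s.1, s.2, ?_⟩
  have hs0 : (s.1 : K) ≠ 0 := by
    intro h0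
    refine s.2 ?_
    rw [show s.1 = 0 from Subtype.ext h0]
    exact zero_mem _
  rw [eq_mul_inv_iff_mul_eq₀ hs0]
  exact h

variable {f : Ideal (IntRing A L)}

/-- The product of an element of `𝒪_K` and an element of `L` is in `f`. -/
def smulIdeal (f : Ideal (IntRing A L)) (x : L) : Ideal (IntRing A K) where
  carrier := {s | ∃ y ∈ f, (y : L) = (s : K) • x}
  add_mem' := by
    rintro s t ⟨y, hy, h⟩ ⟨z, hz, h'⟩
    exact ⟨y + z, f.add_mem hy hz, by push_cast; rw [h, h', add_smul]⟩
  zero_mem' := ⟨0, f.zero_mem, by simp⟩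
  smul_mem' := by
    rintro c s ⟨y, hy, h⟩
    refine ⟨(IsScalarTower.toAlgHom A K L).mapIntegralClosure c * y, f.mul_mem_left _ hy, ?_⟩
    change algebraMap K L (c : K) * (y : L) = ((c : K) * (s : K)) • x
    rw [h, mul_smul, Algebra.smul_def (c : K)]

/-- With the converse `mem_locSpan_of_mem_smulIdeal`, this turns local membership of `x` at `v` into
a statement about ideals: the denominator ideal of `x` is not contained in the prime of `v`. -/
theorem exists_mem_smulIdeal (v : FinPlace A K) {x : L} (hx : x ∈ locSpan f v.1) :
    ∃ s ∈ smulIdeal (K := K) f x, s ∉ v.prime.asIdeal := by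
  induction hx using AddSubgroup.closure_induction with
  | mem z hz =>
    obtain ⟨x, hx, c, hc, rfl⟩ := hz
    obtain ⟨a, s, hs, rfl⟩ := v.exists_eq_mul_inv hc
    refine ⟨s, ⟨(IsScalarTower.toAlgHom A K L).mapIntegralClosure a * x, f.mul_mem_left _ hx, ?_⟩,
      hs⟩
    have hs0 : (s : K) ≠ 0 := by
      intro h0
      refine hs ?_
      rw [show s = 0 from Subtype.ext h0]
      exact zero_mem _
    change algebraMap K L (a : K) * (x : L) = (s : K) • ((a : K) * (s : K)⁻¹) • (x : L)
    rw [smul_smul, mul_comm (a : K), mul_inv_cancel_left₀ hs0, Algebra.smul_def]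
  | zero =>
    refine ⟨1, ⟨0, f.zero_mem, by simp⟩, fun h => ?_⟩
    exact v.prime.isPrime.ne_top ((Ideal.eq_top_iff_one _).mpr h)
  | add x y _ _ hx hy =>
    obtain ⟨s, hs, hs'⟩ := hx
    obtain ⟨t, ht, ht'⟩ := hy
    refine ⟨s * t, ?_, fun h => (v.prime.isPrime.mem_or_mem h).elim hs' ht'⟩
    obtain ⟨y₁, h₁, e₁⟩ := (smulIdeal f x).mul_mem_right t hs
    obtain ⟨y₂, h₂, e₂⟩ := (smulIdeal f y).mul_mem_left s ht
    refine ⟨y₁ + y₂, f.add_mem h₁ h₂, ?_⟩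
    push_cast
    rw [e₁, e₂, ← smul_add]
    rfl
  | neg x _ hx =>
    obtain ⟨s, ⟨y, hy, h⟩, hs'⟩ := hx
    exact ⟨s, ⟨-y, f.neg_mem hy, by push_cast; rw [h, smul_neg]⟩, hs'⟩

theorem mem_locSpan_of_mem_smulIdeal (v : FinPlace A K) {x : L} {s : IntRing A K}
    (hs : s ∈ smulIdeal f x) (hs' : s ∉ v.prime.asIdeal) : x ∈ locSpan f v.1 := by
  obtain ⟨y, hy, h⟩ := hs
  have hs0 : (s : K) ≠ 0 := by
    intro h0
    refine hs' ?_
    rw [show s = 0 from Subtype.ext h0]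
    exact zero_mem _
  refine AddSubgroup.subset_closure ⟨y, hy, _, v.inv_mem hs', ?_⟩
  rw [h, smul_smul, inv_mul_cancel₀ hs0, one_smul]

theorem tmul_one_mem_locIdeal {v : ValuationSubring K} {x : L} (hx : x ∈ locSpan f v) :
    x ⊗ₜ[K] 1 ∈ locIdeal f v := mul_tmul_mem_locIdeal v hx (one_mem _)

variable [FiniteDimensional K L]

/-- An element of `L` that is in `f` locally at all finite places is in `f`. -/
theorem mem_of_forall_tmul_mem (hK : ¬ IsField (IntRing A K)) (hf : f ≠ ⊥) {x : L}
    (hx : ∀ v : FinPlace A K, x ⊗ₜ[K] 1 ∈ locIdeal f v.1) : ∃ y ∈ f, (y : L) = x := by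
  -- The denominator ideal is contained in no maximal ideal. Every maximal ideal comes from a finite
  -- place, because the integer ring is not a field.
  have htop : smulIdeal (K := K) f x = ⊤ := by
    by_contra hne
    obtain ⟨m, hm, hle⟩ := Ideal.exists_le_maximal _ hne
    have hm0 : m ≠ ⊥ := Ring.ne_bot_of_isMaximal_of_not_isField hm hK
    obtain ⟨v, hv⟩ := FinPlace.exists_prime_eq (A := A) (K := K) ⟨m, hm.isPrime, hm0⟩
    obtain ⟨s, hs, hs'⟩ := exists_mem_smulIdeal v (mem_locSpan_of_tmul_mem v.1 hf (hx v))
    rw [hv] at hs'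
    exact hs' (hle hs)
  have h1 : (1 : IntRing A K) ∈ smulIdeal (K := K) f x := by
    rw [htop]
    exact Submodule.mem_top
  obtain ⟨y, hy, h⟩ := h1
  exact ⟨y, hy, by rw [h]; exact one_smul K x⟩

/-- A common denominator of the coordinates of `x` in a basis taken from `f` belongs to the ideal.
-/
theorem smulIdeal_ne_bot (hf : f ≠ ⊥) (x : L) : smulIdeal (K := K) f x ≠ ⊥ := by
  classical
  obtain ⟨n, b, hb⟩ := exists_basis_mem (K := K) hf
  obtain ⟨d, hd⟩ := IsLocalization.exist_integer_multiples_of_finset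
    (nonZeroDivisors (IntRing A K)) (Finset.univ.image fun i => b.repr x i)
  refine fun hbot => nonZeroDivisors.ne_zero d.2 ?_
  rw [← Ideal.mem_bot, ← hbot]
  choose c hc using fun i => hd (b.repr x i) (Finset.mem_image_of_mem _ (Finset.mem_univ i))
  choose y hy hyb using hb
  refine ⟨∑ i, (IsScalarTower.toAlgHom A K L).mapIntegralClosure (c i) * y i,
    sum_mem fun i _ => f.mul_mem_left _ (hy i), ?_⟩
  nth_rw 1 [← b.sum_repr x]
  rw [Finset.smul_sum, AddSubmonoidClass.coe_finsetSum]
  refine Finset.sum_congr rfl fun i _ => ?_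
  change algebraMap K L (c i : K) * (y i : L) = _
  rw [hyb, smul_smul, ← Algebra.smul_def]
  congr 1
  exact hc i

/-- Strong approximation for one place. -/
theorem exists_tmul_sub_mem_and (hf : f ≠ ⊥) (v : FinPlace A K) (z : LocAlg v.1 L) :
    ∃ x : L, z - x ⊗ₜ[K] 1 ∈ locIdeal f v.1 ∧
      ∀ w : FinPlace A K, w ≠ v → x ⊗ₜ[K] 1 ∈ locIdeal f w.1 := by
  obtain ⟨x, hx⟩ := exists_tmul_sub_mem_locIdeal v.1 hf z
  obtain ⟨s, hs, hs0⟩ := Submodule.exists_mem_ne_zero_of_ne_bot (smulIdeal_ne_bot (K := K) hf x)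
  -- Write $(s)=P^aJ$ with $P\nmid J$ and $u'+u=1$ with $u'\in P^a$, $u\in J$. Then $ux$ differs
  -- from $x$ by $u'x$, which is in `f` locally at $v$, while $ux$ itself is in `f` locally at all
  -- other places.
  have hfin : FiniteMultiplicity v.prime.asIdeal (Ideal.span {s}) :=
    FiniteMultiplicity.of_prime_left v.prime.prime (by simpa using hs0)
  obtain ⟨J, hJ, hJ'⟩ := hfin.exists_eq_pow_mul_and_not_dvd
  set a := multiplicity v.prime.asIdeal (Ideal.span {s})
  rw [Ideal.dvd_iff_le] at hJ'
  obtain ⟨j, hj, hjP⟩ := SetLike.not_le_iff_exists.mp hJ'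
  have hcop : IsCoprime (v.prime.asIdeal ^ a) J := by
    refine IsCoprime.pow_left ?_
    rw [Ideal.isCoprime_iff_sup_eq]
    exact (Ideal.isMaximal_def.mp v.prime.isMaximal).2 _
      (left_lt_sup.mpr hJ')
  obtain ⟨u', hu', u, hu, huu⟩ := Ideal.isCoprime_iff_exists.mp hcop
  have hsx : ∀ r ∈ v.prime.asIdeal ^ a * J, ((r : K) • x) ∈ (fun y : IntRing A L => (y : L)) '' f := by
    intro r hr
    rw [← hJ, Ideal.mem_span_singleton'] at hr
    obtain ⟨c, rfl⟩ := hr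
    exact (smulIdeal f x).mul_mem_left c hs
  refine ⟨(u : K) • x, ?_, fun w hw => tmul_one_mem_locIdeal ?_⟩
  · have h1 : z - ((u : K) • x) ⊗ₜ[K] 1 = (z - x ⊗ₜ[K] 1) + ((u' : K) • x) ⊗ₜ[K] 1 := by
      have : (u' : K) = 1 - (u : K) := by
        rw [eq_sub_iff_add_eq]
        exact congrArg (algebraMap (IntRing A K) K) huu
      rw [this, sub_smul, one_smul, TensorProduct.sub_tmul]
      abel
    rw [h1]
    refine add_mem hx (tmul_one_mem_locIdeal (mem_locSpan_of_mem_smulIdeal v (s := j) ?_ hjP))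
    obtain ⟨y, hy, h⟩ := hsx _ (Ideal.mul_mem_mul hu' hj)
    refine ⟨y, hy, h.trans ?_⟩
    rw [smul_smul, mul_comm (j : K)]
    rfl
  · have hne : ¬ v.prime.asIdeal ≤ w.prime.asIdeal := fun hle =>
      hw (FinPlace.prime_injective (HeightOneSpectrum.ext
        (v.prime.isMaximal.eq_of_le w.prime.isPrime.ne_top hle).symm))
    obtain ⟨π, hπ, hπ'⟩ := SetLike.not_le_iff_exists.mp hne
    refine mem_locSpan_of_mem_smulIdeal w (s := π ^ a) ?_
      (fun h => hπ' (w.prime.isPrime.mem_of_pow_mem _ h))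
    obtain ⟨y, hy, h⟩ := hsx _ (Ideal.mul_mem_mul (Ideal.pow_mem_pow hπ a) hu)
    refine ⟨y, hy, h.trans ?_⟩
    rw [smul_smul]
    rfl

end Approximation

/-! ### Entire additive power series -/

section Entire

open Filter Topology

/-- A filtration of a topological ring by open additive subgroups for which the ring is complete. -/
structure LatticeFiltration (R : Type*) [CommRing R] [TopologicalSpace R] where
  /-- The members of the filtration. -/
  lat : ℤ → AddSubgroup R
  anti : Antitone lat
  mul_mem : ∀ {a b x y}, x ∈ lat a → y ∈ lat b → x * y ∈ lat (a + b)
  exists_mem : ∀ x, ∃ k, x ∈ lat k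
  isOpen : ∀ k, IsOpen (lat k : Set R)
  exists_le : ∀ U ∈ 𝓝 (0 : R), ∃ k, (lat k : Set R) ⊆ U
  summable : ∀ f : ℕ → R, (∀ k, ∀ᶠ n in atTop, f n ∈ lat k) → Summable f

namespace LatticeFiltration

variable {R : Type*} [CommRing R] [TopologicalSpace R] (Λ : LatticeFiltration R)

theorem mem_of_le {a b : ℤ} (h : a ≤ b) {x : R} (hx : x ∈ Λ.lat b) : x ∈ Λ.lat a := Λ.anti h hx

theorem pow_mem {a : ℤ} {x : R} (hx : x ∈ Λ.lat a) {n : ℕ} (hn : 0 < n) :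
    x ^ n ∈ Λ.lat (a * n) := by
  induction n, hn using Nat.le_induction with
  | base => simpa using hx
  | succ n _ ih =>
    rw [pow_succ, Nat.cast_succ, mul_add, mul_one]
    exact Λ.mul_mem ih hx

theorem sum_mem_of_hasSum [IsTopologicalAddGroup R] {ι : Type*} {f : ι → R} {s : R} {k : ℤ}
    (hf : ∀ i, f i ∈ Λ.lat k) (hs : HasSum f s) : s ∈ Λ.lat k :=
  ((Λ.lat k).isClosed_of_isOpen (Λ.isOpen k)).mem_of_tendsto hs
    (Eventually.of_forall fun _ => sum_mem fun i _ => hf i)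

variable {Λ}

theorem tendsto_zero {f : ℕ → R} (hf : ∀ k, ∀ᶠ n in atTop, f n ∈ Λ.lat k) :
    Tendsto f atTop (𝓝 0) := fun U hU => by
  obtain ⟨k, hk⟩ := Λ.exists_le U hU
  exact (hf k).mono fun n hn => hk hn

/-- `hε` makes the additive series converge everywhere; the explicit bound `hm'` makes it close to
the identity on a deep lattice. There a Newton-type iteration inverts it, so its image contains that
lattice. -/
theorem exists_expHom [IsTopologicalAddGroup R] [T2Space R] {Fq : Type*} [Field Fq] [Fintype Fq]
    [Algebra Fq R] {ε : ℕ → R} (h0 : ε 0 = 1)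
    (hε : ∀ k : ℤ, ∀ᶠ n in atTop, ε n ∈ Λ.lat (k * (Fintype.card Fq : ℤ) ^ n)) {m : ℤ} (hm : 0 ≤ m)
    (hm' : ∀ n, ε n ∈ Λ.lat (-(2 * m * (Fintype.card Fq : ℤ) ^ n) + m)) :
    ∃ Exp : R →+ R, Continuous Exp ∧
      (∀ x, HasSum (fun i => ε i * x ^ (Fintype.card Fq ^ i)) (Exp x)) ∧
      ∃ k, ∀ y ∈ Λ.lat k, ∃ x, Exp x = y := by
  set q : ℤ := (Fintype.card Fq : ℤ) with hq
  have hq1 : 1 < Fintype.card Fq := Fintype.one_lt_card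
  have hq2 : (2 : ℤ) ≤ q := by rw [hq]; exact_mod_cast hq1
  have hqn : ∀ n : ℕ, (n : ℤ) ≤ q ^ n := fun n => by
    have := (Nat.lt_pow_self hq1 (n := n)).le
    rw [hq]
    exact_mod_cast this
  have hpow : ∀ {a : ℤ} {x : R} (n : ℕ), x ∈ Λ.lat a →
      x ^ (Fintype.card Fq ^ n) ∈ Λ.lat (a * q ^ n) := fun n hx => by
    have := Λ.pow_mem hx (pow_pos (Nat.zero_lt_of_lt hq1) n)
    rwa [Nat.cast_pow] at this
  have hev : ∀ x k, ∀ᶠ n in atTop, ε n * x ^ (Fintype.card Fq ^ n) ∈ Λ.lat k := by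
    intro x k
    obtain ⟨l, hl⟩ := Λ.exists_mem x
    filter_upwards [hε (-l + 1), eventually_ge_atTop k.toNat] with n h1 h2
    refine Λ.mem_of_le ?_ (Λ.mul_mem h1 (hpow n hl))
    have h3 := hqn n
    have h4 : k ≤ n := by omega
    have h5 : (-l + 1) * q ^ n + l * q ^ n = q ^ n := by ring
    omega
  have hsum : ∀ x, HasSum (fun i => ε i * x ^ (Fintype.card Fq ^ i))
      (∑' i, ε i * x ^ (Fintype.card Fq ^ i)) := fun x => (Λ.summable _ (hev x)).hasSum
  let Exp : R →+ R :=
    { toFun x := ∑' i, ε i * x ^ (Fintype.card Fq ^ i)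
      map_zero' := by
        simp only [zero_pow_card_pow, mul_zero]
        exact tsum_zero
      map_add' x y := by
        have := (hsum x).add (hsum y)
        simp only [← mul_add, ← add_pow_card_pow Fq] at this
        exact this.tsum_eq }
  have hE : ∀ x, HasSum (fun i => ε i * x ^ (Fintype.card Fq ^ i)) (Exp x) := hsum
  -- For $n\ge1$ the term lies in level $(k-2m)q^n+m\ge 2(k-2m)+m=2k-3m$, and this is at least $k+1$
  -- exactly when $k\ge 3m+1$.
  have hsub : ∀ k x, 3 * m + 1 ≤ k → x ∈ Λ.lat k → x - Exp x ∈ Λ.lat (k + 1) := by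
    intro k x hk hx
    have h1 := (hasSum_nat_add_iff' 1).mpr (hE x)
    rw [Finset.sum_range_one, h0, pow_zero, pow_one, one_mul] at h1
    rw [← neg_sub]
    refine neg_mem (Λ.sum_mem_of_hasSum (fun n => ?_) h1)
    refine Λ.mem_of_le ?_ (Λ.mul_mem (hm' (n + 1)) (hpow (n + 1) hx))
    have h2 : (2 : ℤ) ≤ q ^ (n + 1) := by
      have := one_le_pow₀ (show (1 : ℤ) ≤ q by omega) (n := n)
      rw [pow_succ]
      nlinarith
    nlinarith
  have hmem : ∀ k x, 3 * m + 1 ≤ k → x ∈ Λ.lat k → Exp x ∈ Λ.lat k := by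
    intro k x hk hx
    have := sub_mem hx (Λ.mem_of_le (by omega) (hsub k x hk hx))
    rwa [sub_sub_cancel] at this
  have hcont : Continuous Exp := by
    apply continuous_of_continuousAt_zero
    intro U hU
    rw [map_zero] at hU
    obtain ⟨k, hk⟩ := Λ.exists_le U hU
    have h1 : (Λ.lat (max k (3 * m + 1)) : Set R) ∈ 𝓝 (0 : R) :=
      (Λ.isOpen _).mem_nhds (zero_mem _)
    rw [Filter.mem_map]
    filter_upwards [h1] with x hx
    exact hk (Λ.mem_of_le (le_max_left _ _) (hmem _ x (le_max_right _ _) hx))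
  refine ⟨Exp, hcont, hE, 3 * m + 1, fun y hy => ?_⟩
  -- Each iterate lies one level deeper, so $\sum_j u_j$ converges; since
  -- $\mathrm{Exp}(u_j)=u_j-u_{j+1}$, its image telescopes to `y`.
  let u : ℕ → R := fun j => (fun x => x - Exp x)^[j] y
  have hu : ∀ j, u (j + 1) = u j - Exp (u j) := fun j => Function.iterate_succ_apply' _ _ _
  have hmu : ∀ j : ℕ, u j ∈ Λ.lat (3 * m + 1 + j) := by
    intro j
    induction j with
    | zero => simpa [u] using hy
    | succ j ih =>
      rw [hu, Nat.cast_succ, ← add_assoc]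
      exact hsub _ _ (by omega) ih
  have hevu : ∀ k, ∀ᶠ n in atTop, u n ∈ Λ.lat k := fun k => by
    filter_upwards [eventually_ge_atTop (k - (3 * m + 1)).toNat] with n hn
    exact Λ.mem_of_le (by omega) (hmu n)
  obtain ⟨x, hx⟩ := Λ.summable u hevu
  refine ⟨x, ?_⟩
  have h1 := (hx.map Exp hcont).tendsto_sum_nat
  have h2 : ∀ n, ∑ i ∈ Finset.range n, (Exp ∘ u) i = y - u n := by
    intro n
    have h3 : ∀ i, (Exp ∘ u) i = u i - u (i + 1) := fun i => by
      rw [hu, sub_sub_cancel, Function.comp_apply]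
    simp only [h3]
    exact Finset.sum_range_sub' u n
  simp only [h2] at h1
  have h4 := (tendsto_zero hevu).const_sub y
  rw [sub_zero] at h4
  exact tendsto_nhds_unique h1 h4

end LatticeFiltration

end Entire

/-! ### The topology of `L_∞` -/

section InfTopology

open Filter Topology

variable {Q : Type*} [Field Q] (inf : ValuationSubring Q) {L : Type*} [Field L] [Algebra Q L]
  {ι : Type*} (b : Module.Basis ι Q L)

theorem coordMap_mul_one_tmul {B : Type*} [CommRing B] [Algebra Q B] (i : ι) (z : L ⊗[Q] B)
    (c : B) : coordMap b i B ((1 ⊗ₜ c) * z) = c * coordMap b i B z := by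
  induction z using TensorProduct.induction_on with
  | zero => simp
  | tmul x d =>
    rw [Algebra.TensorProduct.tmul_mul_tmul, coordMap_tmul, coordMap_tmul, one_mul]
    ring
  | add x y hx hy => rw [mul_add, map_add, hx, hy, map_add, mul_add]

theorem sum_tmul_coordMap [Fintype ι] {B : Type*} [CommRing B] [Algebra Q B] (z : L ⊗[Q] B) :
    ∑ i, b i ⊗ₜ coordMap b i B z = z := by
  induction z using TensorProduct.induction_on with
  | zero => simp
  | tmul x d =>
    simp only [coordMap_tmul]
    exact (tmul_eq_sum_basis b x d).symm
  | add x y hx hy =>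
    simp only [map_add, TensorProduct.tmul_add, Finset.sum_add_distrib]
    rw [hx, hy]

section
variable (L)

theorem isTopologicalAddGroup_infTopology :
    @IsTopologicalAddGroup (InfAlg inf L) (infTopology inf L) _ := by
  letI : Algebra (Cmpl inf) (L ⊗[Q] Cmpl inf) := Algebra.TensorProduct.rightAlgebra
  letI := infTopology inf L
  haveI : IsModuleTopology (Cmpl inf) (L ⊗[Q] Cmpl inf) := ⟨rfl⟩
  exact IsModuleTopology.topologicalAddGroup (Cmpl inf) _

end

theorem continuous_coordMap (i : ι) :
    @Continuous _ _ (infTopology inf L) _ (coordMap b i (Cmpl inf)) := by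
  letI : Algebra (Cmpl inf) (L ⊗[Q] Cmpl inf) := Algebra.TensorProduct.rightAlgebra
  letI := infTopology inf L
  haveI : IsModuleTopology (Cmpl inf) (L ⊗[Q] Cmpl inf) := ⟨rfl⟩
  let g : L ⊗[Q] Cmpl inf →ₗ[Cmpl inf] Cmpl inf :=
    { toFun := coordMap b i (Cmpl inf)
      map_add' := map_add _
      map_smul' c z := by
        rw [Algebra.smul_def]
        exact coordMap_mul_one_tmul b i z c }
  exact IsModuleTopology.continuous_of_linearMap g

theorem continuous_tmul (x : L) :
    @Continuous _ _ _ (infTopology inf L) (fun c : Cmpl inf => x ⊗ₜ[Q] c) := by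
  letI : Algebra (Cmpl inf) (L ⊗[Q] Cmpl inf) := Algebra.TensorProduct.rightAlgebra
  letI := infTopology inf L
  haveI : IsModuleTopology (Cmpl inf) (L ⊗[Q] Cmpl inf) := ⟨rfl⟩
  haveI : ContinuousAdd (L ⊗[Q] Cmpl inf) := IsModuleTopology.toContinuousAdd (Cmpl inf) _
  haveI : ContinuousSMul (Cmpl inf) (L ⊗[Q] Cmpl inf) := IsModuleTopology.toContinuousSMul _ _
  let g : Cmpl inf →ₗ[Cmpl inf] L ⊗[Q] Cmpl inf :=
    { toFun c := x ⊗ₜ[Q] c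
      map_add' := TensorProduct.tmul_add x
      map_smul' c d := by
        rw [Algebra.smul_def]
        change x ⊗ₜ (c * d) = (1 ⊗ₜ c) * (x ⊗ₜ d)
        rw [Algebra.TensorProduct.tmul_mul_tmul, one_mul] }
  exact IsModuleTopology.continuous_of_linearMap g

theorem t2Space_infTopology [Finite ι] (b : Module.Basis ι Q L) :
    @T2Space (InfAlg inf L) (infTopology inf L) := by
  letI := infTopology inf L
  have := Fintype.ofFinite ι
  refine T2Space.of_injective_continuous (f := fun z i => coordMap b i (Cmpl inf) z) ?_
    (continuous_pi fun i => continuous_coordMap inf b i)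
  intro z w h
  rw [← sum_tmul_coordMap b z, ← sum_tmul_coordMap b w]
  exact Finset.sum_congr rfl fun i _ => by
    rw [show coordMap b i (Cmpl inf) z = coordMap b i (Cmpl inf) w from congrFun h i]

theorem continuous_sum_tmul [Fintype ι] :
    @Continuous _ _ _ (infTopology inf L) (fun c : ι → Cmpl inf => ∑ i, b i ⊗ₜ[Q] c i) := by
  letI := infTopology inf L
  haveI := isTopologicalAddGroup_infTopology inf L
  exact continuous_finsetSum _ fun i _ => (continuous_tmul inf (b i)).comp (continuous_apply i)

/-- An element `ϖ` of the maximal ideal of a place, such that every element of the field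
becomes integral after multiplication with a power of `ϖ`. -/
structure IsPseudoUniformizer (ϖ : Q) : Prop where
  ne_zero : ϖ ≠ 0
  lt_one : inf.valuation ϖ < 1
  exists_pow : ∀ x, ∃ N : ℕ, ∀ n, N ≤ n → ϖ ^ n * x ∈ inf

variable {inf} {ϖ : Q} (hϖ : IsPseudoUniformizer inf ϖ)

include hϖ

theorem IsPseudoUniformizer.mem : ϖ ∈ inf := (inf.valuation_le_one_iff _).mp hϖ.lt_one.le

theorem IsPseudoUniformizer.algebraMap_ne_zero : algebraMap Q (Cmpl inf) ϖ ≠ 0 := by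
  simpa using hϖ.ne_zero

theorem IsPseudoUniformizer.pow_mem {n : ℤ} (hn : 0 ≤ n) :
    algebraMap Q (Cmpl inf) ϖ ^ n ∈ cmplInt inf := by
  lift n to ℕ using hn
  rw [zpow_natCast]
  exact _root_.pow_mem ((algebraMap_mem_cmplInt inf).mpr hϖ.mem) n

theorem IsPseudoUniformizer.exists_pow_mul_mem (c : Cmpl inf) :
    ∃ N : ℕ, ∀ n, N ≤ n → algebraMap Q (Cmpl inf) ϖ ^ n * c ∈ cmplInt inf := by
  obtain ⟨x, hx⟩ := exists_sub_mem_of_isOpen inf (cmplInt inf).toAddSubgroup (isOpen_cmplInt inf) c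
  obtain ⟨N, hN⟩ := hϖ.exists_pow x
  refine ⟨N, fun n hn => ?_⟩
  have h1 : algebraMap Q (Cmpl inf) ϖ ^ n * algebraMap Q (Cmpl inf) x ∈ cmplInt inf := by
    rw [← map_pow, ← map_mul]
    exact (algebraMap_mem_cmplInt inf).mpr (hN n hn)
  have h2 := mul_mem (_root_.pow_mem ((algebraMap_mem_cmplInt inf).mpr hϖ.mem) n)
    (show c - algebraMap Q (Cmpl inf) x ∈ cmplInt inf from hx)
  have := add_mem h1 h2
  rwa [← mul_add, add_sub_cancel] at this

/-- The multiples of powers of `ϖ` form a neighbourhood basis of zero. A power making $s/r$ integral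
gives values at most that of $r/s$; one further factor `ϖ` makes the inequality strict. -/
theorem IsPseudoUniformizer.exists_forall_mem {U : Set (Cmpl inf)} (hU : U ∈ 𝓝 (0 : Cmpl inf)) :
    ∃ N : ℕ, ∀ c, (algebraMap Q (Cmpl inf) ϖ ^ N)⁻¹ * c ∈ cmplInt inf → c ∈ U := by
  obtain ⟨γ, hγ⟩ := Valued.mem_nhds_zero.mp hU
  obtain ⟨r, s, hr, hs, h⟩ := Valuation.exists_div_eq_of_unit _ γ
  have hr0 : r ≠ 0 := (Valuation.pos_iff _).mp hr
  have hs0 : s ≠ 0 := (Valuation.pos_iff _).mp hs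
  obtain ⟨N, hN⟩ := hϖ.exists_pow_mul_mem (s / r)
  refine ⟨N + 1, fun c hc => hγ ?_⟩
  rw [Set.mem_ofPred_eq, ← h, ← map_div₀, Valuation.restrict_lt_iff]
  set y := algebraMap Q (Cmpl inf) ϖ with hy
  have hy0 : y ≠ 0 := hϖ.algebraMap_ne_zero
  have h1 : c = (r / s) * ((y ^ N * (s / r)) * ((y ^ (N + 1))⁻¹ * c)) * y := by
    field_simp
    ring
  have h2 : Valued.v ((y ^ N * (s / r)) * ((y ^ (N + 1))⁻¹ * c)) ≤ (1 : inf.ValueGroup) :=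
    mul_mem (hN N le_rfl) hc
  have h3 : Valued.v y < (1 : inf.ValueGroup) := by
    rw [hy, valued_algebraMap]
    exact hϖ.lt_one
  have h4 : (0 : inf.ValueGroup) < Valued.v (r / s) := by
    rw [Valuation.pos_iff]
    exact div_ne_zero hr0 hs0
  calc (Valued.v c : inf.ValueGroup) = Valued.v (r / s) *
        Valued.v ((y ^ N * (s / r)) * ((y ^ (N + 1))⁻¹ * c)) * Valued.v y := by
        conv_lhs => rw [h1]
        rw [map_mul, map_mul]
    _ ≤ Valued.v (r / s) * 1 * Valued.v y := by gcongr
    _ < Valued.v (r / s) := by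
        rw [mul_one]
        exact mul_lt_of_lt_one_right h4 h3

theorem IsPseudoUniformizer.nonarchimedean : NonarchimedeanAddGroup (Cmpl inf) where
  is_nonarchimedean U hU := by
    obtain ⟨N, hN⟩ := hϖ.exists_forall_mem hU
    refine ⟨⟨(cmplInt inf).toAddSubgroup.comap
      (AddMonoidHom.mulLeft (algebraMap Q (Cmpl inf) ϖ ^ N)⁻¹), ?_⟩, fun c hc => hN c hc⟩
    exact (isOpen_cmplInt inf).preimage (continuous_const_mul _)

/-- The lattices `⨁ ϖ^k 𝒪_∞ b_i` in `L_∞`. -/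
def latticeFiltration [Finite ι] (hb : ∀ i j l, b.repr (b i * b j) l ∈ inf) :
    @LatticeFiltration (InfAlg inf L) _ (infTopology inf L) :=
  letI := infTopology inf L
  haveI := Fintype.ofFinite ι
  have h0 : algebraMap Q (Cmpl inf) ϖ ≠ 0 := hϖ.algebraMap_ne_zero
  { lat k := ⨅ i, (cmplInt inf).toAddSubgroup.comap
      ((AddMonoidHom.mulLeft (algebraMap Q (Cmpl inf) ϖ ^ (-k))).comp
        (coordMap b i (Cmpl inf)).toAddMonoidHom)
    anti k l hkl z hz := by
      simp only [AddSubgroup.mem_iInf] at hz ⊢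
      intro i
      have h2 : algebraMap Q (Cmpl inf) ϖ ^ (l - k) * (algebraMap Q (Cmpl inf) ϖ ^ (-l) *
        coordMap b i (Cmpl inf) z) ∈ cmplInt inf := mul_mem (hϖ.pow_mem (by omega)) (hz i)
      rw [← mul_assoc, ← zpow_add₀ h0] at h2
      change algebraMap Q (Cmpl inf) ϖ ^ (-k) * coordMap b i (Cmpl inf) z ∈ cmplInt inf
      convert h2 using 3
      ring
    -- The integral structure constants `hb` ensure that multiplication adds the levels with no
    -- loss.
    mul_mem {k l z w} hz hw := by
      simp only [AddSubgroup.mem_iInf] at hz hw ⊢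
      intro i
      change algebraMap Q (Cmpl inf) ϖ ^ (-(k + l)) * coordMap b i (Cmpl inf) (z * w) ∈ cmplInt inf
      rw [← sum_tmul_coordMap b z, ← sum_tmul_coordMap b w, Finset.sum_mul_sum, map_sum,
        Finset.mul_sum]
      refine sum_mem fun j _ => ?_
      rw [map_sum, Finset.mul_sum]
      refine sum_mem fun j' _ => ?_
      rw [Algebra.TensorProduct.tmul_mul_tmul, coordMap_tmul]
      have h := mul_mem ((algebraMap_mem_cmplInt inf).mpr (hb j j' i)) (mul_mem
        (show algebraMap Q (Cmpl inf) ϖ ^ (-k) * coordMap b j (Cmpl inf) z ∈ cmplInt inf from hz j)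
        (show algebraMap Q (Cmpl inf) ϖ ^ (-l) * coordMap b j' (Cmpl inf) w ∈ cmplInt inf
          from hw j'))
      convert h using 1
      rw [neg_add, zpow_add₀ h0]
      ring
    exists_mem z := by
      choose N hN using fun i => hϖ.exists_pow_mul_mem (coordMap b i (Cmpl inf) z)
      refine ⟨-(Finset.univ.sup N : ℕ), ?_⟩
      simp only [AddSubgroup.mem_iInf]
      intro i
      have := hN i _ (Finset.le_sup (Finset.mem_univ i))
      change algebraMap Q (Cmpl inf) ϖ ^ (- -((Finset.univ.sup N : ℕ) : ℤ)) *
        coordMap b i (Cmpl inf) z ∈ cmplInt inf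
      rwa [neg_neg, zpow_natCast]
    isOpen k := by
      rw [AddSubgroup.coe_iInf]
      exact isOpen_iInter_of_finite fun i => (isOpen_cmplInt inf).preimage
        ((continuous_const_mul _).comp (continuous_coordMap inf b i))
    exists_le U hU := by
      have h1 : (fun c : ι → Cmpl inf => ∑ i, b i ⊗ₜ[Q] c i) ⁻¹' U ∈ 𝓝 0 := by
        refine (continuous_sum_tmul inf b).continuousAt ?_
        simpa using hU
      rw [nhds_pi, Filter.mem_pi] at h1
      obtain ⟨I, -, t, ht, h2⟩ := h1
      choose N hN using fun i => hϖ.exists_forall_mem (ht i)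
      refine ⟨(Finset.univ.sup N : ℕ), fun z hz => ?_⟩
      rw [← sum_tmul_coordMap b z]
      refine h2 (a := fun i => coordMap b i (Cmpl inf) z) fun i _ => hN i _ ?_
      simp only [SetLike.mem_coe, AddSubgroup.mem_iInf] at hz
      have h3 : algebraMap Q (Cmpl inf) ϖ ^ (-((Finset.univ.sup N : ℕ) : ℤ)) *
        coordMap b i (Cmpl inf) z ∈ cmplInt inf := hz i
      have h4 := mul_mem (hϖ.pow_mem (n := ((Finset.univ.sup N : ℕ) : ℤ) - N i)
        (sub_nonneg.mpr (by exact_mod_cast Finset.le_sup (Finset.mem_univ i)))) h3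
      rw [← mul_assoc, ← zpow_add₀ h0] at h4
      rw [← zpow_natCast, ← zpow_neg]
      convert h4 using 3
      ring
    -- In each coordinate the terms tend to zero in a complete nonarchimedean group, hence are
    -- summable there.
    summable f hf := by
      haveI := isTopologicalAddGroup_infTopology inf L
      haveI := hϖ.nonarchimedean
      have h1 : ∀ i, Summable fun n => coordMap b i (Cmpl inf) (f n) := fun i => by
        apply NonarchimedeanAddGroup.summable_of_tendsto_cofinite_zero
        rw [Nat.cofinite_eq_atTop]
        intro U hU
        obtain ⟨N, hN⟩ := hϖ.exists_forall_mem hU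
        rw [Filter.mem_map]
        filter_upwards [hf N] with n hn
        simp only [AddSubgroup.mem_iInf] at hn
        refine hN _ ?_
        have h2 : algebraMap Q (Cmpl inf) ϖ ^ (-(N : ℤ)) *
          coordMap b i (Cmpl inf) (f n) ∈ cmplInt inf := hn i
        rwa [zpow_neg, zpow_natCast] at h2
      have h2 : ∀ i, Summable fun n => b i ⊗ₜ[Q] coordMap b i (Cmpl inf) (f n) := fun i =>
        (h1 i).map (TensorProduct.mk Q L (Cmpl inf) (b i)) (continuous_tmul inf (b i))
      have h3 := summable_sum (s := Finset.univ) fun i _ => h2 i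
      simpa only [sum_tmul_coordMap] using h3 }

theorem mem_latticeFiltration [Finite ι] (hb : ∀ i j l, b.repr (b i * b j) l ∈ inf) {k : ℤ}
    {z : InfAlg inf L} : z ∈ @LatticeFiltration.lat _ _ (infTopology inf L)
      (latticeFiltration b hϖ hb) k ↔
      ∀ i, algebraMap Q (Cmpl inf) ϖ ^ (-k) * coordMap b i (Cmpl inf) z ∈ cmplInt inf :=
  AddSubgroup.mem_iInf

end InfTopology

/-! ### The exponential map on `L_∞` -/

section ExpConvergence

open Filter Topology

namespace LatticeFiltration

variable {R : Type*} [CommRing R] [TopologicalSpace R] (Λ : LatticeFiltration R)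
  {q : ℕ} (hq : 1 < q) {ε φ : ℕ → R} {m : ℤ} (hm : 0 ≤ m) (h1 : (1 : R) ∈ Λ.lat (-m))
  (h0 : ε 0 = 1) (hφ : ∀ i, φ i ∈ Λ.lat (-m))
  (hrec : ∀ n k, 0 < n → (∀ p ∈ (Finset.HasAntidiagonal.antidiagonal n).erase (0, n),
      φ p.1 * ε p.2 ^ (q ^ p.1) ∈ Λ.lat k) → ε n ∈ Λ.lat (k + (q : ℤ) ^ n))

include hq hm hrec hφ

/-- The summand `m` in the exponent makes the bound reproduce itself: raising to the power $q^{p_1}$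
with $p_1\ge1$ at least doubles it, and the coefficient `φ p.1` costs only one `m`. -/
theorem term_mem {n : ℕ} {j : ℤ} {p : ℕ × ℕ}
    (hp : p ∈ (Finset.HasAntidiagonal.antidiagonal n).erase (0, n))
    (h : ε p.2 ∈ Λ.lat ((j - 2 * m) * (q : ℤ) ^ p.2 + m)) :
    φ p.1 * ε p.2 ^ (q ^ p.1) ∈ Λ.lat ((j - 2 * m) * (q : ℤ) ^ n + m) := by
  have hlt := lt_of_mem_erase_antidiagonal hp
  have hpn : p.1 + p.2 = n := Finset.HasAntidiagonal.mem_antidiagonal.mp (Finset.mem_of_mem_erase hp)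
  have hpow := Λ.pow_mem h (pow_pos (Nat.zero_lt_of_lt hq) p.1)
  refine Λ.mem_of_le ?_ (Λ.mul_mem (hφ p.1) hpow)
  have h2 : (2 : ℤ) ≤ q ^ p.1 := by
    have h3 : (1 : ℤ) ≤ q := by exact_mod_cast hq.le
    have h4 : (2 : ℤ) ≤ q := by exact_mod_cast hq
    calc (2 : ℤ) ≤ q := h4
      _ = q ^ 1 := (pow_one _).symm
      _ ≤ q ^ p.1 := pow_le_pow_right₀ h3 (by omega)
  rw [← hpn, pow_add, Nat.cast_pow]
  nlinarith

include h0 h1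

/-- The bound of `term_mem` with `j = 0`, propagated through the recursion; the gain of $q^n$ is not
needed here. -/
theorem coeff_mem (n : ℕ) : ε n ∈ Λ.lat (-(2 * m * (q : ℤ) ^ n) + m) := by
  induction n using Nat.strong_induction_on with
  | _ n ih =>
    rcases Nat.eq_zero_or_pos n with rfl | hn
    · rw [h0, pow_zero]
      exact Λ.mem_of_le (by omega) h1
    · refine Λ.mem_of_le ?_ (hrec n ((0 - 2 * m) * (q : ℤ) ^ n + m) hn fun p hp =>
        Λ.term_mem hq hm hφ hrec hp (Λ.mem_of_le (le_of_eq (by ring))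
          (ih p.2 (lt_of_mem_erase_antidiagonal hp))))
      have : (0 : ℤ) ≤ (q : ℤ) ^ n := by positivity
      linarith

/-- Each pass through the recursion gains a further $q^n$, that is, replaces `j` by `j + 1`. Since
`φ` vanishes from `D` on, only coefficients with index close to `n` contribute, so a bound valid
eventually can be fed back into the recursion. -/
theorem coeff_eventually_mem {D : ℕ} (hD : ∀ i, D ≤ i → φ i = 0) (k : ℤ) :
    ∀ᶠ n in atTop, ε n ∈ Λ.lat (k * (q : ℤ) ^ n) := by
  have key : ∀ j : ℕ, ∀ᶠ n in atTop, ε n ∈ Λ.lat ((j - 2 * m) * (q : ℤ) ^ n + m) := by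
    intro j
    induction j with
    | zero =>
      exact Eventually.of_forall fun n => Λ.mem_of_le (le_of_eq (by push_cast; ring))
        (Λ.coeff_mem hq hm h1 h0 hφ hrec n)
    | succ j ih =>
      obtain ⟨N, hN⟩ := eventually_atTop.mp ih
      filter_upwards [eventually_ge_atTop (N + D + 1)] with n hn
      refine Λ.mem_of_le (le_of_eq ?_) (hrec n ((j - 2 * m) * (q : ℤ) ^ n + m) (by omega)
        fun p hp => ?_)
      · push_cast
        ring
      · have hpn : p.1 + p.2 = n :=
          Finset.HasAntidiagonal.mem_antidiagonal.mp (Finset.mem_of_mem_erase hp)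
        by_cases hpD : D ≤ p.1
        · rw [hD _ hpD, zero_mul]
          exact zero_mem _
        · exact Λ.term_mem hq hm hφ hrec hp (hN _ (by omega))
  filter_upwards [key (k + 2 * m).toNat] with n hn
  refine Λ.mem_of_le ?_ hn
  have h2 : k + 2 * m ≤ (k + 2 * m).toNat := Int.self_le_toNat _
  have h3 : (0 : ℤ) ≤ (q : ℤ) ^ n := by positivity
  nlinarith

end LatticeFiltration

variable {Q : Type*} [Field Q] {inf : ValuationSubring Q} {L : Type*} [Field L] [Algebra Q L]
  {ϖ : Q} (hϖ : IsPseudoUniformizer inf ϖ)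

include hϖ

/-- Scaling a basis by $\varpi^M$ multiplies its structure constants by $\varpi^M$, which makes them
integral for large $M$. -/
theorem IsPseudoUniformizer.exists_basis [FiniteDimensional Q L] :
    ∃ (n : ℕ) (b : Module.Basis (Fin n) Q L), ∀ i j l, b.repr (b i * b j) l ∈ inf := by
  let b := Module.finBasis Q L
  choose N hN using fun i j l => hϖ.exists_pow (b.repr (b i * b j) l)
  let M := Finset.univ.sup fun i => Finset.univ.sup fun j => Finset.univ.sup fun l => N i j l
  have hM : ∀ i j l, N i j l ≤ M := fun i j l =>
    (Finset.le_sup (f := fun l => N i j l) (Finset.mem_univ l)).trans <|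
      (Finset.le_sup (f := fun j => Finset.univ.sup fun l => N i j l) (Finset.mem_univ j)).trans <|
        Finset.le_sup (f := fun i => Finset.univ.sup fun j => Finset.univ.sup fun l => N i j l)
          (Finset.mem_univ i)
  have h0 : ϖ ^ M ≠ 0 := pow_ne_zero _ hϖ.ne_zero
  have hu : ∀ i : Fin (Module.finrank Q L), IsUnit ((fun _ => ϖ ^ M) i) := fun _ => h0.isUnit
  refine ⟨_, b.isUnitSMul hu, fun i j l => ?_⟩
  have h := hN i j l M (hM i j l)
  have h1 : (b.isUnitSMul hu).repr (b i * b j) l = (ϖ ^ M)⁻¹ * b.repr (b i * b j) l := by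
    rw [Module.Basis.repr_isUnitSMul, Units.smul_def, smul_eq_mul]
    congr 1
    rw [Units.val_inv_eq_inv_val]
    rfl
  rw [Module.Basis.isUnitSMul_apply, Module.Basis.isUnitSMul_apply, smul_mul_smul_comm, map_smul,
    Finsupp.smul_apply, h1, smul_eq_mul]
  convert h using 1
  field_simp

theorem IsPseudoUniformizer.smul_mem {ι : Type*} [Finite ι] (b : Module.Basis ι Q L)
    (hb : ∀ i j l, b.repr (b i * b j) l ∈ inf) {k : ℤ} {z : InfAlg inf L}
    (hz : z ∈ @LatticeFiltration.lat _ _ (infTopology inf L) (latticeFiltration b hϖ hb) k)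
    {c : Q} (hc : c ∈ inf) (n : ℕ) :
    (ϖ ^ n * c) • z ∈
      @LatticeFiltration.lat _ _ (infTopology inf L) (latticeFiltration b hϖ hb) (k + n) := by
  rw [mem_latticeFiltration] at hz ⊢
  intro i
  have h := mul_mem ((algebraMap_mem_cmplInt inf).mpr hc) (hz i)
  rw [LinearMap.map_smul, Algebra.smul_def, map_mul, map_pow]
  convert h using 1
  rw [neg_add, zpow_add₀ hϖ.algebraMap_ne_zero, zpow_neg _ (n : ℤ), zpow_natCast]
  have := pow_ne_zero n hϖ.algebraMap_ne_zero
  field_simp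

end ExpConvergence

/-! ### Convergence of the exponential series and openness of its image. -/

section ExpMap

open Filter Topology

variable {Fq A Q K : Type*} [Field Fq] [Fintype Fq] [CommRing A] [Algebra Fq A] [Field Q]
  [Algebra Fq Q] [Algebra A Q] [IsScalarTower Fq A Q] 
  [Field K] [Algebra Fq K] [Algebra A K] [IsScalarTower Fq A K] [Algebra Q K]
  [IsScalarTower A Q K]
  (E : DrinfeldModule Fq A K) (inf : ValuationSubring Q) [IsIntegrallyClosedIn Fq A]
  [FaithfulSMul A K]
  (L : Type*) [Field L] [Algebra K L] [Algebra Q L] [IsScalarTower Q K L]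

/-- The functional equation at `t` gives $(t^{q^n}-t)e_n$ in terms of earlier coefficients. As `t`
has a pole at infinity, $t^{q^n}-t$ is $t^{q^n}$ times a unit of the valuation ring, so $e_n$ gains
$q^n$ factors $t^{-1}$. -/
theorem expCoeff_rec {t : A} (ht : algebraMap A Q t ∉ inf) {n : ℕ} (hn : 0 < n) :
    ∃ c ∈ inf, E.expCoeff n = ((algebraMap A Q t)⁻¹ ^ (Fintype.card Fq ^ n) * c) •
      ∑ p ∈ (Finset.HasAntidiagonal.antidiagonal n).erase (0, n),
        E.coeff t p.1 * E.expCoeff p.2 ^ (Fintype.card Fq ^ p.1) := by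
  set x := algebraMap A Q t with hx
  have hx0 : x ≠ 0 := fun h => ht (by rw [h]; exact zero_mem _)
  -- With $q^n=r+2$ the unit is $1-t^{-(r+1)}$, and the exponent $r+1$ is positive.
  obtain ⟨r, hr⟩ : ∃ r, Fintype.card Fq ^ n = r + 2 := by
    have : 1 < Fintype.card Fq ^ n := Nat.one_lt_pow hn.ne' Fintype.one_lt_card
    exact ⟨Fintype.card Fq ^ n - 2, by omega⟩
  have hlt : inf.valuation x⁻¹ < 1 := by
    rw [valuation_lt_one_iff, inv_inv]
    exact Or.inr ht
  have hlt' : inf.valuation (x⁻¹ ^ (r + 1)) < 1 := by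
    rw [map_pow]
    exact pow_lt_one₀ zero_le hlt (by omega)
  have hval : inf.valuation (1 - x⁻¹ ^ (r + 1)) = 1 := by
    rw [Valuation.map_sub_eq_of_lt_left _ (by rwa [map_one]), map_one]
  have hne : 1 - x⁻¹ ^ (r + 1) ≠ 0 := by
    rw [← (inf.valuation).ne_zero_iff, hval]
    exact one_ne_zero
  refine ⟨(1 - x⁻¹ ^ (r + 1))⁻¹, ?_, ?_⟩
  · rw [← inf.valuation_le_one_iff, map_inv₀, hval, inv_one]
  · have h := E.isExp_expCoeff.2 t n
    rw [twistMul_eq, E.coeff_zero', IsScalarTower.algebraMap_apply A Q K, ← hx] at h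
    have h2 : ∑ p ∈ (Finset.HasAntidiagonal.antidiagonal n).erase (0, n),
        E.coeff t p.1 * E.expCoeff p.2 ^ (Fintype.card Fq ^ p.1) =
        (x ^ (Fintype.card Fq ^ n) - x) • E.expCoeff n := by
      rw [Algebra.smul_def, map_sub, map_pow, sub_mul, mul_comm _ (E.expCoeff n), ← h]
      ring
    rw [h2, smul_smul]
    have h3 : x⁻¹ ^ (Fintype.card Fq ^ n) * (1 - x⁻¹ ^ (r + 1))⁻¹ *
        (x ^ (Fintype.card Fq ^ n) - x) = 1 := by
      rw [hr, mul_assoc, mul_comm _ (x ^ (r + 2) - x), ← mul_assoc, mul_inv_eq_one₀ hne, mul_sub,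
        ← mul_pow, inv_mul_cancel₀ hx0, one_pow, pow_succ _ (r + 1), mul_assoc, inv_mul_cancel₀ hx0,
        mul_one]
    rw [h3, one_smul]

/-- The exponential series of a Drinfeld module converges on `L_∞`, and its image is open. -/
theorem exists_expHom [FiniteDimensional Q L] {t : A}
    (hϖ : IsPseudoUniformizer inf (algebraMap A Q t)⁻¹) :
    letI := infTopology inf L
    ∃ Exp : InfAlg inf L →+ InfAlg inf L,
      (∀ x, HasSum (fun i => algebraMap K (InfAlg inf L) (E.expCoeff i) *
        x ^ (Fintype.card Fq ^ i)) (Exp x)) ∧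
      ∃ U : AddSubgroup (InfAlg inf L), IsOpen (U : Set (InfAlg inf L)) ∧
        ∀ y ∈ U, ∃ x, Exp x = y := by
  letI := infTopology inf L
  obtain ⟨d, b, hb⟩ := hϖ.exists_basis (L := L)
  letI := isTopologicalAddGroup_infTopology inf L
  letI := t2Space_infTopology inf b
  have ht : algebraMap A Q t ∉ inf := by
    have h := hϖ.lt_one
    rw [valuation_lt_one_iff, inv_inv] at h
    exact h.resolve_left hϖ.ne_zero
  let Λ := latticeFiltration b hϖ hb
  letI : Algebra Fq (InfAlg inf L) :=
    ((algebraMap K (InfAlg inf L)).comp (algebraMap Fq K)).toAlgebra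
  obtain ⟨D, hD⟩ : ∃ D, ∀ i, D ≤ i → E.coeff t i = 0 := by
    obtain ⟨D, hD⟩ := (E.φ t).support.bddAbove
    refine ⟨D + 1, fun i hi => ?_⟩
    have : (E.φ t).coeff i = 0 := by
      by_contra h
      have := hD (SkewPolynomial.mem_support_iff.mpr h)
      omega
    rw [DrinfeldModule.coeff, this, map_zero, map_zero]
  -- Only finitely many coefficients of `E.φ t` are nonzero, so one lattice contains them all
  -- together with `1`.
  obtain ⟨m, hm, h1, hφ⟩ : ∃ m : ℤ, 0 ≤ m ∧ (1 : InfAlg inf L) ∈ Λ.lat (-m) ∧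
      ∀ i, algebraMap K (InfAlg inf L) (E.coeff t i) ∈ Λ.lat (-m) := by
    choose k hk using Λ.exists_mem
    let f : ℕ → ℕ := fun i => (- k (algebraMap K (InfAlg inf L) (E.coeff t i))).toNat
    refine ⟨((- k 1).toNat + (Finset.range D).sup f : ℕ), by positivity,
      Λ.mem_of_le (by omega) (hk 1), fun i => ?_⟩
    by_cases hi : D ≤ i
    · rw [hD i hi, map_zero]
      exact zero_mem _
    · refine Λ.mem_of_le ?_ (hk _)
      have := Finset.le_sup (f := f) (Finset.mem_range.mpr (not_le.mp hi))
      simp only [f] at this ⊢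
      omega
  have h0 : algebraMap K (InfAlg inf L) (E.expCoeff 0) = 1 := by
    rw [E.isExp_expCoeff.1, map_one]
  have hrec : ∀ n k, 0 < n → (∀ p ∈ (Finset.HasAntidiagonal.antidiagonal n).erase (0, n),
      algebraMap K (InfAlg inf L) (E.coeff t p.1) *
        algebraMap K (InfAlg inf L) (E.expCoeff p.2) ^ (Fintype.card Fq ^ p.1) ∈ Λ.lat k) →
      algebraMap K (InfAlg inf L) (E.expCoeff n) ∈ Λ.lat (k + (Fintype.card Fq : ℤ) ^ n) := by
    intro n k hn h
    obtain ⟨c, hc, hrec⟩ := expCoeff_rec E inf ht hn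
    have h2 := hϖ.smul_mem b hb (sum_mem h) hc (Fintype.card Fq ^ n)
    rw [Nat.cast_pow] at h2
    convert h2 using 1
    rw [hrec, Algebra.smul_def, map_mul, ← IsScalarTower.algebraMap_apply, ← Algebra.smul_def,
      map_sum]
    simp only [map_mul, map_pow]
  obtain ⟨Exp, -, hE, k, hk⟩ := Λ.exists_expHom (Fq := Fq)
    (ε := fun n => algebraMap K (InfAlg inf L) (E.expCoeff n)) h0
    (Λ.coeff_eventually_mem (φ := fun n => algebraMap K (InfAlg inf L) (E.coeff t n)) Fintype.one_lt_card hm h1 h0 hφ hrec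
      (D := D) (fun i hi => by rw [hD i hi, map_zero])) hm
    (Λ.coeff_mem (φ := fun n => algebraMap K (InfAlg inf L) (E.coeff t n)) Fintype.one_lt_card hm h1 h0 hφ hrec)
  exact ⟨Exp, hE, Λ.lat k, Λ.isOpen k, hk⟩

end ExpMap

/-! ### Finiteness of class groups -/

section Finiteness

open Filter Topology

variable {Fq A Q K : Type*} [Field Fq] [Fintype Fq] [CommRing A] [Algebra Fq A] [Field Q]
  [Algebra Fq Q] [Algebra A Q] [FaithfulSMul A Q] [IsScalarTower Fq A Q]
  [Field K] [Algebra Fq K] [Algebra A K] [IsScalarTower Fq A K] [Algebra Q K]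
  [IsScalarTower A Q K] (E : DrinfeldModule Fq A K) (hQ : IsGlobalFunctionField Fq Q)
  {inf : ValuationSubring Q} (hinf : inf ≠ ⊤)
  (hA : Set.range (algebraMap A Q) = regularRing Fq inf)
  {L : Type*} [Field L] [Algebra K L] [Algebra A L] [IsScalarTower A K L] [Algebra Q L]
  [IsScalarTower Q K L]

include hQ hinf hA in
theorem exists_isPseudoUniformizer : ∃ t : A, IsPseudoUniformizer inf (algebraMap A Q t)⁻¹ := by
  obtain ⟨t, ht, ht'⟩ := exists_mem_regularRing_notMem hQ inf hinf
  obtain ⟨t, rfl⟩ : t ∈ Set.range (algebraMap A Q) := by rw [hA]; exact ht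
  have h0 : algebraMap A Q t ≠ 0 := fun h => ht' (by rw [h]; exact zero_mem _)
  exact ⟨t, inv_ne_zero h0, by rw [valuation_lt_one_iff, inv_inv]; exact Or.inr ht',
    exists_inv_pow_mul_mem hQ inf ht'⟩

include hQ hA in
-- $A$ is cocompact in $Q_\infty$: by density an element of $Q_\infty$ is replaced by one of $Q$,
-- and $Q/(A+t^{-N}\mathcal O_\infty)$ is finite.
theorem exists_finite_sub_mem_add {t : A} (ht : IsPseudoUniformizer inf (algebraMap A Q t)⁻¹)
    (U : AddSubgroup (Cmpl inf)) (hU : IsOpen (U : Set (Cmpl inf))) :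
    ∃ V : Set (Cmpl inf), V.Finite ∧ ∀ c, ∃ v ∈ V, ∃ a : A,
      c - v - algebraMap Q (Cmpl inf) (algebraMap A Q a) ∈ U := by
  obtain ⟨N, hN⟩ := ht.exists_forall_mem (hU.mem_nhds (zero_mem U))
  have ht' : algebraMap A Q t ∉ inf := by
    have h := ht.lt_one
    rw [valuation_lt_one_iff, inv_inv] at h
    exact h.resolve_left ht.ne_zero
  have htr : algebraMap A Q t ∈ regularRing Fq inf := by
    rw [← SetLike.mem_coe, ← hA]
    exact ⟨t, rfl⟩
  obtain ⟨V, hV, h⟩ := exists_finite_sub_mem_regularRing hQ inf htr ht' N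
  refine ⟨algebraMap Q (Cmpl inf) '' V, hV.image _, fun c => ?_⟩
  obtain ⟨x, hx⟩ := exists_sub_mem_of_isOpen inf U hU c
  obtain ⟨v, hv, y, hy, z, hz, hxy⟩ := h x
  obtain ⟨a, rfl⟩ : y ∈ Set.range (algebraMap A Q) := by rw [hA]; exact hy
  refine ⟨_, ⟨v, hv, rfl⟩, a, ?_⟩
  have h1 : algebraMap Q (Cmpl inf) ((algebraMap A Q t)⁻¹ ^ N * z) ∈ U := by
    apply hN
    rw [map_mul, map_pow, inv_mul_cancel_left₀ (pow_ne_zero _ ht.algebraMap_ne_zero)]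
    exact (algebraMap_mem_cmplInt inf).mpr hz
  have h2 : c - algebraMap Q (Cmpl inf) v - algebraMap Q (Cmpl inf) (algebraMap A Q a) =
      (c - algebraMap Q (Cmpl inf) x) + algebraMap Q (Cmpl inf) ((algebraMap A Q t)⁻¹ ^ N * z) := by
    rw [← sub_eq_iff_eq_add'.mpr hxy, map_sub, map_sub]
    ring
  rw [h2]
  exact add_mem hx h1

include hQ hinf hA in
-- Cocompactness of `f` in $L_\infty$ follows from that of $A$ in $Q_\infty$, coordinate by
-- coordinate in a $Q$-basis of $L$ contained in `f`.
theorem exists_finite_sub_mem_ideal_add [FiniteDimensional Q L] [IsScalarTower A Q L]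
    {f : Ideal (IntRing A L)} (hf : f ≠ ⊥) (U : AddSubgroup (InfAlg inf L))
    (hU : @IsOpen _ (infTopology inf L) (U : Set (InfAlg inf L))) :
    ∃ V : Set (InfAlg inf L), V.Finite ∧ ∀ z, ∃ v ∈ V, ∃ x ∈ f,
      z - v - (x : L) ⊗ₜ 1 ∈ U := by
  letI := infTopology inf L
  obtain ⟨t, ht⟩ := exists_isPseudoUniformizer hQ hinf hA
  have := (intRing_structure hQ inf hinf A hA Q).2.2.1
  obtain ⟨n, b, hb⟩ := exists_basis_mem (K := Q) hf
  choose e hef he using hb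
  choose V hV h using fun i => exists_finite_sub_mem_add hQ hA ht
    (U.comap (TensorProduct.mk Q L (Cmpl inf) (b i)).toAddMonoidHom)
    (hU.preimage (continuous_tmul inf (b i)))
  refine ⟨(fun c : Fin n → Cmpl inf => ∑ i, b i ⊗ₜ[Q] c i) '' Set.univ.pi V,
    (Set.Finite.pi hV).image _, fun z => ?_⟩
  choose v hv a ha using fun i => h i (coordMap b i (Cmpl inf) z)
  refine ⟨_, ⟨v, fun i _ => hv i, rfl⟩, ∑ i, a i • e i, sum_mem fun i _ => ?_, ?_⟩
  · rw [Algebra.smul_def]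
    exact f.mul_mem_left _ (hef i)
  · have h1 : ((∑ i, a i • e i : IntRing A L) : L) ⊗ₜ[Q] (1 : Cmpl inf) =
        ∑ i, b i ⊗ₜ[Q] (algebraMap Q (Cmpl inf) (algebraMap A Q (a i))) := by
      rw [AddSubmonoidClass.coe_finsetSum, TensorProduct.sum_tmul]
      refine Finset.sum_congr rfl fun i _ => ?_
      rw [← mul_one (algebraMap Q (Cmpl inf) _), ← Algebra.smul_def, ← TensorProduct.smul_tmul,
        ← he, algebraMap_smul]
      rfl
    rw [h1]
    nth_rw 1 [← sum_tmul_coordMap b z]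
    rw [← Finset.sum_sub_distrib, ← Finset.sum_sub_distrib]
    refine sum_mem fun i _ => ?_
    have h2 : b i ⊗ₜ[Q] (coordMap b i (Cmpl inf) z - v i -
      algebraMap Q (Cmpl inf) (algebraMap A Q (a i))) ∈ U := ha i
    rwa [TensorProduct.tmul_sub, TensorProduct.tmul_sub] at h2

variable [IsIntegrallyClosedIn Fq A] [FaithfulSMul A K]

variable {E} in
theorem classGroup_mk_eq {f : Ideal (IntRing A L)} {z w : IdeleQuot E inf f} :
    (Submodule.Quotient.mk z : ClassGroup E inf f) = Submodule.Quotient.mk w ↔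
    ∃ x : Points E L, Submodule.Quotient.mk (diagInf E inf L x) = z.1 - w.1 ∧
      ∀ v : FinPlace A K, Submodule.Quotient.mk (diagLoc E L v.1 x) = z.2 v - w.2 v := by
  rw [Submodule.Quotient.eq]
  constructor
  · rintro ⟨x, hx⟩
    obtain ⟨h1, h2⟩ := Prod.ext_iff.mp hx
    exact ⟨x, h1, fun v => congrFun h2 v⟩
  · rintro ⟨x, h1, h2⟩
    exact ⟨x, Prod.ext h1 (funext fun v => h2 v)⟩

/-- Strong approximation at one place leaves all other finite components trivial, so solutions for
single places can be added. -/
theorem exists_diagLoc_eq [IsDedekindDomain (IntRing A K)] [IsFractionRing (IntRing A K) K]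
    [FiniteDimensional K L] {f : Ideal (IntRing A L)} (hf : f ≠ ⊥)
    (z : ⨁ v : FinPlace A K, (Points E (LocAlg v.1 L) ⧸ locSub E f v.1)) :
    ∃ x : Points E L, ∀ v : FinPlace A K, Submodule.Quotient.mk (diagLoc E L v.1 x) = z v := by
  classical
  induction z using DirectSum.induction_on with
  | zero => exact ⟨0, fun v => by rw [map_zero]; rfl⟩
  | of v z =>
    obtain ⟨z, rfl⟩ := Submodule.Quotient.mk_surjective _ z
    obtain ⟨x, hx, hx'⟩ := exists_tmul_sub_mem_and hf v (Points.val E z)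
    refine ⟨(Points.val E).symm x, fun w => ?_⟩
    rcases eq_or_ne w v with rfl | hw
    · rw [DirectSum.of_eq_same, eq_comm, Submodule.Quotient.eq]
      exact hx
    · rw [DirectSum.of_eq_of_ne _ _ _ hw, Submodule.Quotient.mk_eq_zero]
      exact hx' w hw
  | add z w hz hw =>
    obtain ⟨x, hx⟩ := hz
    obtain ⟨y, hy⟩ := hw
    refine ⟨x + y, fun v => ?_⟩
    rw [map_add, Submodule.Quotient.mk_add, hx, hy]
    rfl

/-- The class in `H_𝔣` of an element of `L_∞`. -/
def infClass (f : Ideal (IntRing A L)) : Points E (InfAlg inf L) →ₗ[A] ClassGroup E inf f :=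
  (diagImage E inf f).mkQ ∘ₗ LinearMap.inl A _ _ ∘ₗ (expImage E inf L).mkQ

/-- Subtracting the diagonal image of an element of `L` that approximates all finite components
leaves a component at infinity only. -/
theorem infClass_surjective [IsDedekindDomain (IntRing A K)] [IsFractionRing (IntRing A K) K]
    [FiniteDimensional K L] {f : Ideal (IntRing A L)} (hf : f ≠ ⊥) :
    Function.Surjective (infClass E (inf := inf) f) := by
  intro z
  obtain ⟨⟨α, β⟩, rfl⟩ := Submodule.Quotient.mk_surjective (diagImage E inf f) z
  obtain ⟨α, rfl⟩ := Submodule.Quotient.mk_surjective _ α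
  obtain ⟨x, hx⟩ := exists_diagLoc_eq E hf β
  refine ⟨α - diagInf E inf L x, classGroup_mk_eq.mpr ⟨-x, ?_, fun v => ?_⟩⟩
  · change _ = Submodule.Quotient.mk (α - diagInf E inf L x) - Submodule.Quotient.mk α
    rw [Submodule.Quotient.mk_sub, sub_sub_cancel_left, map_neg, Submodule.Quotient.mk_neg]
  · change _ = 0 - β v
    rw [map_neg, Submodule.Quotient.mk_neg, hx, zero_sub]

/-- A diagonal element with trivial finite components belongs to `f` locally everywhere, hence
globally. -/
theorem infClass_eq_zero_iff [IsDedekindDomain (IntRing A K)] [IsFractionRing (IntRing A K) K]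
    [FiniteDimensional K L] (hK : ¬ IsField (IntRing A K)) {f : Ideal (IntRing A L)} (hf : f ≠ ⊥)
    (z : Points E (InfAlg inf L)) :
    infClass E (inf := inf) f z = 0 ↔ ∃ x ∈ f,
      z - diagInf E inf L ((Points.val E).symm (x : L)) ∈ expImage E inf L := by
  rw [← (infClass E f).map_zero]
  refine classGroup_mk_eq.trans ?_
  constructor
  · rintro ⟨x, h1, h2⟩
    obtain ⟨y, hy, hxy⟩ := mem_of_forall_tmul_mem hK hf (x := Points.val E x) fun v => by
      have h3 : Submodule.Quotient.mk (diagLoc E L v.1 x) =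
        (0 : Points E (LocAlg v.1 L) ⧸ locSub E f v.1) := (h2 v).trans (sub_self _)
      exact (Submodule.Quotient.mk_eq_zero _).mp h3
    refine ⟨y, hy, ?_⟩
    rw [hxy, AddEquiv.symm_apply_apply, ← Submodule.Quotient.eq, h1]
    exact (sub_zero (Submodule.Quotient.mk z : Points E (InfAlg inf L) ⧸ expImage E inf L)).symm
  · rintro ⟨x, hx, h⟩
    refine ⟨(Points.val E).symm (x : L), ?_, fun v => ?_⟩
    · rw [← Submodule.Quotient.eq] at h
      exact h.symm.trans (sub_zero (Submodule.Quotient.mk z)).symm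
    · refine ((Submodule.Quotient.mk_eq_zero _).mpr ?_).trans (sub_self _).symm
      exact AddSubgroup.subset_closure ⟨x, hx, 1, one_mem _, rfl⟩

include hQ hinf hA in
-- The class group is a quotient of $L_\infty/(\mathfrak f+U)$ for an open subgroup $U$ of
-- exponential values, and this quotient is finite.
theorem finite_classGroup [FiniteDimensional Q K] [FiniteDimensional K L]
    {f : Ideal (IntRing A L)} (hf : f ≠ ⊥) : Finite (ClassGroup E inf f) := by
  letI := infTopology inf L
  obtain ⟨-, _, _, hK, -⟩ := intRing_structure hQ inf hinf A hA K
  have : FiniteDimensional Q L := FiniteDimensional.trans Q K L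
  have : IsScalarTower A Q L := IsScalarTower.of_algebraMap_eq fun a => by
    rw [IsScalarTower.algebraMap_apply A K L, IsScalarTower.algebraMap_apply A Q K,
      ← IsScalarTower.algebraMap_apply Q K L]
  obtain ⟨t, ht⟩ := exists_isPseudoUniformizer hQ hinf hA
  obtain ⟨Exp, hE, U, hU, hUE⟩ := exists_expHom E inf L ht
  obtain ⟨V, hV, h⟩ := exists_finite_sub_mem_ideal_add hQ hinf hA hf U hU
  have := hV.to_subtype
  refine Finite.of_surjective
    (fun v : V => infClass E f ((Points.val E).symm (v : InfAlg inf L))) fun z => ?_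
  obtain ⟨z, rfl⟩ := infClass_surjective E hf z
  obtain ⟨v, hv, x, hx, hU'⟩ := h (Points.val E z)
  obtain ⟨y, hy⟩ := hUE _ hU'
  refine ⟨⟨v, hv⟩, ?_⟩
  rw [eq_comm, ← sub_eq_zero, ← map_sub, infClass_eq_zero_iff E hK hf]
  refine ⟨x, hx, Submodule.subset_span ⟨y, ?_⟩⟩
  have := hE y
  rw [hy] at this
  exact this

end Finiteness

/-! ### Traces in tamely ramified extensions -/

section Tame

open IsDedekindDomain

/-- If all traces lay in `P`, the sum of the characters $b\mapsto\sigma b \bmod P$ would vanish. By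
Dedekind's independence of characters, the multiplicity of each distinct character would be zero in
the residue field. -/
theorem exists_sum_smul_notMem {S G : Type*} [CommRing S] [Group G] [Fintype G]
    [MulSemiringAction G S] (P : Ideal S) [P.IsMaximal]
    (h : (Nat.card (P.inertia G) : S) ∉ P) : ∃ b : S, ∑ σ : G, σ • b ∉ P := by
  classical
  by_contra! hsum
  letI := Ideal.Quotient.field P
  let f : G → S →* S ⧸ P := fun σ =>
    (Ideal.Quotient.mk P : S →* S ⧸ P).comp (MulSemiringAction.toRingHom G S σ : S →* S)
  have hf : ∀ σ b, f σ b = Ideal.Quotient.mk P (σ • b) := fun _ _ => rfl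
  have hli := linearIndependent_iff'.mp (linearIndependent_monoidHom S (S ⧸ P))
    (Finset.univ.image f) (fun χ => ((Finset.univ.filter fun σ => f σ = χ).card : S ⧸ P)) (by
      ext b
      rw [Finset.sum_apply]
      have h1 : ∑ σ : G, f σ b = 0 := by
        simp only [hf]
        rw [← map_sum, Ideal.Quotient.eq_zero_iff_mem]
        exact hsum b
      rw [← Finset.sum_fiberwise_of_maps_to
        (fun σ _ => Finset.mem_image_of_mem f (Finset.mem_univ σ))] at h1
      rw [Pi.zero_apply, ← h1]
      refine Finset.sum_congr rfl fun χ _ => ?_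
      rw [Pi.smul_apply, smul_eq_mul, ← nsmul_eq_mul]
      rw [Finset.sum_congr rfl (g := fun _ => χ b) (fun σ hσ => by
        rw [(Finset.mem_filter.mp hσ).2]), Finset.sum_const])
    (f 1) (Finset.mem_image_of_mem f (Finset.mem_univ 1))
  apply h
  rw [← Ideal.Quotient.eq_zero_iff_mem, map_natCast]
  -- The automorphisms with the same character as the identity are those acting trivially modulo
  -- `P`.
  have h2 : Nat.card (P.inertia G) = (Finset.univ.filter fun σ => f σ = f 1).card := by
    rw [← Nat.subtype_card (Finset.univ.filter fun σ => f σ = f 1)]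
    intro σ
    rw [Finset.mem_filter, and_iff_right (Finset.mem_univ _), DFunLike.ext_iff]
    refine forall_congr' fun b => ?_
    rw [hf, hf, one_smul, Ideal.Quotient.eq]
    rfl
  rw [h2]
  exact hli

theorem ramIdx_eq_one_of {K L : Type*} [Field K] [Field L] [Algebra K L] (w : ValuationSubring L)
    (h : ∀ x : L, x ≠ 0 → ∃ y : K, w.valuation x = w.valuation (algebraMap K L y)) :
    ramIdx K w = 1 := by
  rw [ramIdx, Subgroup.index_eq_one, eq_top_iff]
  intro γ _
  obtain ⟨x, hx⟩ := w.valuation_surjective γ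
  have hx0 : x ≠ 0 := by
    rintro rfl
    rw [map_zero] at hx
    exact γ.ne_zero hx.symm
  obtain ⟨y, hy⟩ := h x hx0
  have hy0 : y ≠ 0 := by
    rintro rfl
    rw [map_zero, map_zero, hx] at hy
    exact γ.ne_zero hy
  exact ⟨Units.mk0 y hy0, Units.ext (hy.symm.trans hx)⟩

theorem exists_valuation_eq_of_ramIdx_eq_one {K L : Type*} [Field K] [Field L] [Algebra K L]
    (w : ValuationSubring L) (h : ramIdx K w = 1) {x : L} (hx : x ≠ 0) :
    ∃ y : K, w.valuation x = w.valuation (algebraMap K L y) := by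
  rw [ramIdx, Subgroup.index_eq_one] at h
  obtain ⟨y, hy⟩ := (h ▸ Subgroup.mem_top (Units.mk0 (w.valuation x)
    ((Valuation.ne_zero_iff _).mpr hx)) : _ ∈ (Units.map ((w.valuation : L →* w.ValueGroup).comp
    (algebraMap K L : K →* L))).range)
  exact ⟨y, (congrArg Units.val hy).symm⟩

/-- Chevalley's extension theorem: some valuation ring of `M` dominates the image of `w`, and
domination forces the contraction to be `w` itself. -/
theorem exists_comap_eq {L M : Type*} [Field L] [Field M] [Algebra L M] (w : ValuationSubring L) :
    ∃ W : ValuationSubring M, W.comap (algebraMap L M) = w := by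
  obtain ⟨W, hW⟩ := LocalSubring.exists_le_valuationSubring
    (w.toLocalSubring.map (algebraMap L M))
  have hle : ∀ x ∈ w, algebraMap L M x ∈ W := fun x hx => hW.1 ⟨x, hx, rfl⟩
  refine ⟨W, ?_⟩
  ext x
  rw [ValuationSubring.mem_comap]
  refine ⟨fun hx => ?_, hle x⟩
  by_contra hxw
  have hx' : x⁻¹ ∈ w := (w.mem_or_inv_mem x).resolve_left hxw
  have hx0 : x ≠ 0 := fun h => hxw (h ▸ zero_mem w)
  obtain ⟨_, hloc⟩ := hW
  -- In `W` the image of $x^{-1}$ has the inverse $x$; as the inclusion is local, it is already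
  -- invertible in the image of `w`.
  have hu : IsUnit (⟨algebraMap L M x⁻¹, ⟨x⁻¹, hx', rfl⟩⟩ :
      (w.toLocalSubring.map (algebraMap L M)).toSubring) := by
    apply hloc.map_nonunit
    refine IsUnit.of_mul_eq_one (⟨algebraMap L M x, hx⟩ : W.toLocalSubring.toSubring) ?_
    apply Subtype.ext
    change algebraMap L M x⁻¹ * algebraMap L M x = 1
    rw [← map_mul, inv_mul_cancel₀ hx0, map_one]
  obtain ⟨⟨_, y, hy, rfl⟩, h⟩ := hu.exists_right_inv
  have h1 : algebraMap L M x⁻¹ * algebraMap L M y = 1 := congrArg Subtype.val h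
  rw [← map_mul, ← map_one (algebraMap L M)] at h1
  have h2 := (algebraMap L M).injective h1
  rw [inv_mul_eq_one₀ hx0] at h2
  exact hxw (h2 ▸ hy)

variable {A L L' : Type*} [CommRing A] [Field L] [Field L'] [Algebra A L] [Algebra A L']
  [Algebra L L'] [IsScalarTower A L L']
  [IsDedekindDomain (IntRing A L)] [IsFractionRing (IntRing A L) L]
  [IsDedekindDomain (IntRing A L')] [IsFractionRing (IntRing A L') L']

/-- This transfers primality to `p` from the index of value groups to the ideal-theoretic
ramification index; divisibility is all that is needed. The normalized valuation of `w` maps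
$L^\times$ into $e\mathbb Z$. -/
theorem ramificationIdx_dvd_ramIdx [Algebra (IntRing A L) (IntRing A L')]
    [IsScalarTower (IntRing A L) (IntRing A L') L'] [Module.IsTorsionFree (IntRing A L) (IntRing A L')]
    (u : HeightOneSpectrum (IntRing A L)) (w : FinPlace A L')
    [w.prime.asIdeal.LiesOver u.asIdeal] :
    u.asIdeal.ramificationIdx' w.prime.asIdeal ∣ ramIdx L w.1 := by
  set e := u.asIdeal.ramificationIdx' w.prime.asIdeal with he
  let ψ : L'ˣ →* Multiplicative ℤ := (WithZero.unitsWithZeroEquiv (α := Multiplicative ℤ)).toMonoidHom.comp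
    (Units.map (w.prime.valuation L' : L' →* WithZero (Multiplicative ℤ)))
  have hψ : Function.Surjective ψ := by
    intro n
    obtain ⟨x, hx⟩ := w.prime.valuation_surjective L' (n : WithZero (Multiplicative ℤ))
    have hx0 : x ≠ 0 := by
      rintro rfl
      rw [map_zero] at hx
      exact WithZero.coe_ne_zero hx.symm
    refine ⟨Units.mk0 x hx0, ?_⟩
    apply WithZero.coe_injective
    change ((WithZero.unitsWithZeroEquiv _ : Multiplicative ℤ) : WithZero (Multiplicative ℤ)) = _
    rw [WithZero.coe_unitsWithZeroEquiv_eq_units_val]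
    exact hx
  let v : L'ˣ →* w.1.ValueGroupˣ := Units.map (w.1.valuation : L' →* w.1.ValueGroup)
  have hv : Function.Surjective v := by
    intro γ
    obtain ⟨x, hx⟩ := w.1.valuation_surjective γ
    have hx0 : x ≠ 0 := by
      rintro rfl
      rw [map_zero] at hx
      exact γ.ne_zero hx.symm
    exact ⟨Units.mk0 x hx0, Units.ext hx⟩
  have heq : w.1.valuation.IsEquiv (w.prime.valuation L') := by
    rw [Valuation.isEquiv_iff_valuationSubring, ValuationSubring.valuationSubring_valuation]
    exact w.eq_valuationSubring
  rw [ramIdx, ← Subgroup.index_comap_of_surjective _ hv]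
  have hindex : (Subgroup.comap ψ (AddSubgroup.toSubgroup (AddSubgroup.zmultiples (e : ℤ)))).index =
      e := by
    rw [Subgroup.index_comap_of_surjective _ hψ]
    exact (Int.index_zmultiples (e : ℤ)).trans (Int.natAbs_natCast e)
  rw [← hindex]
  -- It remains to see that a unit of `L'` with the same value as some `y` in `L` has normalized
  -- valuation $e$ times that of `y`.
  refine Subgroup.index_dvd_of_le ?_
  rintro x ⟨y, hy⟩
  have hy' : w.1.valuation (algebraMap L L' y) = w.1.valuation x := congrArg Units.val hy
  have h1 := heq.eq_iff.mp hy'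
  rw [← HeightOneSpectrum.valuation_liesOver L' u w.prime, ← he] at h1
  have hne : u.valuation L (y : L) ≠ 0 := (Valuation.ne_zero_iff _).mpr y.ne_zero
  obtain ⟨n, hn⟩ := WithZero.ne_zero_iff_exists.mp hne
  refine ⟨n.toAdd, ?_⟩
  change Multiplicative.ofAdd (n.toAdd • (e : ℤ)) = ψ x
  apply WithZero.coe_injective
  change _ = ((WithZero.unitsWithZeroEquiv _ : Multiplicative ℤ) : WithZero (Multiplicative ℤ))
  rw [WithZero.coe_unitsWithZeroEquiv_eq_units_val]
  change _ = w.prime.valuation L' x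
  rw [← h1, ← hn, ← WithZero.coe_pow]
  congr 1
  change _ = Multiplicative.ofAdd (e • n.toAdd)
  rw [smul_eq_mul, nsmul_eq_mul, mul_comm]

variable [FiniteDimensional L L'] [IsGalois L L'] [Module.Finite A (IntRing A L')]
  (hfin : ∀ P : Ideal (IntRing A L), P.IsMaximal → Finite (IntRing A L ⧸ P))

include hfin in
/-- If `L'/L` is tamely ramified above the place `u` of `L`, then the trace of an integral element
is a unit at `u`. -/
theorem exists_trace_notMem {p : ℕ} [hp : Fact p.Prime] [CharP L p] (u : FinPlace A L)
    (hu : ∀ w : FinPlace A L', w.1.comap (algebraMap L L') = u.1 → ¬ p ∣ ramIdx L w.1) :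
    ∃ (b : IntRing A L') (y : IntRing A L), Algebra.trace L L' (b : L') = y ∧
      u.1.valuation (y : L) = 1 := by
  classical
  letI : Algebra (IntRing A L) (IntRing A L') :=
    (IsScalarTower.toAlgHom A L L').mapIntegralClosure.toRingHom.toAlgebra
  haveI : IsScalarTower (IntRing A L) (IntRing A L') L' := IsScalarTower.of_algebraMap_eq fun _ => rfl
  haveI : IsScalarTower A (IntRing A L) (IntRing A L') :=
    IsScalarTower.of_algebraMap_eq fun a => ((IsScalarTower.toAlgHom A L L').mapIntegralClosure.commutes a).symm
  have hinj : Function.Injective (algebraMap (IntRing A L) (IntRing A L')) := fun x y h =>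
    Subtype.ext ((algebraMap L L').injective (congrArg Subtype.val h))
  haveI : FaithfulSMul (IntRing A L) (IntRing A L') :=
    (faithfulSMul_iff_algebraMap_injective _ _).mpr hinj
  haveI : Module.Finite (IntRing A L) (IntRing A L') := Module.Finite.of_restrictScalars_finite A _ _
  haveI : IsGaloisGroup (L' ≃ₐ[L] L') (IntRing A L) (IntRing A L') :=
    IsGaloisGroup.of_isFractionRing _ _ _ L L'
  have humax : u.prime.asIdeal.IsMaximal := u.prime.isMaximal
  obtain ⟨P, hPmax, hP⟩ := Ideal.exists_maximal_ideal_liesOver_of_isIntegral (S := IntRing A L')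
    u.prime.asIdeal
  have hP0 : P ≠ ⊥ := Ideal.ne_bot_of_liesOver_of_ne_bot u.prime.ne_bot P
  obtain ⟨w, hw⟩ := FinPlace.exists_prime_eq (A := A) (K := L') ⟨P, hPmax.isPrime, hP0⟩
  obtain rfl : w.prime.asIdeal = P := congrArg HeightOneSpectrum.asIdeal hw
  haveI := hfin _ humax
  -- Finiteness of the residue field enters here: the order of the inertia group is then the full
  -- ramification index.
  have hcard : Nat.card (w.prime.asIdeal.inertia (L' ≃ₐ[L] L')) =
      u.prime.asIdeal.ramificationIdx' w.prime.asIdeal := by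
    rw [Ideal.card_inertia_eq_ramificationIdxIn u.prime.asIdeal,
      Ideal.ramificationIdxIn_eq_ramificationIdx u.prime.asIdeal w.prime.asIdeal (L' ≃ₐ[L] L'),
      Ideal.ramificationIdx'_eq_ramificationIdx _ _ u.prime.ne_bot]
  have he : u.prime.asIdeal.ramificationIdx' w.prime.asIdeal ≠ 0 := by
    rw [← hcard]
    exact Nat.card_pos.ne'
  have hcomap : w.1.comap (algebraMap L L') = u.1 := by
    ext x
    rw [ValuationSubring.mem_comap, w.eq_valuationSubring, u.eq_valuationSubring,
      Valuation.mem_valuationSubring_iff, Valuation.mem_valuationSubring_iff,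
      ← HeightOneSpectrum.valuation_liesOver L' u.prime w.prime]
    exact pow_le_one_iff he
  have hndvd := fun h : p ∣ u.prime.asIdeal.ramificationIdx' w.prime.asIdeal =>
    hu w hcomap (h.trans (ramificationIdx_dvd_ramIdx u.prime w))
  rw [← hcard] at hndvd
  -- In characteristic `p`, a Bézout relation makes an integer prime to `p` a unit, so it cannot lie
  -- in a prime ideal.
  obtain ⟨b, hb⟩ := exists_sum_smul_notMem (G := L' ≃ₐ[L] L') w.prime.asIdeal (fun hmem => by
    have hcop := (Nat.isCoprime_iff_coprime.mpr ((Nat.Prime.coprime_iff_not_dvd hp.out).mpr hndvd))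
    obtain ⟨a, c, hac⟩ := hcop
    have hp0 : ((p : ℕ) : IntRing A L') = 0 := by
      apply Subtype.ext
      change ((p : IntRing A L') : L') = 0
      rw [SubringClass.coe_natCast, ← map_natCast (algebraMap L L'), CharP.cast_eq_zero, map_zero]
    have h1 := congrArg (Int.cast : ℤ → IntRing A L') hac
    push_cast at h1
    rw [hp0, mul_zero, zero_add] at h1
    exact hPmax.ne_top ((Ideal.eq_top_iff_one _).mpr (h1 ▸ Ideal.mul_mem_left _ _ hmem)))
  refine ⟨b, ⟨Algebra.trace L L' (b : L'), Algebra.isIntegral_trace b.2⟩, rfl, ?_⟩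
  refine (valuation_lt_one_or_eq_one u.1 (u.intRing_mem
    ⟨Algebra.trace L L' (b : L'), Algebra.isIntegral_trace b.2⟩)).resolve_left fun hlt => hb ?_
  have h1 := (u.mem_prime ⟨Algebra.trace L L' (b : L'), Algebra.isIntegral_trace b.2⟩).mpr hlt
  rw [Ideal.over_def w.prime.asIdeal u.prime.asIdeal, Ideal.under_def, Ideal.mem_comap] at h1
  convert h1 using 1
  apply Subtype.ext
  change _ = algebraMap L L' (Algebra.trace L L' (b : L'))
  rw [trace_eq_sum_automorphisms, AddSubmonoidClass.coe_finsetSum]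
  rfl

end Tame

/-! ### The trace on class groups of a fixed modulus -/

section BaseTrace

variable {Fq Q K : Type*} [Field Fq] [Fintype Fq] [Field Q] [Field K] [Algebra Fq K] [Algebra Q K]
  {L L' : Type*} [Field L] [Algebra K L] [Algebra Q L] [IsScalarTower Q K L]
  [Field L'] [Algebra K L'] [Algebra Q L'] [IsScalarTower Q K L'] [Algebra L L']
  [IsScalarTower K L L'] [FiniteDimensional L L'] [IsGalois L L']

theorem base_traceTau_surjective (B : Type*) [CommRing B] [Algebra Q B] :
    Function.Surjective ((traceTau Fq K L L').base Q B) := by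
  intro z
  induction z using TensorProduct.induction_on with
  | zero => exact ⟨0, map_zero _⟩
  | tmul x b =>
    obtain ⟨y, hy⟩ := Algebra.trace_surjective L L' x
    exact ⟨y ⊗ₜ b, by rw [TauMap.base_tmul]; exact congrArg (· ⊗ₜ b) hy⟩
  | add x y hx hy =>
    obtain ⟨x, rfl⟩ := hx
    obtain ⟨y, rfl⟩ := hy
    exact ⟨x + y, map_add _ _ _⟩

/-- An automorphism of `L'/L` as an automorphism of `L'/K`. -/
abbrev galRes (K : Type*) {L L' : Type*} [Field K] [Field L] [Field L'] [Algebra K L] [Algebra K L']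
    [Algebra L L'] [IsScalarTower K L L'] (σ : L' ≃ₐ[L] L') : L' ≃ₐ[K] L' := σ.restrictScalars K

/-- The additive form of Hilbert's Theorem 90 for `L' ⊗ B`. -/
theorem exists_sum_galTau_sub (B : Type*) [CommRing B] [Algebra Q B] {w : L' ⊗[Q] B}
    (hw : (traceTau Fq K L L').base Q B w = 0) :
    ∃ y : (L' ≃ₐ[L] L') → L' ⊗[Q] B,
      w = ∑ σ, ((galTau Fq (galRes K σ)).base Q B (y σ) - y σ) := by
  have hQL : IsScalarTower Q L L' := IsScalarTower.of_algebraMap_eq fun a => by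
    rw [IsScalarTower.algebraMap_apply Q K L', IsScalarTower.algebraMap_apply Q K L,
      ← IsScalarTower.algebraMap_apply K L L']
  obtain ⟨θ, hθ⟩ := Algebra.trace_surjective L L' 1
  have hsmul : ∀ (σ : L' ≃ₐ[L] L') (x : L') (z : L' ⊗[Q] B),
      (galTau Fq (galRes K σ)).base Q B (x • z) = σ x • (galTau Fq (galRes K σ)).base Q B z := by
    intro σ x z
    induction z using TensorProduct.induction_on with
    | zero => simp
    | tmul y b =>
      rw [TensorProduct.smul_tmul', TauMap.base_tmul, TauMap.base_tmul, TensorProduct.smul_tmul']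
      exact congrArg (· ⊗ₜ b) (map_mul σ x y)
    | add y z hy hz => rw [smul_add, map_add, hy, hz, map_add, smul_add]
  have hinv : ∀ (σ : L' ≃ₐ[L] L') (z : L' ⊗[Q] B), (galTau Fq (galRes K σ)).base Q B
      ((galTau Fq (galRes K σ⁻¹)).base Q B z) = z := by
    intro σ z
    induction z using TensorProduct.induction_on with
    | zero => simp
    | tmul y b =>
      rw [TauMap.base_tmul, TauMap.base_tmul]
      exact congrArg (· ⊗ₜ b) (σ.apply_symm_apply y)
    | add y z hy hz => rw [map_add, map_add, hy, hz]
  have hsum : ∀ z : L' ⊗[Q] B, ∑ σ : L' ≃ₐ[L] L', (galTau Fq (galRes K σ)).base Q B z =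
      TensorProduct.map ((Algebra.linearMap L L').restrictScalars Q) LinearMap.id
        ((traceTau Fq K L L').base Q B z) := by
    intro z
    induction z using TensorProduct.induction_on with
    | zero => simp
    | tmul y b =>
      rw [TauMap.base_tmul, TensorProduct.map_tmul]
      simp only [TauMap.base_tmul]
      rw [← TensorProduct.sum_tmul]
      exact congrArg (· ⊗ₜ b) (trace_eq_sum_automorphisms y).symm
    | add y z hy hz =>
      simp only [map_add, Finset.sum_add_distrib]
      rw [hy, hz]
  -- With $\mathrm{Tr}\,\theta=1$ and $y_\sigma=\theta\,\sigma^{-1}w$, the sum of the $\sigma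
  -- y_\sigma=\sigma(\theta)w$ is $w$, and the sum of the $y_\sigma$ is $\theta$ times the trace of
  -- $w$, which is zero.
  refine ⟨fun σ => θ • (galTau Fq (galRes K σ⁻¹)).base Q B w, ?_⟩
  rw [Finset.sum_sub_distrib, ← Finset.smul_sum,
    Fintype.sum_equiv (Equiv.inv (L' ≃ₐ[L] L')) (fun σ => (galTau Fq (galRes K σ⁻¹)).base Q B w)
      (fun σ => (galTau Fq (galRes K σ)).base Q B w) (fun _ => rfl), hsum, hw, map_zero, smul_zero,
    sub_zero]
  simp only [hsmul, hinv]
  rw [← Finset.sum_smul, ← trace_eq_sum_automorphisms θ, hθ, map_one, one_smul]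

end BaseTrace

/-! ### Trace ideals and the trace between class groups with moduli. -/

section FiniteLevel

variable {Fq A Q K : Type*} [Field Fq] [Fintype Fq] [CommRing A] [Algebra Fq A] [Field Q]
  [Algebra Fq Q] [Algebra A Q] [FaithfulSMul A Q] [IsScalarTower Fq A Q]
  [Field K] [Algebra Fq K] [Algebra A K] [IsScalarTower Fq A K] [Algebra Q K]
  [IsScalarTower A Q K] (E : DrinfeldModule Fq A K) (hQ : IsGlobalFunctionField Fq Q)
  {inf : ValuationSubring Q} (hinf : inf ≠ ⊤)
  (hA : Set.range (algebraMap A Q) = regularRing Fq inf)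
  {L L' : Type*} [Field L] [Algebra K L] [Algebra A L] [IsScalarTower A K L] [Algebra Q L]
  [IsScalarTower Q K L] [Field L'] [Algebra K L'] [Algebra A L'] [IsScalarTower A K L']
  [Algebra Q L'] [IsScalarTower Q K L'] [Algebra L L'] [IsScalarTower K L L']

/-- The trace of an ideal of `𝒪_{L'}`. -/
def traceIdeal (K L : Type*) {L' : Type*} [Field K] [Field L] [Field L'] [Algebra A K] [Algebra K L]
    [Algebra A L] [IsScalarTower A K L] [Algebra K L'] [Algebra A L'] [IsScalarTower A K L']
    [Algebra L L'] [IsScalarTower K L L']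
    (f' : Ideal (IntRing A L')) : Ideal (IntRing A L) where
  carrier := {y | ∃ x ∈ f', (y : L) = Algebra.trace L L' (x : L')}
  add_mem' := by
    rintro _ _ ⟨x, hx, h⟩ ⟨y, hy, h'⟩
    exact ⟨x + y, add_mem hx hy, by push_cast; rw [h, h', map_add]⟩
  zero_mem' := ⟨0, zero_mem _, by simp⟩
  smul_mem' := by
    rintro c _ ⟨x, hx, h⟩
    refine ⟨((IsScalarTower.toAlgHom K L L').restrictScalars A).mapIntegralClosure c * x,
      f'.mul_mem_left _ hx, ?_⟩
    change (c : L) * _ = Algebra.trace L L' (algebraMap L L' (c : L) * (x : L'))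
    rw [← Algebra.smul_def, map_smul, smul_eq_mul, h]

theorem traceTau_mapsInto_traceIdeal (f' : Ideal (IntRing A L')) :
    (traceTau Fq K L L').MapsInto f' (traceIdeal K L f') := by
  intro x hx
  haveI : IsScalarTower A L L' := IsScalarTower.of_algebraMap_eq fun a => by
    rw [IsScalarTower.algebraMap_apply A K L', IsScalarTower.algebraMap_apply A K L,
      IsScalarTower.algebraMap_apply K L L']
  by_cases hfin : FiniteDimensional L L'
  · exact ⟨⟨_, Algebra.isIntegral_trace x.2⟩, ⟨x, hx, rfl⟩, rfl⟩
  · refine ⟨0, zero_mem _, ?_⟩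
    change _ = Algebra.trace L L' (x : L')
    rw [Algebra.trace_eq_zero_of_not_exists_basis]
    · simp
    · rintro ⟨s, ⟨b⟩⟩
      exact hfin (Module.Finite.of_basis b)

theorem traceIdeal_extIdeal_le (Fq : Type*) [Field Fq] [Fintype Fq] [Algebra Fq A]
    [Algebra Fq K] [IsScalarTower Fq A K] (f : Ideal (IntRing A L)) :
    traceIdeal K L (extIdeal (K := K) L' f) ≤ f := by
  rintro y ⟨x, hx, h⟩
  obtain ⟨z, hz, h'⟩ := traceTau_mapsInto (Fq := Fq) (K := K) L' f x hx
  have : y = z := Subtype.ext (h.trans h'.symm)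
  rwa [this]

/-- The projection formula $x\,\mathrm{Tr}(b)=\mathrm{Tr}(xb)$; it bounds the trace ideal from
below. -/
theorem mul_mem_traceIdeal {f : Ideal (IntRing A L)} {x y : IntRing A L} (hx : x ∈ f)
    {b : IntRing A L'} (hb : Algebra.trace L L' (b : L') = y) :
    x * y ∈ traceIdeal K L (extIdeal (K := K) L' f) := by
  refine ⟨((IsScalarTower.toAlgHom K L L').restrictScalars A).mapIntegralClosure x * b,
    Ideal.mul_mem_right _ _ (Ideal.mem_map_of_mem _ hx), ?_⟩
  change (x : L) * (y : L) = Algebra.trace L L' (algebraMap L L' (x : L) * (b : L'))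
  rw [← Algebra.smul_def, map_smul, smul_eq_mul, hb]

section

variable (L')

/-- An element of trace `1`, multiplied by a denominator, is integral with nonzero trace. -/
theorem traceIdeal_ne_bot [IsFractionRing (IntRing A L) L] [FiniteDimensional L L']
    [IsGalois L L'] {f : Ideal (IntRing A L)} (hf : f ≠ ⊥) :
    traceIdeal K L (extIdeal (K := K) L' f) ≠ ⊥ := by
  classical
  haveI : IsScalarTower A L L' := IsScalarTower.of_algebraMap_eq fun a => by
    rw [IsScalarTower.algebraMap_apply A K L', IsScalarTower.algebraMap_apply A K L,
      IsScalarTower.algebraMap_apply K L L']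
  obtain ⟨x, hx, hx0⟩ := Submodule.exists_mem_ne_zero_of_ne_bot hf
  obtain ⟨θ, hθ⟩ := Algebra.trace_surjective L L' 1
  obtain ⟨s, hs, hsb⟩ := exists_integral_multiples (IntRing A L) L {θ}
  have h := hsb θ (Finset.mem_singleton_self θ)
  have h' : IsIntegral A (s • θ) := isIntegral_trans (A := IntRing A L) _ h
  have htr : Algebra.trace L L' ((⟨s • θ, h'⟩ : IntRing A L') : L') = s := by
    change Algebra.trace L L' ((s : L) • θ) = s
    rw [map_smul, hθ, smul_eq_mul, mul_one]
  intro hbot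
  have hmem := mul_mem_traceIdeal (K := K) hx htr
  rw [hbot, Ideal.mem_bot] at hmem
  exact (mul_ne_zero hx0 hs) hmem

end

/-- `L'/L` is tamely ramified at all finite places of `L'` that do not lie above `S`. -/
def IsTameOutside (p : ℕ) (S : Set (FinPlace A K)) (L L' : Type*) [Field L] [Field L'] [Algebra A L']
    [Algebra K L'] [Algebra L L'] : Prop :=
  ∀ w : FinPlace A L', (¬ ∃ v ∈ S, v.1 = w.1.comap (algebraMap K L')) → ¬ p ∣ ramIdx L w.1

include hQ hinf hA in
-- The place where tameness is used. At `u` outside `S` some integral `b` has a trace that is a unit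
-- at `u`. Multiplying elements of `f` by this trace gives elements of the trace ideal with
-- unchanged values at `u`, so `u` divides the trace ideal only if it divides `f`.
theorem supported_traceIdeal [FiniteDimensional Q K] [FiniteDimensional K L]
    [FiniteDimensional L L'] [IsGalois L L'] {p : ℕ} [Fact p.Prime] [CharP Fq p]
    {S : Set (FinPlace A K)} (htame : IsTameOutside p S L L') {f : Ideal (IntRing A L)}
    (hf : Supported S f) : Supported S (traceIdeal K L (extIdeal (K := K) L' f)) := by
  haveI : IsScalarTower A L L' := IsScalarTower.of_algebraMap_eq fun a => by
    rw [IsScalarTower.algebraMap_apply A K L', IsScalarTower.algebraMap_apply A K L,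
      IsScalarTower.algebraMap_apply K L L']
  have : FiniteDimensional Q L := FiniteDimensional.trans Q K L
  have : FiniteDimensional K L' := FiniteDimensional.trans K L L'
  have : FiniteDimensional Q L' := FiniteDimensional.trans Q K L'
  have : IsScalarTower A Q L := IsScalarTower.of_algebraMap_eq fun a => by
    rw [IsScalarTower.algebraMap_apply A K L, IsScalarTower.algebraMap_apply A Q K,
      ← IsScalarTower.algebraMap_apply Q K L]
  have : IsScalarTower A Q L' := IsScalarTower.of_algebraMap_eq fun a => by
    rw [IsScalarTower.algebraMap_apply A K L', IsScalarTower.algebraMap_apply A Q K,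
      ← IsScalarTower.algebraMap_apply Q K L']
  obtain ⟨-, _, _, -, hfin⟩ := intRing_structure hQ inf hinf A hA L
  obtain ⟨_, _, _, -, -⟩ := intRing_structure hQ inf hinf A hA L'
  have : CharP L p := (RingHom.charP_iff_charP ((algebraMap K L).comp (algebraMap Fq K)) p).mp ‹_›
  intro u hu
  by_contra hS
  obtain ⟨b, y, hb, hy⟩ := exists_trace_notMem hfin (p := p) (L' := L') u fun w hw => htame w (by
    rintro ⟨v, hv, h⟩
    refine hS ⟨v, hv, h.trans ?_⟩
    rw [← hw, ValuationSubring.comap_comap, ← IsScalarTower.algebraMap_eq])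
  refine hS (hf u fun x hx => ?_)
  have h := hu _ (mul_mem_traceIdeal (K := K) hx hb)
  have h2 : u.1.valuation ((x * y : IntRing A L) : L) = u.1.valuation (x : L) := by
    rw [MulMemClass.coe_mul, map_mul, hy, mul_one]
  rwa [h2] at h

variable [IsIntegrallyClosedIn Fq A] [FaithfulSMul A K]

theorem classMap_infClass (T : TauMap Fq K L' L) {f' : Ideal (IntRing A L')}
    {f : Ideal (IntRing A L)} (h : T.MapsInto f' f) (z : Points E (InfAlg inf L')) :
    classMap E inf T h (infClass E f' z) = infClass E f (infMap E inf T z) := by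
  refine congrArg Submodule.Quotient.mk (Prod.ext rfl ?_)
  exact map_zero (DirectSum.lmap fun v : FinPlace A K =>
    Submodule.mapQ _ _ (locMap E T v.1) (locSub_le_comap E h v.1))

include hQ hinf hA in
-- The argument of the exponential is lifted through the surjective trace. The series converges at
-- the lift because it is entire, and the trace, being continuous, $K$-linear and compatible with
-- Frobenius, maps it term by term to the given series.
theorem expImage_le_map [FiniteDimensional Q K] [FiniteDimensional K L]
    [FiniteDimensional L L'] [IsGalois L L'] :
    expImage E inf L ≤ (expImage E inf L').map (infMap E inf (traceTau Fq K L L')) := by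
  have : FiniteDimensional Q L := FiniteDimensional.trans Q K L
  have : FiniteDimensional K L' := FiniteDimensional.trans K L L'
  have : FiniteDimensional Q L' := FiniteDimensional.trans Q K L'
  letI := infTopology inf L
  letI := infTopology inf L'
  haveI := t2Space_infTopology inf (Module.finBasis Q L)
  obtain ⟨t, ht⟩ := exists_isPseudoUniformizer hQ hinf hA
  obtain ⟨Exp, hE, -⟩ := exists_expHom E inf L' ht
  refine Submodule.span_le.mpr ?_
  rintro y ⟨x, hx⟩
  obtain ⟨x', rfl⟩ := base_traceTau_surjective (Fq := Fq) (K := K) (L := L) (L' := L') (Cmpl inf) x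
  refine ⟨(Points.val E).symm (Exp x'), Submodule.subset_span ⟨x', hE x'⟩, ?_⟩
  have h := (hE x').map ((traceTau Fq K L L').base Q (Cmpl inf)) (infMap_continuous inf _)
  refine h.unique ((congrArg (fun g => HasSum g (Points.val E y)) ?_).mpr hx)
  funext i
  rw [Function.comp_apply, ← Algebra.smul_def, ← Algebra.smul_def, map_smul,
      pow_card_pow_of_frob _ ((traceTau Fq K L L').base_frob Q (Cmpl inf))]

include hQ hinf hA in
/-- On class groups of a fixed modulus, the trace is surjective. -/
theorem classMap_traceTau_surjective [FiniteDimensional Q K] [FiniteDimensional K L]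
    [FiniteDimensional L L'] [IsGalois L L'] {f' : Ideal (IntRing A L')}
    {f : Ideal (IntRing A L)} (hf : f ≠ ⊥) (h : (traceTau Fq K L L').MapsInto f' f) :
    Function.Surjective (classMap E inf (traceTau Fq K L L') h) := by
  obtain ⟨-, _, _, -, -⟩ := intRing_structure hQ inf hinf A hA K
  intro z
  obtain ⟨z, rfl⟩ := infClass_surjective E hf z
  obtain ⟨w, hw⟩ := base_traceTau_surjective (Fq := Fq) (K := K) (L := L) (L' := L') (Cmpl inf)
    (Points.val E z)
  refine ⟨infClass E f' ((Points.val E).symm w), ?_⟩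
  rw [classMap_infClass]
  exact congrArg _ ((Points.val E).injective hw)

include hQ hinf hA in
theorem classMap_id_surjective [FiniteDimensional Q K] [FiniteDimensional K L]
    {f g : Ideal (IntRing A L)} (hg : g ≠ ⊥) (h : (TauMap.id Fq K L).MapsInto f g) :
    Function.Surjective (classMap E inf (TauMap.id Fq K L) h) := by
  obtain ⟨-, _, _, -, -⟩ := intRing_structure hQ inf hinf A hA K
  intro z
  obtain ⟨z, rfl⟩ := infClass_surjective E hg z
  refine ⟨infClass E f z, ?_⟩
  rw [classMap_infClass]
  refine congrArg _ ((Points.val E).injective ?_)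
  change (TauMap.id Fq K L).base Q (Cmpl inf) (Points.val E z) = Points.val E z
  induction Points.val E z using TensorProduct.induction_on with
  | zero => simp
  | tmul x b => rfl
  | add x y hx hy => rw [map_add, hx, hy]

include hQ hinf hA in
/-- The kernel of the trace on class groups of a fixed modulus. -/
theorem exists_sum_of_classMap_traceTau_eq_zero [FiniteDimensional Q K] [FiniteDimensional K L]
    [FiniteDimensional L L'] [IsGalois L L'] {f' : Ideal (IntRing A L')} (hf' : f' ≠ ⊥)
    (hf : traceIdeal K L f' ≠ ⊥)
    (hσ : ∀ σ : L' ≃ₐ[L] L', (galTau Fq (galRes K σ)).MapsInto f' f') {z : ClassGroup E inf f'}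
    (hz : classMap E inf (traceTau Fq K L L') (traceTau_mapsInto_traceIdeal f') z = 0) :
    ∃ y : (L' ≃ₐ[L] L') → ClassGroup E inf f',
      z = ∑ σ, (classMap E inf (galTau Fq (galRes K σ)) (hσ σ) (y σ) - y σ) := by
  obtain ⟨-, _, _, hK, -⟩ := intRing_structure hQ inf hinf A hA K
  have : FiniteDimensional K L' := FiniteDimensional.trans K L L'
  obtain ⟨z, rfl⟩ := infClass_surjective E hf' z
  rw [classMap_infClass, infClass_eq_zero_iff E hK hf] at hz
  -- Because the target modulus is exactly the trace ideal, the lattice part `x` is the trace of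
  -- some `x'` in `f'`.
  obtain ⟨x, ⟨x', hx', hxx⟩, hz⟩ := hz
  obtain ⟨e, he, hez⟩ := expImage_le_map E hQ hinf hA (L' := L') hz
  -- After both corrections the trace vanishes in $L_\infty$ itself and not only in the quotient, so
  -- Hilbert 90 applies.
  have h0 : (traceTau Fq K L L').base Q (Cmpl inf) (Points.val E
      (z - diagInf E inf L' ((Points.val E).symm (x' : L')) - e)) = 0 := by
    have h1 : infMap E inf (traceTau Fq K L L') (diagInf E inf L' ((Points.val E).symm (x' : L'))) =
        diagInf E inf L ((Points.val E).symm (x : L)) := by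
      rw [hxx]
      rfl
    have h2 : infMap E inf (traceTau Fq K L L')
        (z - diagInf E inf L' ((Points.val E).symm (x' : L')) - e) = 0 := by
      rw [map_sub, map_sub, h1, hez, sub_self]
    exact congrArg (Points.val E) h2
  obtain ⟨y, hy⟩ := exists_sum_galTau_sub (Cmpl inf) h0
  refine ⟨fun σ => infClass E f' ((Points.val E).symm (y σ)), ?_⟩
  have h2 : infClass E f' z =
      infClass E f' (z - diagInf E inf L' ((Points.val E).symm (x' : L')) - e) := by
    rw [← sub_eq_zero, ← map_sub, infClass_eq_zero_iff E hK hf']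
    refine ⟨x', hx', ?_⟩
    rwa [sub_sub z (diagInf E inf L' ((Points.val E).symm (x' : L'))) e, sub_sub_cancel,
      add_sub_cancel_left]
  rw [h2]
  simp only [classMap_infClass, ← map_sub, ← map_sum]
  exact congrArg (infClass E f') hy

end FiniteLevel

/-! ### Projective limits of compact spaces -/

section Compact

/-- The sets of solutions at the individual levels are nonempty, closed and directed in a compact
space, so they have a common point. -/
theorem exists_eq_of_forall_exists {ι H H' : Type*} [TopologicalSpace H] [CompactSpace H]
    [Nonempty ι] {X : ι → Type*} [∀ i, TopologicalSpace (X i)] [∀ i, T2Space (X i)]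
    (Φ : H → H') (π : ∀ i, H' → X i) (hπ : ∀ i, Continuous fun y => π i (Φ y))
    (hdir : ∀ i j, ∃ k, ∀ u v, π k u = π k v → π i u = π i v ∧ π j u = π j v)
    (hsep : ∀ u v, (∀ i, π i u = π i v) → u = v) {x : H'} (h : ∀ i, ∃ y, π i (Φ y) = π i x) :
    ∃ y, Φ y = x := by
  have hcl : ∀ i, IsClosed {y | π i (Φ y) = π i x} := fun i =>
    isClosed_eq (hπ i) continuous_const
  obtain ⟨y, hy⟩ := IsCompact.nonempty_iInter_of_directed_nonempty_isCompact_isClosed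
    (fun i => {y | π i (Φ y) = π i x}) (fun i j => by
      obtain ⟨k, hk⟩ := hdir i j
      exact ⟨k, fun y hy => (hk _ _ hy).1, fun y hy => (hk _ _ hy).2⟩) h
    (fun i => (hcl i).isCompact) hcl
  exact ⟨y, hsep _ _ fun i => Set.mem_iInter.mp hy i⟩

/-- The projections of a projective limit of compact spaces with surjective transition maps are
surjective. The relation `r i j` means that there is a transition map from `X i` to `X j`. -/
theorem exists_compatible {ι : Type*} {r : ι → ι → Prop}
    (htrans : ∀ i j k, r i j → r j k → r i k) (hdir : ∀ i j, ∃ k, r k i ∧ r k j) {X : ι → Type*}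
    [∀ i, TopologicalSpace (X i)] [∀ i, CompactSpace (X i)] [∀ i, T2Space (X i)]
    [∀ i, Nonempty (X i)] (f : ∀ i j, r i j → X i → X j) (hcont : ∀ i j h, Continuous (f i j h))
    (hsurj : ∀ i j h, Function.Surjective (f i j h))
    (hcomp : ∀ i j k (hij : r i j) (hjk : r j k) (hik : r i k) x,
      f j k hjk (f i j hij x) = f i k hik x) (j : ι) (z : X j) :
    ∃ x : ∀ i, X i, x j = z ∧ ∀ i k h, f i k h (x i) = x k := by
  classical
  -- Families over `z` that are compatible on all indices below `i`.
  let T : {i // r i j} → Set (∀ i, X i) := fun i =>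
    {x | x j = z ∧ ∀ k l (h : r k l), r i.1 k → f k l h (x k) = x l}
  have hcl : ∀ i, IsClosed (T i) := by
    intro i
    have h : T i = {x | x j = z} ∩ ⋂ (k) (l) (h : r k l) (_ : r i.1 k),
        {x | f k l h (x k) = x l} := by
      ext x
      simp only [T, Set.mem_inter_iff, Set.mem_iInter, Set.mem_ofPred_eq]
    rw [h]
    refine (isClosed_eq (continuous_apply j) continuous_const).inter ?_
    exact isClosed_iInter fun k => isClosed_iInter fun l => isClosed_iInter fun h =>
      isClosed_iInter fun _ => isClosed_eq ((hcont k l h).comp (continuous_apply k))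
        (continuous_apply l)
  have : Nonempty {i // r i j} := by
    obtain ⟨k, hk, -⟩ := hdir j j
    exact ⟨⟨k, hk⟩⟩
  obtain ⟨x, hx⟩ := IsCompact.nonempty_iInter_of_directed_nonempty_isCompact_isClosed T
    (fun a b => by
      obtain ⟨k, hka, hkb⟩ := hdir a.1 b.1
      exact ⟨⟨k, htrans _ _ _ hka a.2⟩,
        fun x hx => ⟨hx.1, fun l m h hl => hx.2 l m h (htrans _ _ _ hka hl)⟩,
        fun x hx => ⟨hx.1, fun l m h hl => hx.2 l m h (htrans _ _ _ hkb hl)⟩⟩)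
    (fun i => by
      obtain ⟨w, hw⟩ := hsurj i.1 j i.2 z
      -- A lift `w` of `z` to level `i` determines the values below `i`; other indices are
      -- unconstrained and receive arbitrary values.
      refine ⟨fun k => if h : r i.1 k then f i.1 k h w else Classical.arbitrary _, ?_, ?_⟩
      · beta_reduce
        rw [dif_pos i.2, hw]
      · intro k l h hk
        beta_reduce
        rw [dif_pos hk, dif_pos (htrans _ _ _ hk h)]
        exact hcomp _ _ _ _ _ _ _)
    (fun i => (hcl i).isCompact) hcl
  rw [Set.mem_iInter] at hx
  refine ⟨x, (hx (Classical.arbitrary _)).1, fun i k h => ?_⟩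
  obtain ⟨m, hmi, hmj⟩ := hdir i j
  exact (hx ⟨m, hmj⟩).2 i k h hmi

end Compact

/-! ### The profinite topology of $H_S$ and the formal properties of the Galois action. -/

section Profinite

variable {Fq A Q K : Type*} [Field Fq] [Fintype Fq] [CommRing A] [Algebra Fq A] [Field Q]
  [Field K] [Algebra Fq K] [Algebra A K] [IsScalarTower Fq A K] [Algebra Q K]
  (E : DrinfeldModule Fq A K) {inf : ValuationSubring Q}
  {L L' : Type*} [Field L] [Algebra K L] [Algebra A L] [IsScalarTower A K L] [Algebra Q L]
  [IsScalarTower Q K L] [Field L'] [Algebra K L'] [Algebra A L'] [IsScalarTower A K L']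
  [Algebra Q L'] [IsScalarTower Q K L'] [Algebra L L'] [IsScalarTower K L L']
  [IsIntegrallyClosedIn Fq A] [FaithfulSMul A K] {S : Set (FinPlace A K)}

instance (f : Ideal (IntRing A L)) : TopologicalSpace (ClassGroup E inf f) := ⊥

instance (f : Ideal (IntRing A L)) : DiscreteTopology (ClassGroup E inf f) := ⟨rfl⟩

instance : TopologicalSpace (SClassGroup E inf S L) :=
  inferInstanceAs (TopologicalSpace ↥(sClassSubmodule E inf S L))

instance : T2Space (SClassGroup E inf S L) :=
  inferInstanceAs (T2Space ↥(sClassSubmodule E inf S L))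

theorem SClassGroup.continuous_component (f : Moduli S L) :
    Continuous fun x : SClassGroup E inf S L => x.1 f :=
  (continuous_apply f).comp continuous_subtype_val

theorem continuous_limMap (T : TauMap Fq K L' L) (pull : Moduli S L → Moduli S L')
    (hT : ∀ f, T.MapsInto (pull f).1 f.1) (hmono : ∀ f g, f.1 ≤ g.1 → (pull f).1 ≤ (pull g).1) :
    Continuous (limMap E inf T pull hT hmono) := by
  refine Continuous.subtype_mk (continuous_pi fun f => ?_) _
  exact (continuous_of_discreteTopology (f := classMap E inf T (hT f))).comp
    (SClassGroup.continuous_component E (pull f))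

theorem continuous_traceMap : Continuous (traceMap L L' E inf S) := continuous_limMap E _ _ _ _

theorem continuous_galMap (σ : L ≃ₐ[K] L) : Continuous (galMap E inf S σ) :=
  continuous_limMap E _ _ _ _

instance : ContinuousAdd (SClassGroup E inf S L) := ⟨by
  refine Continuous.subtype_mk (continuous_pi fun f => ?_) _
  exact (continuous_of_discreteTopology (f := fun z : ClassGroup E inf f.1 × ClassGroup E inf f.1 =>
      z.1 + z.2)).comp
    (((SClassGroup.continuous_component E f).comp continuous_fst).prodMk
      ((SClassGroup.continuous_component E f).comp continuous_snd))⟩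

instance : IsTopologicalAddGroup (SClassGroup E inf S L) where
  continuous_neg := by
    refine Continuous.subtype_mk (continuous_pi fun f => ?_) _
    exact (continuous_of_discreteTopology (f := fun z : ClassGroup E inf f.1 => -z)).comp
      (SClassGroup.continuous_component E f)

instance [∀ f : Moduli S L, Finite (ClassGroup E inf f.1)] :
    CompactSpace (SClassGroup E inf S L) := by
  refine isCompact_iff_compactSpace.mp (IsClosed.isCompact (?_ :
    IsClosed {x : ∀ f : Moduli S L, ClassGroup E inf f.1 | ∀ (f g : Moduli S L) (h : f.1 ≤ g.1),
      classMap E inf (TauMap.id Fq K L) (mapsInto_id h) (x f) = x g}))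
  simp only [Set.ofPred_forall]
  exact isClosed_iInter fun f => isClosed_iInter fun g => isClosed_iInter fun h =>
    isClosed_eq (continuous_of_discreteTopology.comp (continuous_apply f)) (continuous_apply g)

/-- Any two moduli have a common refinement. -/
theorem exists_moduli_le [IsDomain (IntRing A L)] (f g : Moduli S L) :
    ∃ k : Moduli S L, k.1 ≤ f.1 ∧ k.1 ≤ g.1 := by
  have hle : f.1 * g.1 ≤ f.1 ⊓ g.1 := Ideal.mul_le_inf
  refine ⟨⟨f.1 * g.1, mul_ne_zero f.2.1 g.2.1, fun w hw => ?_⟩, hle.trans inf_le_left,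
    hle.trans inf_le_right⟩
  by_cases h : ∀ x ∈ f.1, w.1.valuation (x : L) < 1
  · exact f.2.2 w h
  · push Not at h
    obtain ⟨x, hx, h⟩ := h
    refine g.2.2 w fun y hy => ?_
    have h1 := hw _ (Ideal.mul_mem_mul hx hy)
    rw [MulMemClass.coe_mul, map_mul] at h1
    by_contra h2
    exact (one_le_mul_of_one_le_of_one_le h (not_lt.mp h2)).not_gt h1

variable (L) in
theorem nonempty_moduli [IsDomain (IntRing A L)] : Nonempty (Moduli S L) :=
  ⟨⟨⊤, top_ne_bot, fun w hw => by
    have h := hw 1 trivial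
    rw [OneMemClass.coe_one, map_one] at h
    exact (lt_irrefl _ h).elim⟩⟩

theorem SClassGroup.eq_of_le {x y : SClassGroup E inf S L} {f g : Moduli S L} (h : f.1 ≤ g.1)
    (hxy : x.1 f = y.1 f) : x.1 g = y.1 g := by
  rw [← x.2 f g h, ← y.2 f g h, hxy]

theorem galMap_one (x : SClassGroup E inf S L) : galMap E inf S (1 : L ≃ₐ[K] L) x = x :=
  Subtype.ext (funext fun f => x.2 (galModulus 1 f) f fun _ h => h)

theorem galMap_mul (σ τ : L ≃ₐ[K] L) (x : SClassGroup E inf S L) :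
    galMap E inf S (σ * τ) x = galMap E inf S σ (galMap E inf S τ x) :=
  Subtype.ext (funext fun f => (classMap_comp E inf (galTau Fq σ) (galTau Fq τ) (galTau Fq (σ * τ))
    (fun _ => rfl) _ _ _ _).symm)

/-- At a Galois-stable modulus the action can be computed on a single component, which links it to
the statements at finite level. -/
theorem galMap_apply_of_le (σ : L ≃ₐ[K] L) (x : SClassGroup E inf S L) (f : Moduli S L)
    (h : (galTau Fq σ).MapsInto f.1 f.1) (hf : f.1 ≤ (galModulus σ f).1) :
    (galMap E inf S σ x).1 f = classMap E inf (galTau Fq σ) h (x.1 f) := by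
  change classMap E inf (galTau Fq σ) _ (x.1 (galModulus σ f)) = _
  rw [← x.2 f _ hf]
  exact classMap_comp E inf _ _ _ (fun _ => rfl) _ _ _ _

theorem traceMap_galRes (σ : L' ≃ₐ[L] L') (x : SClassGroup E inf S L') :
    traceMap L L' E inf S (galMap E inf S (galRes K σ) x) = traceMap L L' E inf S x := by
  rw [traceMap_galMap E inf S (galRes K σ) (1 : L ≃ₐ[K] L) (fun y => σ.commutes y),
    galMap_one]

end Profinite

/-! ### Surjectivity and kernel of the trace on $H_S$. -/

section Limit

variable {Fq A Q K : Type*} [Field Fq] [Fintype Fq] [CommRing A] [Algebra Fq A] [Field Q]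
  [Algebra Fq Q] [Algebra A Q] [FaithfulSMul A Q] [IsScalarTower Fq A Q]
  [Field K] [Algebra Fq K] [Algebra A K] [IsScalarTower Fq A K] [Algebra Q K]
  [IsScalarTower A Q K] (E : DrinfeldModule Fq A K) (hQ : IsGlobalFunctionField Fq Q)
  {inf : ValuationSubring Q} (hinf : inf ≠ ⊤)
  (hA : Set.range (algebraMap A Q) = regularRing Fq inf)
  {L L' : Type*} [Field L] [Algebra K L] [Algebra A L] [IsScalarTower A K L] [Algebra Q L]
  [IsScalarTower Q K L] [Field L'] [Algebra K L'] [Algebra A L'] [IsScalarTower A K L']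
  [Algebra Q L'] [IsScalarTower Q K L'] [Algebra L L'] [IsScalarTower K L L']
  {S : Set (FinPlace A K)}

include hQ hinf hA in
-- The extended moduli are cofinal, so components at them determine an element of the limit. The
-- modulus is the contraction of `g`: it is nonzero by integrality, and its support is controlled by
-- lying over.
theorem exists_extModulus_le [FiniteDimensional Q K] [FiniteDimensional K L]
    [FiniteDimensional L L'] (g : Moduli S L') : ∃ f : Moduli S L, (extModulus L' f).1 ≤ g.1 := by
  haveI : IsScalarTower A L L' := IsScalarTower.of_algebraMap_eq fun a => by
    rw [IsScalarTower.algebraMap_apply A K L', IsScalarTower.algebraMap_apply A K L,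
      IsScalarTower.algebraMap_apply K L L']
  have : FiniteDimensional Q L := FiniteDimensional.trans Q K L
  have : FiniteDimensional K L' := FiniteDimensional.trans K L L'
  have : FiniteDimensional Q L' := FiniteDimensional.trans Q K L'
  have : IsScalarTower A Q L := IsScalarTower.of_algebraMap_eq fun a => by
    rw [IsScalarTower.algebraMap_apply A K L, IsScalarTower.algebraMap_apply A Q K,
      ← IsScalarTower.algebraMap_apply Q K L]
  have : IsScalarTower A Q L' := IsScalarTower.of_algebraMap_eq fun a => by
    rw [IsScalarTower.algebraMap_apply A K L', IsScalarTower.algebraMap_apply A Q K,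
      ← IsScalarTower.algebraMap_apply Q K L']
  obtain ⟨-, _, _, hL, hfin⟩ := intRing_structure hQ inf hinf A hA L
  obtain ⟨-, _, _, hL', -⟩ := intRing_structure hQ inf hinf A hA L'
  let j : IntRing A L →+* IntRing A L' :=
    ((IsScalarTower.toAlgHom K L L').restrictScalars A).mapIntegralClosure.toRingHom
  letI : Algebra (IntRing A L) (IntRing A L') := j.toAlgebra
  have : IsScalarTower A (IntRing A L) (IntRing A L') := IsScalarTower.of_algebraMap_eq fun a =>
    (AlgHom.commutes ((IsScalarTower.toAlgHom K L L').restrictScalars A).mapIntegralClosure a).symm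
  have : Algebra.IsIntegral (IntRing A L) (IntRing A L') := Algebra.IsIntegral.tower_top A
  refine ⟨⟨g.1.comap j, Ideal.IsIntegral.comap_ne_bot _ g.2.1, fun u hu => ?_⟩,
    Ideal.map_comap_le⟩
  have hle : g.1.comap (algebraMap (IntRing A L) (IntRing A L')) ≤ u.prime.asIdeal := by
    intro x hx
    rw [FinPlace.mem_prime]
    exact hu x hx
  -- A prime over `u` that contains `g` gives a place in the support of `g`, which therefore lies
  -- above `S`.
  obtain ⟨P, hP, hP1, hP2⟩ := Ideal.exists_ideal_over_prime_of_isIntegral u.prime.asIdeal g.1 hle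
  have hPbot : P ≠ ⊥ := fun h => g.2.1 (le_bot_iff.mp (h ▸ hP))
  obtain ⟨w, hw⟩ := FinPlace.exists_prime_eq ⟨P, hP1, hPbot⟩
  have hwP : w.prime.asIdeal = P := congrArg IsDedekindDomain.HeightOneSpectrum.asIdeal hw
  obtain ⟨v, hv, h⟩ := g.2.2 w fun x hx => by
    rw [← FinPlace.mem_prime, hwP]
    exact hP hx
  have hne : w.1.comap (algebraMap L L') ≠ ⊤ := by
    intro htop
    obtain ⟨x, hx, hx0⟩ := Submodule.exists_mem_ne_zero_of_ne_bot u.prime.ne_bot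
    rw [← hP2, Ideal.mem_comap, ← hwP, FinPlace.mem_prime, valuation_lt_one_iff] at hx
    have hx' : ((algebraMap (IntRing A L) (IntRing A L') x : IntRing A L') : L') =
      algebraMap L L' (x : L) := rfl
    rw [hx'] at hx
    rcases hx with hx | hx
    · exact hx0 (Subtype.ext ((map_eq_zero _).mp hx))
    · rw [← map_inv₀] at hx
      exact hx (ValuationSubring.mem_comap.mp (htop ▸ ValuationSubring.mem_top _))
  let u' : FinPlace A L := ⟨w.1.comap (algebraMap L L'), hne, fun a => by
    rw [ValuationSubring.mem_comap, ← IsScalarTower.algebraMap_apply A L L']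
    exact w.2.2 a⟩
  have huu : u' = u := by
    refine FinPlace.prime_injective (IsDedekindDomain.HeightOneSpectrum.ext ?_)
    ext x
    rw [← hP2, Ideal.mem_comap, ← hwP, FinPlace.mem_prime, FinPlace.mem_prime, valuation_lt_one_iff,
      valuation_lt_one_iff, ValuationSubring.mem_comap]
    have hx' : ((algebraMap (IntRing A L) (IntRing A L') x : IntRing A L') : L') =
      algebraMap L L' (x : L) := rfl
    rw [hx', map_inv₀, map_eq_zero]
  refine ⟨v, hv, h.trans ?_⟩
  rw [← huu]
  change _ = (w.1.comap (algebraMap L L')).comap (algebraMap K L)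
  rw [ValuationSubring.comap_comap, ← IsScalarTower.algebraMap_eq]

variable [IsIntegrallyClosedIn Fq A] [FaithfulSMul A K]

variable (L S) in
include hQ hinf hA in
theorem compactSpace_sClassGroup [FiniteDimensional Q K] [FiniteDimensional K L] :
    CompactSpace (SClassGroup E inf S L) := by
  have : ∀ f : Moduli S L, Finite (ClassGroup E inf f.1) := fun f =>
    finite_classGroup E hQ hinf hA f.2.1
  infer_instance

variable (A) in
include hQ hinf hA in
theorem isDedekindDomain_intRing [FiniteDimensional Q K] [FiniteDimensional K L] :
    IsDedekindDomain (IntRing A L) := by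
  have : FiniteDimensional Q L := FiniteDimensional.trans Q K L
  have : IsScalarTower A Q L := IsScalarTower.of_algebraMap_eq fun a => by
    rw [IsScalarTower.algebraMap_apply A K L, IsScalarTower.algebraMap_apply A Q K,
      ← IsScalarTower.algebraMap_apply Q K L]
  exact (intRing_structure hQ inf hinf A hA L).2.1

include hQ hinf hA in
-- The class groups are finite, and the transition maps between them are surjective since
-- representatives at infinity do not depend on the modulus.
theorem SClassGroup.component_surjective [FiniteDimensional Q K] [FiniteDimensional K L]
    (f : Moduli S L) : Function.Surjective fun x : SClassGroup E inf S L => x.1 f := by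
  have := isDedekindDomain_intRing A hQ hinf hA (K := K) (L := L)
  have : ∀ f : Moduli S L, Finite (ClassGroup E inf f.1) := fun f =>
    finite_classGroup E hQ hinf hA f.2.1
  intro z
  obtain ⟨x, hx, h⟩ := exists_compatible (r := fun f g : Moduli S L => f.1 ≤ g.1)
    (fun _ _ _ => le_trans) exists_moduli_le
    (fun f g h => classMap E inf (TauMap.id Fq K L) (mapsInto_id h))
    (fun _ _ _ => continuous_of_discreteTopology)
    (fun f g h => classMap_id_surjective E hQ hinf hA g.2.1 (mapsInto_id h))
    (fun _ _ _ _ _ _ x => classMap_comp E inf _ _ _ (fun _ => rfl) _ _ _ x) f z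
  exact ⟨⟨x, h⟩, hx⟩

include hQ hinf hA in
theorem traceMap_surjective [FiniteDimensional Q K] [FiniteDimensional K L]
    [FiniteDimensional L L'] [IsGalois L L'] :
    Function.Surjective (traceMap L L' E inf S) := by
  have : FiniteDimensional K L' := FiniteDimensional.trans K L L'
  have := isDedekindDomain_intRing A hQ hinf hA (K := K) (L := L)
  have := nonempty_moduli (S := S) L
  have := compactSpace_sClassGroup E hQ hinf hA L' S
  intro x
  refine exists_eq_of_forall_exists (traceMap L L' E inf S)
    (fun (f : Moduli S L) (x : SClassGroup E inf S L) => x.1 f)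
    (fun f => (SClassGroup.continuous_component E f).comp (continuous_traceMap E))
    (fun f g => ?_) (fun u v h => Subtype.ext (funext h)) (fun f => ?_)
  · obtain ⟨k, hf, hg⟩ := exists_moduli_le f g
    exact ⟨k, fun u v h => ⟨SClassGroup.eq_of_le E hf h, SClassGroup.eq_of_le E hg h⟩⟩
  · obtain ⟨z, hz⟩ := classMap_traceTau_surjective E hQ hinf hA f.2.1
      (traceTau_mapsInto (Fq := Fq) (K := K) L' f.1) (x.1 f)
    obtain ⟨y, hy⟩ := SClassGroup.component_surjective E hQ hinf hA (extModulus L' f) z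
    refine ⟨y, ?_⟩
    change classMap E inf (traceTau Fq K L L') _ (y.1 (extModulus L' f)) = _
    rw [← hz]
    exact congrArg _ hy

include hQ hinf hA in
-- By compactness it suffices to solve the equation at each modulus $\mathfrak f\mathcal O_{L'}$,
-- where the description of the kernel at finite level applies.
theorem exists_sum_of_traceMap_eq_zero [FiniteDimensional Q K] [FiniteDimensional K L]
    [FiniteDimensional L L'] [IsGalois L L'] {p : ℕ} [Fact p.Prime] [CharP Fq p]
    (htame : IsTameOutside p S L L') {x : SClassGroup E inf S L'}
    (hx : traceMap L L' E inf S x = 0) : ∃ y : (L' ≃ₐ[L] L') → SClassGroup E inf S L',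
      ∑ σ, (galMap E inf S (galRes K σ) (y σ) - y σ) = x := by
  have : FiniteDimensional K L' := FiniteDimensional.trans K L L'
  have : FiniteDimensional Q L := FiniteDimensional.trans Q K L
  have : IsScalarTower A Q L := IsScalarTower.of_algebraMap_eq fun a => by
    rw [IsScalarTower.algebraMap_apply A K L, IsScalarTower.algebraMap_apply A Q K,
      ← IsScalarTower.algebraMap_apply Q K L]
  obtain ⟨-, _, _, -, -⟩ := intRing_structure hQ inf hinf A hA L
  have hne0 := fun f : Moduli S L => traceIdeal_ne_bot (K := K) (A := A) L' f.2.1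
  have := nonempty_moduli (S := S) L
  have := compactSpace_sClassGroup E hQ hinf hA L' S
  refine exists_eq_of_forall_exists
    (fun y : (L' ≃ₐ[L] L') → SClassGroup E inf S L' =>
      ∑ σ, (galMap E inf S (galRes K σ) (y σ) - y σ))
    (fun (f : Moduli S L) (x : SClassGroup E inf S L') => x.1 (extModulus L' f))
    (fun f => (SClassGroup.continuous_component E _).comp (continuous_finsetSum _ fun σ _ =>
      ((continuous_galMap E _).comp (continuous_apply σ)).sub (continuous_apply σ)))
    (fun f g => ?_) (fun u v h => Subtype.ext (funext fun g => ?_)) (fun f => ?_)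
  · obtain ⟨k, hf, hg⟩ := exists_moduli_le f g
    exact ⟨k, fun u v h => ⟨SClassGroup.eq_of_le E (Ideal.map_mono hf) h,
      SClassGroup.eq_of_le E (Ideal.map_mono hg) h⟩⟩
  · obtain ⟨f, hf⟩ := exists_extModulus_le (L := L) hQ hinf hA g
    exact SClassGroup.eq_of_le E hf (h f)
  · have hle : ∀ σ : L' ≃ₐ[L] L',
        (extModulus L' f).1 ≤ (galModulus (galRes K σ) (extModulus L' f)).1 := fun σ =>
      extModulus_galModulus_le (galRes K σ) (1 : L ≃ₐ[K] L) (fun y => σ.commutes y) f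
    have hσ : ∀ σ : L' ≃ₐ[L] L', (galTau Fq (galRes K σ)).MapsInto (extModulus L' f).1
        (extModulus L' f).1 := fun σ x hx =>
      ⟨((galRes K σ).restrictScalars A).mapIntegralClosure x, hle σ hx, rfl⟩
    -- Tameness makes the finer modulus `g` admissible in the limit defining $H_S$ over `L`.
    let g : Moduli S L := ⟨traceIdeal K L (extModulus L' f).1, hne0 f,
      supported_traceIdeal hQ hinf hA htame f.2.2⟩
    have hgf : g.1 ≤ f.1 := traceIdeal_extIdeal_le Fq f.1
    -- The trace from modulus $\mathfrak f\mathcal O_{L'}$ to `g` is evaluated by passing through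
    -- $\mathfrak g\mathcal O_{L'}$, where it is the component at `g` of the trace of `x`.
    have h0 : classMap E inf (traceTau Fq K L L') (traceTau_mapsInto_traceIdeal (extModulus L' f).1)
        (x.1 (extModulus L' f)) = 0 := by
      rw [← x.2 (extModulus L' g) (extModulus L' f) (Ideal.map_mono hgf)]
      refine (classMap_comp E inf _ _ _ (fun _ => rfl) _ _ (traceTau_mapsInto L' g.1) _).trans ?_
      exact congrArg (fun x : SClassGroup E inf S L => x.1 g) hx
    obtain ⟨y, hy⟩ := exists_sum_of_classMap_traceTau_eq_zero E hQ hinf hA (extModulus L' f).2.1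
      g.2.1 hσ h0
    choose Y hY using fun σ =>
      SClassGroup.component_surjective E hQ hinf hA (extModulus L' f) (y σ)
    refine ⟨Y, ?_⟩
    have hadd : ∀ F : (L' ≃ₐ[L] L') → SClassGroup E inf S L',
        (∑ σ, F σ).1 (extModulus L' f) = ∑ σ, (F σ).1 (extModulus L' f) := fun F =>
      map_sum ((LinearMap.proj (extModulus L' f)).comp (sClassSubmodule E inf S L').subtype) F _
    rw [hadd, hy]
    refine Finset.sum_congr rfl fun σ _ => ?_
    change (galMap E inf S (galRes K σ) (Y σ)).1 (extModulus L' f) - (Y σ).1 (extModulus L' f) = _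
    rw [galMap_apply_of_le E _ _ _ (hσ σ) (hle σ)]
    exact congrArg (fun z => classMap E inf (galTau Fq (galRes K σ)) (hσ σ) z - z) (hY σ)

end Limit

/-! ### Layers of `ℤ_p`-extensions -/

section Layers

/-- Membership in the ring replaces equality of values, since a valuation ring and its restriction
have different value groups. -/
theorem valuation_eq_iff {F : Type*} [Field F] (v : ValuationSubring F) {x y : F} (hx : x ≠ 0)
    (hy : y ≠ 0) : v.valuation x = v.valuation y ↔ x / y ∈ v ∧ y / x ∈ v := by
  rw [← ValuationSubring.valuation_le_one_iff, ← ValuationSubring.valuation_le_one_iff,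
    map_div₀, map_div₀, div_le_one₀ (zero_lt_iff.mpr ((Valuation.ne_zero_iff _).mpr hy)),
    div_le_one₀ (zero_lt_iff.mpr ((Valuation.ne_zero_iff _).mpr hx)), le_antisymm_iff]

theorem comap_valuation_eq_iff {F F' : Type*} [Field F] [Field F'] (f : F →+* F')
    (v : ValuationSubring F') {x y : F} (hx : x ≠ 0) (hy : y ≠ 0) :
    (v.comap f).valuation x = (v.comap f).valuation y ↔
      v.valuation (f x) = v.valuation (f y) := by
  rw [valuation_eq_iff _ hx hy, valuation_eq_iff _ ((map_ne_zero f).mpr hx)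
    ((map_ne_zero f).mpr hy), ValuationSubring.mem_comap, ValuationSubring.mem_comap, map_div₀,
    map_div₀]

/-- If the places of `M` above `v` are unramified over `K`, then so are the places above `v` of every
intermediate extension `L'/L`. -/
theorem ramIdx_eq_one_of_tower {K L L' M : Type*} [Field K] [Field L] [Field L'] [Field M]
    [Algebra K L] [Algebra K L'] [Algebra K M] [Algebra L L'] [Algebra L' M] [IsScalarTower K L L']
    [IsScalarTower K L' M] (w : ValuationSubring L')
    (h : ∀ W : ValuationSubring M, W.comap (algebraMap K M) = w.comap (algebraMap K L') →
      ramIdx K W = 1) : ramIdx L w = 1 := by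
  obtain ⟨W, hW⟩ := exists_comap_eq (M := M) w
  have h1 := h W (by
    rw [← hW, ValuationSubring.comap_comap, ← IsScalarTower.algebraMap_eq])
  refine ramIdx_eq_one_of w fun x hx => ?_
  -- Every value of `W` is already attained on `K`, hence so is every value of `w`, and a fortiori
  -- on `L`.
  obtain ⟨y, hy⟩ := exists_valuation_eq_of_ramIdx_eq_one W h1 ((map_ne_zero (algebraMap L' M)).mpr hx)
  have hy0 : y ≠ 0 := by
    rintro rfl
    rw [map_zero, map_zero, Valuation.zero_iff, map_eq_zero] at hy
    exact hx hy
  refine ⟨algebraMap K L y, ?_⟩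
  rw [← IsScalarTower.algebraMap_apply, ← hW, comap_valuation_eq_iff _ _ hx
    ((map_ne_zero _).mpr hy0), hy, ← IsScalarTower.algebraMap_apply]

/-- The place of `K` below a finite place of an algebraic extension of `K`. -/
def FinPlace.below {A : Type*} (K : Type*) {L : Type*} [CommRing A] [Field K] [Field L] [Algebra A K]
    [Algebra K L] [Algebra A L] [IsScalarTower A K L] [Algebra.IsAlgebraic K L]
    (w : FinPlace A L) : FinPlace A K :=
  ⟨w.1.comap (algebraMap K L), fun h => w.2.1 (eq_top_iff.mpr fun x _ =>
    mem_of_isIntegral (R := K) w.1 (fun a => by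
      rw [← ValuationSubring.mem_comap, h]
      exact ValuationSubring.mem_top a) (Algebra.IsIntegral.isIntegral x)), fun a => by
    rw [ValuationSubring.mem_comap, ← IsScalarTower.algebraMap_apply]
    exact w.2.2 a⟩

variable {K M : Type*} [Field K] [Field M] [Algebra K M] {p : ℕ}

theorem layerAut_eq_one {σ : M ≃ₐ[K] M} {n : ℕ} (hσ : σ ∈ gammaPow K p M n) :
    layerAut p σ n = 1 := by
  ext x
  exact (IntermediateField.mem_fixedField_iff _ _).mp x.2 σ hσ

variable [Fact p.Prime] (e : (M ≃ₐ[K] M) ≃ₜ* Multiplicative ℤ_[p])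

/-- A topological generator of `Γ^(p^n)`. -/
def gammaGen (n : ℕ) : M ≃ₐ[K] M := (e.symm (Multiplicative.ofAdd 1)) ^ p ^ n

theorem gammaGen_mem (n : ℕ) : gammaGen e n ∈ gammaPow K p M n :=
  Subgroup.subset_closure ⟨_, rfl⟩

/-- The stabilizer of `x` is open, hence closed. It contains $\gamma^{kp^n}$ for all natural `k`,
and these are dense in the $p^n$-th powers because the natural numbers are dense in $\mathbb Z_p$.
-/
theorem mem_layer_of_gammaGen_apply [Algebra.IsAlgebraic K M] {n : ℕ} {x : M}
    (hx : gammaGen e n x = x) : x ∈ layer K p M n := by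
  rw [mem_layer_iff]
  have hcl : IsClosed {z : ℤ_[p] |
      (e.symm (Multiplicative.ofAdd z)) ^ p ^ n ∈ MulAction.stabilizer (M ≃ₐ[K] M) x} :=
    ((MulAction.stabilizer (M ≃ₐ[K] M) x).isClosed_of_isOpen
      (stabilizer_isOpen_of_isIntegral (K := K) x)).preimage
      ((e.symm.continuous.comp continuous_ofAdd).pow _)
  have huniv : ∀ z : ℤ_[p],
      (e.symm (Multiplicative.ofAdd z)) ^ p ^ n ∈ MulAction.stabilizer (M ≃ₐ[K] M) x := by
    intro z
    refine PadicInt.denseRange_natCast.induction_on z hcl fun k => ?_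
    rw [show Multiplicative.ofAdd ((k : ℕ) : ℤ_[p]) = Multiplicative.ofAdd (1 : ℤ_[p]) ^ k by
      rw [← ofAdd_nsmul, nsmul_one], map_pow, ← pow_mul, mul_comm, pow_mul]
    exact pow_mem (show gammaGen e n ∈ MulAction.stabilizer (M ≃ₐ[K] M) x from hx) k
  intro g
  have h := huniv (Multiplicative.toAdd (e g))
  rw [ofAdd_toAdd, ContinuousMulEquiv.symm_apply_apply] at h
  exact h

include e in
-- The subgroup contains the preimage of the open ball $p^n\mathbb Z_p$. This makes the layers
-- finite over `K`.
theorem isOpen_gammaPow (n : ℕ) : IsOpen (gammaPow K p M n : Set (M ≃ₐ[K] M)) := by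
  have h : e ⁻¹' {z | ‖(Multiplicative.toAdd z : ℤ_[p])‖ ≤ (p : ℝ) ^ (-n : ℤ)} ⊆
      gammaPow K p M n := by
    intro g hg
    obtain ⟨z, hz⟩ := Ideal.mem_span_singleton.mp ((PadicInt.norm_le_pow_iff_mem_span_pow _ _).mp hg)
    refine Subgroup.subset_closure ⟨e.symm (Multiplicative.ofAdd z), ?_⟩
    apply e.injective
    beta_reduce
    rw [map_pow, ContinuousMulEquiv.apply_symm_apply, ← ofAdd_nsmul, nsmul_eq_mul, Nat.cast_pow, ← hz,
      ofAdd_toAdd]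
  refine Subgroup.isOpen_of_mem_nhds (g := 1) _ (Filter.mem_of_superset (IsOpen.mem_nhds ?_ ?_) h)
  · refine IsOpen.preimage e.continuous (IsOpen.preimage continuous_toAdd
      (?_ : IsOpen {z : ℤ_[p] | ‖z‖ ≤ (p : ℝ) ^ (-n : ℤ)}))
    have := IsUltrametricDist.isOpen_closedBall (0 : ℤ_[p]) (r := (p : ℝ) ^ (-n : ℤ))
      (zpow_ne_zero _ (Nat.cast_ne_zero.mpr (Fact.out : p.Prime).ne_zero))
    convert this using 1
    ext z
    simp
  · change ‖Multiplicative.toAdd (e 1)‖ ≤ (p : ℝ) ^ (-n : ℤ)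
    rw [map_one, toAdd_one, norm_zero]
    positivity

include e in
theorem finiteDimensional_layer [IsGalois K M] (n : ℕ) : FiniteDimensional K (layer K p M n) := by
  rw [← InfiniteGalois.isOpen_iff_finite]
  refine Subgroup.isOpen_mono (fun σ hσ x => ?_) (isOpen_gammaPow e n)
  exact (IntermediateField.mem_fixedField_iff _ _).mp x.2 σ hσ

variable (K p M) in
theorem isGalois_layer [IsGalois K M] (n : ℕ) : IsGalois K (layer K p M n) := by
  have : Normal K (layer K p M n) := by
    rw [IntermediateField.normal_iff_forall_map_le']
    rintro σ _ ⟨x, hx, rfl⟩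
    exact apply_mem_layer p σ n hx
  constructor

/-- By the Galois correspondence: elements of $K_m$ fixed by the generator lie in $K_n$ and hence
are fixed by `τ`. So the group of $K_m/K_n$ is cyclic. -/
theorem mem_zpowers_layerAut [IsGalois K M] {n m : ℕ} (τ : layer K p M m ≃ₐ[K] layer K p M m)
    (hτ : ∀ x : layer K p M m, (x : M) ∈ layer K p M n → τ x = x) :
    τ ∈ Subgroup.zpowers (layerAut p (gammaGen e n) m) := by
  have := finiteDimensional_layer e m
  rw [← IntermediateField.fixingSubgroup_fixedField
    (Subgroup.zpowers (layerAut p (gammaGen e n) m))]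
  intro x
  refine hτ x (mem_layer_of_gammaGen_apply e ?_)
  exact congrArg Subtype.val ((IntermediateField.mem_fixedField_iff _ _).mp x.2 _
    (Subgroup.mem_zpowers _))

end Layers

/-! ### Transitivity of the trace maps -/

section Transitivity

variable {Fq A Q K : Type*} [Field Fq] [Fintype Fq] [CommRing A] [Algebra Fq A] [Field Q]
  [Field K] [Algebra Fq K] [Algebra A K] [IsScalarTower Fq A K] [Algebra Q K]
  (E : DrinfeldModule Fq A K) {inf : ValuationSubring Q}
  {L L' L'' : Type*} [Field L] [Algebra K L] [Algebra A L] [IsScalarTower A K L] [Algebra Q L]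
  [IsScalarTower Q K L] [Field L'] [Algebra K L'] [Algebra A L'] [IsScalarTower A K L']
  [Algebra Q L'] [IsScalarTower Q K L'] [Algebra L L'] [IsScalarTower K L L']
  [Field L''] [Algebra K L''] [Algebra A L''] [IsScalarTower A K L''] [Algebra Q L'']
  [IsScalarTower Q K L''] [Algebra L L''] [IsScalarTower K L L'']
  [Algebra L' L''] [IsScalarTower K L' L''] [IsScalarTower L L' L'']
  [IsIntegrallyClosedIn Fq A] [FaithfulSMul A K] {S : Set (FinPlace A K)}

/-- This inclusion suffices to compare the iterated trace with the direct one, both computed from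
the smaller modulus. -/
theorem extIdeal_extIdeal_le (f : Ideal (IntRing A L)) :
    extIdeal (K := K) L'' (extIdeal (K := K) L' f) ≤ extIdeal (K := K) L'' f := by
  refine Ideal.map_le_iff_le_comap.mpr (Ideal.map_le_iff_le_comap.mpr fun x hx => ?_)
  have h := Ideal.mem_map_of_mem
    ((IsScalarTower.toAlgHom K L L'').restrictScalars A).mapIntegralClosure hx
  have h2 : ((IsScalarTower.toAlgHom K L L'').restrictScalars A).mapIntegralClosure x =
      ((IsScalarTower.toAlgHom K L' L'').restrictScalars A).mapIntegralClosure
        (((IsScalarTower.toAlgHom K L L').restrictScalars A).mapIntegralClosure x) :=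
    Subtype.ext (IsScalarTower.algebraMap_apply L L' L'' (x : L))
  rw [h2] at h
  exact h

theorem traceMap_traceMap [FiniteDimensional L L'] [FiniteDimensional L' L'']
    (x : SClassGroup E inf S L'') :
    traceMap L L' E inf S (traceMap L' L'' E inf S x) = traceMap L L'' E inf S x := by
  refine Subtype.ext (funext fun f => ?_)
  have hle : (extModulus L'' (extModulus L' f)).1 ≤ (extModulus L'' f).1 :=
    extIdeal_extIdeal_le f.1
  have htr : ∀ y : L'', (traceTau Fq K L L'').toLinearMap y =
      (traceTau Fq K L L').toLinearMap ((traceTau Fq K L' L'').toLinearMap y) := fun y =>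
    (Algebra.trace_trace y).symm
  have h3 : (traceTau Fq K L L'').MapsInto (extModulus L'' (extModulus L' f)).1 f.1 :=
    fun y hy => traceTau_mapsInto L'' f.1 y (hle hy)
  have e1 := classMap_comp E inf (traceTau Fq K L L') (traceTau Fq K L' L'') (traceTau Fq K L L'')
    htr (traceTau_mapsInto L' f.1) (traceTau_mapsInto L'' (extModulus L' f).1) h3
    (x.1 (extModulus L'' (extModulus L' f)))
  have e2 := classMap_comp E inf (traceTau Fq K L L'') (TauMap.id Fq K L'') (traceTau Fq K L L'')
    (fun _ => rfl) (traceTau_mapsInto L'' f.1) (mapsInto_id hle) h3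
    (x.1 (extModulus L'' (extModulus L' f)))
  have e3 := x.2 (extModulus L'' (extModulus L' f)) (extModulus L'' f) hle
  exact e1.trans (e2.symm.trans (congrArg _ e3))

end Transitivity

/-! ### The augmentation for a cyclic group of automorphisms. -/

section Generator

variable {Fq A Q K : Type*} [Field Fq] [Fintype Fq] [CommRing A] [Algebra Fq A] [Field Q]
  [Field K] [Algebra Fq K] [Algebra A K] [IsScalarTower Fq A K] [Algebra Q K]
  (E : DrinfeldModule Fq A K) {inf : ValuationSubring Q}
  {L : Type*} [Field L] [Algebra K L] [Algebra A L] [IsScalarTower A K L] [Algebra Q L]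
  [IsScalarTower Q K L] [IsIntegrallyClosedIn Fq A] [FaithfulSMul A K] {S : Set (FinPlace A K)}

/-- For $\sigma$ a power of $\tau$, the element $\sigma-1$ of the group ring is a multiple of
$\tau-1$. This replaces sums over a cyclic Galois group by one difference. -/
theorem exists_galMap_sub_eq {τ σ : L ≃ₐ[K] L} (hσ : σ ∈ Subgroup.zpowers τ)
    (x : SClassGroup E inf S L) : ∃ y, galMap E inf S τ y - y = galMap E inf S σ x - x := by
  rw [Subgroup.zpowers_eq_closure] at hσ
  induction hσ using Subgroup.closure_induction generalizing x with
  | mem σ h => rw [Set.mem_singleton_iff.mp h]; exact ⟨x, rfl⟩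
  | one => exact ⟨0, by rw [map_zero, galMap_one, sub_self, sub_self]⟩
  | mul σ σ' _ _ h h' =>
    obtain ⟨y, hy⟩ := h (galMap E inf S σ' x)
    obtain ⟨y', hy'⟩ := h' x
    refine ⟨y + y', ?_⟩
    rw [galMap_mul, map_add, add_sub_add_comm, hy, hy', sub_add_sub_cancel]
  | inv σ _ h =>
    obtain ⟨y, hy⟩ := h (galMap E inf S σ⁻¹ x)
    refine ⟨-y, ?_⟩
    rw [← galMap_mul, mul_inv_cancel, galMap_one] at hy
    rw [map_neg, neg_sub_neg, ← neg_sub, hy, neg_sub]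

end Generator

/-! ### Iwasawa modules -/

section Iwasawa

variable {Fq A Q K : Type*} [Field Fq] [Fintype Fq] [CommRing A] [Algebra Fq A] [Field Q]
  [Algebra Fq Q] [Algebra A Q] [FaithfulSMul A Q] [IsScalarTower Fq A Q]
  [Field K] [Algebra Fq K] [Algebra A K] [IsScalarTower Fq A K] [Algebra Q K]
  [IsScalarTower A Q K] (E : DrinfeldModule Fq A K) (hQ : IsGlobalFunctionField Fq Q)
  {inf : ValuationSubring Q} (hinf : inf ≠ ⊤)
  (hA : Set.range (algebraMap A Q) = regularRing Fq inf)
  {S : Set (FinPlace A K)} [IsIntegrallyClosedIn Fq A] [FaithfulSMul A K]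
  {p : ℕ} [Fact p.Prime]
  {M : Type*} [Field M] [Algebra K M] [Algebra A M] [IsScalarTower A K M] [Algebra Q M]
  [IsScalarTower Q K M] [IsGalois K M]
  (e : (M ≃ₐ[K] M) ≃ₜ* Multiplicative ℤ_[p])

theorem continuous_layerTrace {n m : ℕ} (h : n ≤ m) :
    Continuous (layerTrace E inf S p M h) :=
  letI : Algebra (layer K p M n) (layer K p M m) :=
    (IntermediateField.inclusion (layer_mono p M h)).toAlgebra
  haveI : IsScalarTower K (layer K p M n) (layer K p M m) :=
    IsScalarTower.of_algebraMap_eq fun _ => rfl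
  continuous_traceMap E

include e in
theorem layerTrace_layerTrace {n m k : ℕ} (hnm : n ≤ m) (hmk : m ≤ k) (hnk : n ≤ k)
    (x : SClassGroup E inf S (layer K p M k)) :
    layerTrace E inf S p M hnm (layerTrace E inf S p M hmk x) = layerTrace E inf S p M hnk x := by
  have := finiteDimensional_layer e m
  have := finiteDimensional_layer e k
  letI : Algebra (layer K p M n) (layer K p M m) :=
    (IntermediateField.inclusion (layer_mono p M hnm)).toAlgebra
  haveI : IsScalarTower K (layer K p M n) (layer K p M m) :=
    IsScalarTower.of_algebraMap_eq fun _ => rfl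
  letI : Algebra (layer K p M m) (layer K p M k) :=
    (IntermediateField.inclusion (layer_mono p M hmk)).toAlgebra
  haveI : IsScalarTower K (layer K p M m) (layer K p M k) :=
    IsScalarTower.of_algebraMap_eq fun _ => rfl
  letI : Algebra (layer K p M n) (layer K p M k) :=
    (IntermediateField.inclusion (layer_mono p M hnk)).toAlgebra
  haveI : IsScalarTower K (layer K p M n) (layer K p M k) :=
    IsScalarTower.of_algebraMap_eq fun _ => rfl
  haveI : IsScalarTower (layer K p M n) (layer K p M m) (layer K p M k) :=
    IsScalarTower.of_algebraMap_eq fun _ => rfl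
  haveI : FiniteDimensional (layer K p M n) (layer K p M m) := FiniteDimensional.right K _ _
  haveI : FiniteDimensional (layer K p M m) (layer K p M k) := FiniteDimensional.right K _ _
  exact traceMap_traceMap E x

include e hQ hinf hA in
theorem layerTrace_surjective [FiniteDimensional Q K] {n m : ℕ} (h : n ≤ m) :
    Function.Surjective (layerTrace E inf S p M h) := by
  have := finiteDimensional_layer e n
  have := finiteDimensional_layer e m
  letI : Algebra (layer K p M n) (layer K p M m) :=
    (IntermediateField.inclusion (layer_mono p M h)).toAlgebra
  haveI : IsScalarTower K (layer K p M n) (layer K p M m) :=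
    IsScalarTower.of_algebraMap_eq fun _ => rfl
  haveI : FiniteDimensional (layer K p M n) (layer K p M m) := FiniteDimensional.right K _ _
  haveI := isGalois_layer K M p m
  haveI : IsGalois (layer K p M n) (layer K p M m) := IsGalois.tower_top_of_isGalois K _ _
  exact traceMap_surjective E hQ hinf hA

include hQ hinf hA in
-- Layers are unramified, hence tame, outside `S`, so the trace kernel consists of sums of
-- differences; cyclicity collapses such a sum to a single one.
theorem exists_galMap_sub_of_layerTrace_eq_zero [CharP Fq p] [FiniteDimensional Q K]
    (hS : ∀ v : FinPlace A K, IsRamifiedAt M v.1 → v ∈ S) {n m : ℕ} (h : n ≤ m)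
    {x : SClassGroup E inf S (layer K p M m)} (hx : layerTrace E inf S p M h x = 0) :
    ∃ y, galMap E inf S (layerAut p (gammaGen e n) m) y - y = x := by
  have := finiteDimensional_layer e n
  have := finiteDimensional_layer e m
  letI : Algebra (layer K p M n) (layer K p M m) :=
    (IntermediateField.inclusion (layer_mono p M h)).toAlgebra
  haveI : IsScalarTower K (layer K p M n) (layer K p M m) :=
    IsScalarTower.of_algebraMap_eq fun _ => rfl
  haveI : FiniteDimensional (layer K p M n) (layer K p M m) := FiniteDimensional.right K _ _
  haveI := isGalois_layer K M p m
  haveI : IsGalois (layer K p M n) (layer K p M m) := IsGalois.tower_top_of_isGalois K _ _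
  have htame : IsTameOutside p S (layer K p M n) (layer K p M m) := by
    intro w hw
    rw [ramIdx_eq_one_of_tower (K := K) (M := M) w.1 fun W hW => ?_]
    · exact (Fact.out : p.Prime).one_lt.ne' ∘ Nat.dvd_one.mp
    · by_contra hne
      exact hw ⟨w.below K, hS _ ⟨W, hW, hne⟩, rfl⟩
  obtain ⟨y, hy⟩ := exists_sum_of_traceMap_eq_zero E hQ hinf hA htame hx
  choose z hz using fun σ => exists_galMap_sub_eq E
    (mem_zpowers_layerAut e (n := n) (galRes K σ) fun a ha => σ.commutes ⟨a, ha⟩) (y σ)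
  refine ⟨∑ σ, z σ, ?_⟩
  rw [map_sum, ← Finset.sum_sub_distrib, ← hy]
  exact Finset.sum_congr rfl fun σ _ => hz σ

instance : TopologicalSpace (IwasawaModule E inf S p M) :=
  inferInstanceAs (TopologicalSpace ↥(iwasawaSubmodule E inf S p M))

theorem IwasawaModule.continuous_component (n : ℕ) :
    Continuous fun x : IwasawaModule E inf S p M => x.1 n :=
  (continuous_apply n).comp continuous_subtype_val

include e hQ hinf hA in
theorem compactSpace_iwasawaModule [FiniteDimensional Q K] :
    CompactSpace (IwasawaModule E inf S p M) := by
  have := finiteDimensional_layer e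
  have := fun n => compactSpace_sClassGroup E hQ hinf hA (layer K p M n) S
  refine isCompact_iff_compactSpace.mp (IsClosed.isCompact (?_ :
    IsClosed {x : ∀ n : ℕ, SClassGroup E inf S (layer K p M n) | ∀ (n m : ℕ) (h : n ≤ m),
      layerTrace E inf S p M h (x m) = x n}))
  simp only [Set.ofPred_forall]
  exact isClosed_iInter fun n => isClosed_iInter fun m => isClosed_iInter fun h =>
    isClosed_eq ((continuous_layerTrace E h).comp (continuous_apply m)) (continuous_apply n)

include e hQ hinf hA in
theorem IwasawaModule.component_surjective [FiniteDimensional Q K] (n : ℕ) :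
    Function.Surjective fun x : IwasawaModule E inf S p M => x.1 n := by
  have := finiteDimensional_layer e
  have := fun n => compactSpace_sClassGroup E hQ hinf hA (layer K p M n) S
  intro z
  obtain ⟨x, hx, h⟩ := exists_compatible (r := fun m n : ℕ => n ≤ m)
    (fun _ _ _ h h' => le_trans h' h) (fun i j => ⟨max i j, le_max_left _ _, le_max_right _ _⟩)
    (fun m n h => layerTrace E inf S p M h) (fun _ _ h => continuous_layerTrace E h)
    (fun _ _ h => layerTrace_surjective E hQ hinf hA e h)
    (fun _ _ _ h h' h'' x => layerTrace_layerTrace E e h' h h'' x) n z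
  exact ⟨⟨x, fun n m h' => h m n h'⟩, hx⟩

include hQ hinf hA in
theorem exists_iwasawaGal_sub_of_component_eq_zero [CharP Fq p] [FiniteDimensional Q K]
    (hS : ∀ v : FinPlace A K, IsRamifiedAt M v.1 → v ∈ S) (n : ℕ)
    {x : IwasawaModule E inf S p M} (hx : x.1 n = 0) :
    ∃ y, iwasawaGal E inf S p (gammaGen e n) y - y = x := by
  have := compactSpace_iwasawaModule E hQ hinf hA (S := S) e
  refine exists_eq_of_forall_exists
    (fun y : IwasawaModule E inf S p M => iwasawaGal E inf S p (gammaGen e n) y - y)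
    (fun m x => x.1 m) (fun m => ?_) (fun i j => ?_)
    (fun u v h => Subtype.ext (funext h)) (fun m => ?_)
  · exact ((continuous_galMap E _).comp (IwasawaModule.continuous_component E m)).sub
      (IwasawaModule.continuous_component E m)
  · refine ⟨max i j, fun u v h => ⟨?_, ?_⟩⟩
    · rw [← u.2 i (max i j) (le_max_left _ _), ← v.2 i (max i j) (le_max_left _ _), h]
    · rw [← u.2 j (max i j) (le_max_right _ _), ← v.2 j (max i j) (le_max_right _ _), h]
  · rcases le_total m n with h | h
    -- At levels below `n` the component of `x` is a trace of its zero component at level `n`.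
    · refine ⟨0, ?_⟩
      rw [← x.2 m n h, hx, map_zero, map_zero, sub_zero]
      rfl
    · obtain ⟨z, hz⟩ := exists_galMap_sub_of_layerTrace_eq_zero E hQ hinf hA e hS h
        ((x.2 n m h).trans hx)
      obtain ⟨y, hy⟩ := IwasawaModule.component_surjective E hQ hinf hA e m z
      refine ⟨y, ?_⟩
      rw [← hz, ← hy]
      rfl

end Iwasawa

/-! ### Modules over the profinite completion -/

section ProfiniteModule

variable {A : Type*} [CommRing A]

/-- $A/\mathrm{Ann}(Z)$ embeds into the finite set of maps from `Z` to itself. -/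
theorem finite_quotient_annihilator (Z : Type*) [AddCommGroup Z] [Module A Z] [Finite Z] :
    Finite (A ⧸ Module.annihilator A Z) := by
  refine Finite.of_injective (fun c : A ⧸ Module.annihilator A Z =>
    Quotient.liftOn' c (fun a : A => fun z : Z => a • z) fun a b hab => funext fun z => ?_) ?_
  · rw [Submodule.quotientRel_def, Module.mem_annihilator] at hab
    rw [← sub_eq_zero, ← sub_smul, hab]
  · intro c d h
    induction c using Submodule.Quotient.induction_on with | _ a => ?_
    induction d using Submodule.Quotient.induction_on with | _ b => ?_
    refine (Submodule.Quotient.eq _).mpr (Module.mem_annihilator.mpr fun z => ?_)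
    rw [sub_smul, sub_eq_zero]
    exact congrFun h z

/-- The action of the profinite completion of `A` on a finite `A`-module. -/
def profiniteHom (Z : Type*) [AddCommGroup Z] [Module A Z] [Finite Z] :
    ProfiniteCompletion A →+* Module.End A Z :=
  (Ideal.Quotient.lift (Module.annihilator A Z) (algebraMap A (Module.End A Z)) fun a ha =>
    LinearMap.ext fun z => Module.mem_annihilator.mp ha z).comp
  ((Pi.evalRingHom _ (⟨_, finite_quotient_annihilator Z⟩ : {I : Ideal A // Finite (A ⧸ I)})).comp
    (profiniteSubring A).subtype)

theorem profiniteHom_apply {Z : Type*} [AddCommGroup Z] [Module A Z] [Finite Z]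
    (I : {I : Ideal A // Finite (A ⧸ I)}) (hI : ∀ a ∈ I.1, ∀ z : Z, a • z = 0)
    {c : ProfiniteCompletion A} {a : A} (h : c.1 I = Ideal.Quotient.mk I.1 a) (z : Z) :
    profiniteHom Z c z = a • z := by
  have hle : I.1 ≤ Module.annihilator A Z := fun a ha => Module.mem_annihilator.mpr (hI a ha)
  have h1 := c.2 I ⟨_, finite_quotient_annihilator Z⟩ hle
  rw [h, Ideal.Quotient.factor_mk] at h1
  change (Ideal.Quotient.lift (Module.annihilator A Z) (algebraMap A (Module.End A Z))
    (fun a ha => LinearMap.ext fun z => Module.mem_annihilator.mp ha z)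
    (c.1 ⟨_, finite_quotient_annihilator Z⟩) : Module.End A Z) z = _
  rw [← h1]
  rfl

/-- The annihilator of $Z\times Z'$ has finite index, so a single `a` in `A` represents the action
of `c` on both modules. -/
theorem map_profiniteHom {Z Z' : Type*} [AddCommGroup Z] [Module A Z] [Finite Z] [AddCommGroup Z']
    [Module A Z'] [Finite Z'] (φ : Z →ₗ[A] Z') (c : ProfiniteCompletion A) (z : Z) :
    φ (profiniteHom Z c z) = profiniteHom Z' c (φ z) := by
  let I : {I : Ideal A // Finite (A ⧸ I)} := ⟨_, finite_quotient_annihilator (A := A) (Z × Z')⟩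
  have hI : ∀ a ∈ I.1, ∀ z : Z × Z', a • z = 0 := fun a ha => Module.mem_annihilator.mp ha
  obtain ⟨a, ha⟩ := Ideal.Quotient.mk_surjective (c.1 I)
  rw [profiniteHom_apply I (fun a h z => congrArg Prod.fst (hI a h (z, 0))) ha.symm,
    profiniteHom_apply I (fun a h z => congrArg Prod.snd (hI a h (0, z))) ha.symm, map_smul]

theorem exists_quotient_span_equiv {R H H' : Type*} [Ring R] [AddCommGroup H] [Module R H]
    [AddCommGroup H'] [Module R H'] (T : H →ₗ[R] H') (hT : Function.Surjective T) {X : Set H}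
    (h₁ : ∀ x ∈ X, T x = 0) (h₂ : ∀ x, T x = 0 → x ∈ Submodule.span R X) :
    ∃ e : (H ⧸ Submodule.span R X) ≃ₗ[R] H', ∀ x, e (Submodule.Quotient.mk x) = T x :=
  ⟨(Submodule.quotEquivOfEq _ _ (le_antisymm
    (Submodule.span_le.mpr fun x hx => h₁ x hx) fun x hx => h₂ x hx)).trans
    (T.quotKerEquivOfSurjective hT), fun _ => rfl⟩

end ProfiniteModule

/-! ### The natural module structure of $H_S$ over the profinite completion. -/

section ClassGroupModule

variable {Fq A Q K : Type*} [Field Fq] [Fintype Fq] [CommRing A] [Algebra Fq A] [Field Q]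
  [Field K] [Algebra Fq K] [Algebra A K] [IsScalarTower Fq A K] [Algebra Q K]
  (E : DrinfeldModule Fq A K) {inf : ValuationSubring Q}
  {L L' : Type*} [Field L] [Algebra K L] [Algebra A L] [IsScalarTower A K L] [Algebra Q L]
  [IsScalarTower Q K L] [Field L'] [Algebra K L'] [Algebra A L'] [IsScalarTower A K L']
  [Algebra Q L'] [IsScalarTower Q K L'] [Algebra L L'] [IsScalarTower K L L']
  [IsIntegrallyClosedIn Fq A] [FaithfulSMul A K] {S : Set (FinPlace A K)}

/-- The module structure over the profinite completion of `A` on `H_S(E/𝒪_L)`. -/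
@[reducible] def sClassModule [∀ f : Moduli S L, Finite (ClassGroup E inf f.1)] :
    Module (ProfiniteCompletion A) (SClassGroup E inf S L) where
  smul c x := ⟨fun f => profiniteHom (ClassGroup E inf f.1) c (x.1 f), fun f g h => by
    beta_reduce
    rw [map_profiniteHom, x.2 f g h]⟩
  one_smul x := Subtype.ext (funext fun f =>
    congrArg (fun φ : Module.End A _ => φ (x.1 f)) (map_one (profiniteHom _)))
  mul_smul c d x := Subtype.ext (funext fun f =>
    congrArg (fun φ : Module.End A _ => φ (x.1 f)) (map_mul (profiniteHom _) c d))
  smul_zero c := Subtype.ext (funext fun f => map_zero (profiniteHom _ c))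
  smul_add c x y := Subtype.ext (funext fun f => map_add (profiniteHom _ c) (x.1 f) (y.1 f))
  add_smul c d x := Subtype.ext (funext fun f =>
    congrArg (fun φ : Module.End A _ => φ (x.1 f)) (map_add (profiniteHom _) c d))
  zero_smul x := Subtype.ext (funext fun f =>
    congrArg (fun φ : Module.End A _ => φ (x.1 f)) (map_zero (profiniteHom _)))

theorem isNaturalModule_sClassModule [∀ f : Moduli S L, Finite (ClassGroup E inf f.1)] :
    letI := sClassModule (L := L) (S := S) E (inf := inf)
    IsNaturalModule E inf S L := by
  intro f
  have hI : ∀ a ∈ Module.annihilator A (ClassGroup E inf f.1), ∀ z : ClassGroup E inf f.1,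
      a • z = 0 := fun a ha => Module.mem_annihilator.mp ha
  exact ⟨⟨_, finite_quotient_annihilator _⟩, hI, fun c a h x => profiniteHom_apply _ hI h _⟩

theorem limMap_smul [∀ f : Moduli S L, Finite (ClassGroup E inf f.1)]
    [∀ f : Moduli S L', Finite (ClassGroup E inf f.1)] (T : TauMap Fq K L' L)
    (pull : Moduli S L → Moduli S L')
    (hT : ∀ f, T.MapsInto (pull f).1 f.1) (hmono : ∀ f g, f.1 ≤ g.1 → (pull f).1 ≤ (pull g).1)
    (c : ProfiniteCompletion A) (x : SClassGroup E inf S L') :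
    letI := sClassModule (L := L) (S := S) E (inf := inf)
    letI := sClassModule (L := L') (S := S) E (inf := inf)
    limMap E inf T pull hT hmono (c • x) = c • limMap E inf T pull hT hmono x :=
  Subtype.ext (funext fun f => map_profiniteHom (classMap E inf T (hT f)) c (x.1 (pull f)))

theorem traceMap_smul [∀ f : Moduli S L, Finite (ClassGroup E inf f.1)]
    [∀ f : Moduli S L', Finite (ClassGroup E inf f.1)] (c : ProfiniteCompletion A)
    (x : SClassGroup E inf S L') :
    letI := sClassModule (L := L) (S := S) E (inf := inf)
    letI := sClassModule (L := L') (S := S) E (inf := inf)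
    traceMap L L' E inf S (c • x) = c • traceMap L L' E inf S x :=
  limMap_smul E _ _ _ _ c x

theorem galMap_smul [∀ f : Moduli S L, Finite (ClassGroup E inf f.1)] (σ : L ≃ₐ[K] L)
    (c : ProfiniteCompletion A) (x : SClassGroup E inf S L) :
    letI := sClassModule (L := L) (S := S) E (inf := inf)
    galMap E inf S σ (c • x) = c • galMap E inf S σ x :=
  limMap_smul E _ _ _ _ c x

end ClassGroupModule

/-! ### Coinvariants -/

section Coinvariants

variable {Fq A Q K : Type*} [Field Fq] [Fintype Fq] [CommRing A] [Algebra Fq A] [Field Q]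
  [Algebra Fq Q] [Algebra A Q] [FaithfulSMul A Q] [IsScalarTower Fq A Q]
  [Field K] [Algebra Fq K] [Algebra A K] [IsScalarTower Fq A K] [Algebra Q K]
  [IsScalarTower A Q K] (E : DrinfeldModule Fq A K) (hQ : IsGlobalFunctionField Fq Q)
  {inf : ValuationSubring Q} (hinf : inf ≠ ⊤)
  (hA : Set.range (algebraMap A Q) = regularRing Fq inf)
  {S : Set (FinPlace A K)} [IsIntegrallyClosedIn Fq A] [FaithfulSMul A K]
  {p : ℕ} [Fact p.Prime] [CharP Fq p] [FiniteDimensional Q K]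

include hQ hinf hA in
theorem exists_coinvariants_equiv {K' : Type*} [Field K'] [Algebra K K'] [Algebra A K']
    [IsScalarTower A K K'] [Algebra Q K'] [IsScalarTower Q K K'] [FiniteDimensional K K']
    [IsGalois K K'] (htame : ∀ v : FinPlace A K, v ∉ S → IsTameAt p K' v.1) :
    ∃ (_ : Module (ProfiniteCompletion A) (SClassGroup E inf S K'))
      (_ : Module (ProfiniteCompletion A) (SClassGroup E inf S K)),
      IsNaturalModule E inf S K' ∧ IsNaturalModule E inf S K ∧
      (∀ (σ : K' ≃ₐ[K] K') (c : ProfiniteCompletion A) (x : SClassGroup E inf S K'),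
        galMap E inf S σ (c • x) = c • galMap E inf S σ x) ∧
      ∃ e : (SClassGroup E inf S K' ⧸ Submodule.span (ProfiniteCompletion A)
            {y : SClassGroup E inf S K' | ∃ (σ : K' ≃ₐ[K] K') (x : SClassGroup E inf S K'),
              y = galMap E inf S σ x - x}) ≃ₗ[ProfiniteCompletion A] SClassGroup E inf S K,
        ∀ x : SClassGroup E inf S K', e (Submodule.Quotient.mk x) = traceMap K K' E inf S x := by
  have : ∀ f : Moduli S K, Finite (ClassGroup E inf f.1) := fun f =>
    finite_classGroup E hQ hinf hA f.2.1
  have : ∀ f : Moduli S K', Finite (ClassGroup E inf f.1) := fun f =>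
    finite_classGroup E hQ hinf hA f.2.1
  letI := sClassModule (L := K) (S := S) E (inf := inf)
  letI := sClassModule (L := K') (S := S) E (inf := inf)
  refine ⟨inferInstance, inferInstance, isNaturalModule_sClassModule E,
    isNaturalModule_sClassModule E, galMap_smul E, ?_⟩
  -- The hypothesis is indexed by places of `K`; it is applied to the place below `w`.
  have htame' : IsTameOutside p S K K' := fun w hw =>
    htame (w.below K) (fun h => hw ⟨_, h, rfl⟩) w.1 rfl
  refine exists_quotient_span_equiv
    ({ traceMap K K' E inf S with map_smul' := traceMap_smul E } :
      SClassGroup E inf S K' →ₗ[ProfiniteCompletion A] SClassGroup E inf S K)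
    (traceMap_surjective E hQ hinf hA) ?_ fun x hx => ?_
  · rintro _ ⟨σ, x, rfl⟩
    rw [map_sub, sub_eq_zero]
    exact traceMap_galRes E σ x
  · obtain ⟨y, rfl⟩ := exists_sum_of_traceMap_eq_zero E hQ hinf hA htame' hx
    exact Submodule.sum_mem _ fun σ _ => Submodule.subset_span ⟨σ, y σ, rfl⟩

include hQ hinf hA in
theorem exists_iwasawa_coinvariants_equiv {M : Type*} [Field M] [Algebra K M] [Algebra A M]
    [IsScalarTower A K M] [Algebra Q M] [IsScalarTower Q K M] [IsGalois K M]
    (e : (M ≃ₐ[K] M) ≃ₜ* Multiplicative ℤ_[p])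
    (hS : ∀ v : FinPlace A K, IsRamifiedAt M v.1 → v ∈ S) :
    ∃ (_ : ∀ n : ℕ, Module (ProfiniteCompletion A) (SClassGroup E inf S (layer K p M n)))
      (_ : Module (ProfiniteCompletion A) (IwasawaModule E inf S p M)),
      (∀ n : ℕ, IsNaturalModule E inf S (layer K p M n)) ∧
      (∀ (c : ProfiniteCompletion A) (x : IwasawaModule E inf S p M) (n : ℕ),
        (c • x).1 n = c • x.1 n) ∧
      (∀ (σ : M ≃ₐ[K] M) (c : ProfiniteCompletion A) (x : IwasawaModule E inf S p M),
        iwasawaGal E inf S p σ (c • x) = c • iwasawaGal E inf S p σ x) ∧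
      ∀ n : ℕ, ∃ e : (IwasawaModule E inf S p M ⧸ Submodule.span (ProfiniteCompletion A)
            {y : IwasawaModule E inf S p M | ∃ σ ∈ gammaPow K p M n,
              ∃ x : IwasawaModule E inf S p M, y = iwasawaGal E inf S p σ x - x})
          ≃ₗ[ProfiniteCompletion A] SClassGroup E inf S (layer K p M n),
        ∀ x : IwasawaModule E inf S p M, e (Submodule.Quotient.mk x) = x.1 n := by
  have := finiteDimensional_layer e
  have : ∀ (n : ℕ) (f : Moduli S (layer K p M n)), Finite (ClassGroup E inf f.1) := fun n f =>
    finite_classGroup E hQ hinf hA f.2.1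
  letI inst := fun n : ℕ => sClassModule (L := layer K p M n) (S := S) E (inf := inf)
  have hsmul : ∀ (c : ProfiniteCompletion A) (n m : ℕ) (h : n ≤ m)
      (x : SClassGroup E inf S (layer K p M m)),
      layerTrace E inf S p M h (c • x) = c • layerTrace E inf S p M h x := by
    intro c n m h x
    letI : Algebra (layer K p M n) (layer K p M m) :=
      (IntermediateField.inclusion (layer_mono p M h)).toAlgebra
    haveI : IsScalarTower K (layer K p M n) (layer K p M m) :=
      IsScalarTower.of_algebraMap_eq fun _ => rfl
    exact traceMap_smul E c x
  letI : Module (ProfiniteCompletion A) (IwasawaModule E inf S p M) :=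
    { smul := fun c x => ⟨fun n => c • x.1 n, fun n m h => by rw [hsmul, x.2 n m h]⟩
      one_smul := fun x => Subtype.ext (funext fun n => (inst n).one_smul (x.1 n))
      mul_smul := fun c d x => Subtype.ext (funext fun n => (inst n).mul_smul c d (x.1 n))
      smul_zero := fun c => Subtype.ext (funext fun n => (inst n).smul_zero c)
      smul_add := fun c x y => Subtype.ext (funext fun n => (inst n).smul_add c (x.1 n) (y.1 n))
      add_smul := fun c d x => Subtype.ext (funext fun n => (inst n).add_smul c d (x.1 n))
      zero_smul := fun x => Subtype.ext (funext fun n => (inst n).zero_smul (x.1 n)) }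
  refine ⟨inferInstance, inferInstance, fun n => isNaturalModule_sClassModule E, fun _ _ _ => rfl,
    fun σ c x => Subtype.ext (funext fun n =>
      galMap_smul E (layerAut p σ n) c (x.1 n)), fun n => ?_⟩
  refine exists_quotient_span_equiv
    ({ toFun := fun x => x.1 n, map_add' := fun _ _ => rfl, map_smul' := fun _ _ => rfl } :
      IwasawaModule E inf S p M →ₗ[ProfiniteCompletion A] SClassGroup E inf S (layer K p M n))
    (IwasawaModule.component_surjective E hQ hinf hA e n) ?_ fun x hx => ?_
  · rintro _ ⟨σ, hσ, x, rfl⟩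
    rw [map_sub, sub_eq_zero]
    change (iwasawaGal E inf S p σ x).1 n = x.1 n
    -- Elements of $\Gamma^{p^n}$ restrict to the identity on $K_n$.
    rw [iwasawaGal_apply, layerAut_eq_one hσ, galMap_one]
  · obtain ⟨y, rfl⟩ := exists_iwasawaGal_sub_of_component_eq_zero E hQ hinf hA e hS n hx
    exact Submodule.subset_span ⟨_, gammaGen_mem e n, y, rfl⟩

end Coinvariants

end TaelmanClassGroup

end

open TaelmanClassGroup in
theorem proposition3 {Fq Q K : Type*} [Field Fq] [Fintype Fq]
    [Field Q] [Algebra Fq Q] [IsIntegrallyClosedIn Fq Q] (hQ : IsGlobalFunctionField Fq Q)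
    (inf : ValuationSubring Q) (hinf : inf ≠ ⊤)
    [Field K] [Algebra Fq K] [Algebra Q K] [IsScalarTower Fq Q K]
    (hK : IsGlobalFunctionField Fq K)
    (p : ℕ) [Fact p.Prime] [CharP Fq p]
    (E : DrinfeldModule Fq (regularRing Fq inf) K)
    (S : Set (FinPlace (regularRing Fq inf) K)) (hS : S.Finite) :
    -- finite Galois extensions `K'/K`
    (∀ (K' : Type*) [Field K'] [Algebra K K'] [Algebra Q K'] [IsScalarTower Q K K']
      [FiniteDimensional K K'] [IsGalois K K'],
      (∀ v : FinPlace (regularRing Fq inf) K, v ∉ S → IsTameAt p K' v.1) →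
      ∃ (_ : Module (ProfiniteCompletion (regularRing Fq inf)) (SClassGroup E inf S K'))
        (_ : Module (ProfiniteCompletion (regularRing Fq inf)) (SClassGroup E inf S K)),
        IsNaturalModule E inf S K' ∧ IsNaturalModule E inf S K ∧
        (∀ (σ : K' ≃ₐ[K] K') (c : ProfiniteCompletion (regularRing Fq inf))
          (x : SClassGroup E inf S K'),
          galMap E inf S σ (c • x) = c • galMap E inf S σ x) ∧
        ∃ e : (SClassGroup E inf S K' ⧸
            Submodule.span (ProfiniteCompletion (regularRing Fq inf))
              {y : SClassGroup E inf S K' | ∃ (σ : K' ≃ₐ[K] K') (x : SClassGroup E inf S K'),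
                y = galMap E inf S σ x - x})
            ≃ₗ[ProfiniteCompletion (regularRing Fq inf)] SClassGroup E inf S K,
          ∀ x : SClassGroup E inf S K',
            e (Submodule.Quotient.mk x) = traceMap K K' E inf S x) ∧
    -- `ℤ_p`-extensions `M/K`
    (∀ (M : Type*) [Field M] [Algebra K M] [Algebra Q M] [IsScalarTower Q K M] [IsGalois K M],
      Nonempty ((M ≃ₐ[K] M) ≃ₜ* Multiplicative ℤ_[p]) →
      (∀ v : FinPlace (regularRing Fq inf) K, IsRamifiedAt M v.1 → v ∈ S) →
      ∃ (_ : ∀ n : ℕ, Module (ProfiniteCompletion (regularRing Fq inf))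
          (SClassGroup E inf S (layer K p M n)))
        (_ : Module (ProfiniteCompletion (regularRing Fq inf)) (IwasawaModule E inf S p M)),
        (∀ n : ℕ, IsNaturalModule E inf S (layer K p M n)) ∧
        (∀ (c : ProfiniteCompletion (regularRing Fq inf)) (x : IwasawaModule E inf S p M) (n : ℕ),
          (c • x).1 n = c • x.1 n) ∧
        (∀ (σ : M ≃ₐ[K] M) (c : ProfiniteCompletion (regularRing Fq inf))
          (x : IwasawaModule E inf S p M),
          iwasawaGal E inf S p σ (c • x) = c • iwasawaGal E inf S p σ x) ∧
        ∀ n : ℕ, ∃ e : (IwasawaModule E inf S p M ⧸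
            Submodule.span (ProfiniteCompletion (regularRing Fq inf))
              {y : IwasawaModule E inf S p M | ∃ σ ∈ gammaPow K p M n,
                ∃ x : IwasawaModule E inf S p M, y = iwasawaGal E inf S p σ x - x})
            ≃ₗ[ProfiniteCompletion (regularRing Fq inf)] SClassGroup E inf S (layer K p M n),
          ∀ x : IwasawaModule E inf S p M, e (Submodule.Quotient.mk x) = x.1 n) := by
  have := finiteDimensional_of_isGlobalFunctionField hQ inf hinf K hK
  have hA : Set.range (algebraMap (regularRing Fq inf) Q) = regularRing Fq inf :=
    Subtype.range_coe
  refine ⟨fun K' _ _ _ _ _ _ htame => exists_coinvariants_equiv E hQ hinf hA htame, ?_⟩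
  rintro M _ _ _ _ _ ⟨e⟩ hS
  exact exists_iwasawa_coinvariants_equiv E hQ hinf hA e hS
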